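/- Let $\mathbb T^4=(\mathbb R/\mathbb Z)^4$ and let $\mathscr S'$ be the space of real distributions on $\mathbb T^4$, i.e. the linear functionals on $C^\infty(\mathbb T^4,\mathbb R)$ that are bounded by a multiple of one of the seminorms $\max_{|\mu|\le j}\sup_x|\partial^\mu\phi(x)|$. Fix a dyadic partition of unity $(\rho_{-1},\rho_0)$ on $\mathbb R^4$: non-negative radial $C_c^\infty$ functions with $\operatorname{supp}\rho_{-1}\subset\{|y|\le 4/3\}$, $\operatorname{supp}\rho_0\subset\{3/4\le|y|\le 8/3\}$ and $\rho_{-1}(x)+\sum_{q\ge0}\rho_0(2^{-q}x)=1$ for all $x$. Put $\rho_q=\rho_0(2^{-q}\cdot)$ for $q\ge 0$ and, for $q\ge-1$, $K_q(x)=\sum_{m\in\mathbb Z^4}\rho_q(m)\cos(2\pi\langle x,m\rangle)$ and $\Delta_qf=K_q*f$ for $f\in\mathscr S'$. Let $$\|f\|_\alpha=\sup_{q\ge-1}2^{\alpha q}\|\Delta_qf\|_{L^\infty},\qquad \mathscr C^\alpha=\{f\in\mathscr S':\ \lim_{q\to\infty}2^{\alpha q}\|\Delta_qf\|_{L^\infty}=0\},$$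 let $C_U\mathscr C^\alpha$ be the space of $\|\cdot\|_\alpha$-continuous maps $[0,U]\to\mathscr C^\alpha$, and let $\|f\|_{C_U\mathscr C^\alpha}=\sup_{r\in[0,U]}\|f(r)\|_\alpha$. Let $P_0f=f$ and, for $r>0$, $P_rf=\eta_r*f$ with $\eta_r(x)=\sum_{m\in\mathbb Z^4}e^{-r|2\pi m|^4}\cos(2\pi\langle x,m\rangle)$. The product of $f,g\in\mathscr S'$ is $fg=\lim_{N\to\infty}\big(\sum_{i\le N}\Delta_if\big)\big(\sum_{j\le N}\Delta_jg\big)$ in $\mathscr S'$, whenever this limit exists; integrals of $\mathscr S'$-valued functions are taken after testing against smooth functions; $\Delta$ without index is the Laplacian. Let $\alpha\in(0,2)$, $g_1,g_5\in\mathscr C^\alpha$ and $g_2,g_3,g_4,g_6,g_7,g_8\in\bigcap_{U\ge0,\,\epsilon>0}C_U\mathscr C^{-\epsilon}$. Then there exist $c,\gamma_1>0$, $\gamma_2\in(0,1)$ and $\beta_1,\beta_2\in(0,+\infty]$ such that the following holds. (1) There is a unique $f_1\in\bigcap_{U\in[0,\beta_1)}C_U\mathscr C^\alpha$ such that for all $r\in[0,\beta_1)$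 $$f_1(r)=P_rg_1+\int_0^rP_{r-q}\,\Delta\big(f_1(q)^3+3f_1(q)^2g_2(q)+3f_1(q)g_3(q)+g_4(q)-f_1(q)-g_2(q)\big)\,dq,$$ and if $\beta_1<\infty$ then $\lim_{q\uparrow\beta_1}\|f_1(q)\|_\alpha=+\infty$. (2) There is a unique $f_2\in\bigcap_{U\in[0,\beta_2)}C_U\mathscr C^\alpha$ such that for all $r\in[0,\beta_2)$ $$f_2(r)=P_rg_5+\int_0^rP_{r-q}\,\Delta\big(f_2(q)^3+3f_2(q)^2g_6(q)+3f_2(q)g_7(q)+g_8(q)-f_2(q)-g_6(q)\big)\,dq,$$ and if $\beta_2<\infty$ then $\lim_{q\uparrow\beta_2}\|f_2(q)\|_\alpha=+\infty$. (3) For all $\sigma\ge0$ and $U\in[0,\min(\beta_1,\beta_2))$ with $\max(\|f_1\|_{C_U\mathscr C^\alpha},\|f_2\|_{C_U\mathscr C^\alpha})\le\sigma$, $$\|f_2-f_1\|_{C_U\mathscr C^\alpha}\le\Big(\|g_5-g_1\|_\alpha+c\,m_U\big((\sigma^2+1)\|g_6-g_2\|_{C_U\mathscr C^{-\gamma_1}}+\sigma\|g_7-g_3\|_{C_U\mathscr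 C^{-\gamma_1}}+\|g_8-g_4\|_{C_U\mathscr C^{-\gamma_1}}\big)\Big)\,e^{c\,m_U\left(2\sigma^2+2\sigma\|g_6\|_{C_U\mathscr C^{-\gamma_1}}+\|g_7\|_{C_U\mathscr C^{-\gamma_1}}+1\right)},$$ where $m_U=\max(U,U^{1-\gamma_2})$. (The numbers $c,\gamma_1,\gamma_2$ are chosen after the data $\alpha,g_1,\dots,g_8$.) -/

import Mathlib

open MeasureTheory Filter Topology
open scoped ENNReal NNReal

namespace CahnHilliard

noncomputable section

/-- The `d`-dimensional torus `(ℝ/ℤ)^d`, with its Haar probability measure `volume`. -/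
abbrev Torus (d : ℕ) : Type := UnitAddTorus (Fin d)

/-- The covering map `ℝ^d → 𝕋^d`. -/
def proj {d : ℕ} (x : EuclideanSpace ℝ (Fin d)) : Torus d := fun i => (x i : UnitAddCircle)

lemma proj_add_single {d : ℕ} (x : EuclideanSpace ℝ (Fin d)) (i : Fin d) (t : ℝ) :
    proj (x + t • EuclideanSpace.single i (1 : ℝ)) =
      proj x + Pi.single i (t : UnitAddCircle) := by
  funext j
  by_cases h : j = i
  · subst h; simp [proj]
  · simp [proj, h]

lemma proj_sub {d : ℕ} (x y : EuclideanSpace ℝ (Fin d)) : proj (x - y) = proj x - proj y := by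
  funext j; simp [proj]

lemma isQuotientMap_proj {d : ℕ} : IsQuotientMap (proj : EuclideanSpace ℝ (Fin d) → Torus d) := by
  have h1 : IsOpenQuotientMap
      (Pi.map (fun _ : Fin d => ((↑) : ℝ → UnitAddCircle))) :=
    IsOpenQuotientMap.piMap fun _ => QuotientAddGroup.isOpenQuotientMap_mk
  exact h1.isQuotientMap.comp (EuclideanSpace.equiv (Fin d) ℝ).toHomeomorph.isQuotientMap

/-! ### Test functions and distributions -/

/-- The space `C^∞(𝕋^d, ℝ)` of smooth functions on the torus. -/
def TestFun (d : ℕ) : Submodule ℝ (Torus d → ℝ) where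
  carrier := {φ | ContDiff ℝ (⊤ : ℕ∞) (fun x : EuclideanSpace ℝ (Fin d) => φ (proj x))}
  add_mem' {φ ψ} h1 h2 := by
    change ContDiff ℝ (⊤ : ℕ∞) fun x : EuclideanSpace ℝ (Fin d) => φ (proj x) + ψ (proj x)
    exact ContDiff.add h1 h2
  zero_mem' := by
    change ContDiff ℝ (⊤ : ℕ∞) fun _ : EuclideanSpace ℝ (Fin d) => (0 : ℝ)
    exact contDiff_const
  smul_mem' c φ h := by
    change ContDiff ℝ (⊤ : ℕ∞) fun x : EuclideanSpace ℝ (Fin d) => c • φ (proj x)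
    exact ContDiff.const_smul c h

lemma contDiff_testFun {d : ℕ} (φ : TestFun d) :
    ContDiff ℝ (⊤ : ℕ∞) (fun x : EuclideanSpace ℝ (Fin d) => φ.1 (proj x)) := φ.2

lemma continuous_testFun {d : ℕ} (φ : TestFun d) : Continuous φ.1 :=
  isQuotientMap_proj.continuous_iff.2 (contDiff_testFun φ).continuous

lemma hasDerivAt_testFun {d : ℕ} (φ : TestFun d) (i : Fin d)
    (y : EuclideanSpace ℝ (Fin d)) :
    HasDerivAt (fun t : ℝ => φ.1 (proj y + Pi.single i (t : UnitAddCircle)))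
      (fderiv ℝ (fun x => φ.1 (proj x)) y (EuclideanSpace.single i (1 : ℝ))) 0 := by
  have h := ((contDiff_testFun φ).differentiable (by simp) y).hasFDerivAt.hasLineDerivAt
    (EuclideanSpace.single i (1 : ℝ))
  unfold HasLineDerivAt at h
  simpa only [proj_add_single] using h

lemma differentiableAt_testFun {d : ℕ} (φ : TestFun d) (i : Fin d) (x : Torus d) :
    DifferentiableAt ℝ (fun t : ℝ => φ.1 (x + Pi.single i (t : UnitAddCircle))) 0 := by
  obtain ⟨y, rfl⟩ := isQuotientMap_proj.surjective x
  exact (hasDerivAt_testFun φ i y).differentiableAt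

/-- The partial derivative `∂_i` on test functions. -/
def pd {d : ℕ} (i : Fin d) : TestFun d →ₗ[ℝ] TestFun d where
  toFun φ := ⟨fun x => deriv (fun t : ℝ => φ.1 (x + Pi.single i (t : UnitAddCircle))) 0, by
    change ContDiff ℝ (⊤ : ℕ∞) _
    simp only [(hasDerivAt_testFun φ i _).deriv]
    exact ((contDiff_testFun φ).fderiv_right (m := (⊤ : ℕ∞)) (by simp)).clm_apply contDiff_const⟩
  map_add' φ ψ := by
    ext x
    exact deriv_add (differentiableAt_testFun φ i x) (differentiableAt_testFun ψ i x)
  map_smul' c φ := by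
    ext x
    exact deriv_const_mul c (differentiableAt_testFun φ i x)

/-- The iterated partial derivative `∂_{i₁} ⋯ ∂_{iₖ}` attached to a word `[i₁, …, iₖ]`.
As partial derivatives commute, the words of length at most `j` give exactly the derivatives
`∂^μ` with `|μ| ≤ j`. -/
def wordDeriv {d : ℕ} (l : List (Fin d)) : TestFun d →ₗ[ℝ] TestFun d :=
  (l.map fun i => (pd i : Module.End ℝ (TestFun d))).prod

/-- The seminorm `max_{|μ| ≤ j} sup_x |∂^μ φ(x)|`. -/
def testSeminorm {d : ℕ} (j : ℕ) (φ : TestFun d) : ℝ≥0∞ :=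
  ⨆ (l : List (Fin d)) (_ : l.length ≤ j) (x : Torus d), ‖(wordDeriv l φ).1 x‖ₑ

lemma testSeminorm_mono {d : ℕ} {j k : ℕ} (h : j ≤ k) (φ : TestFun d) :
    testSeminorm j φ ≤ testSeminorm k φ :=
  iSup_mono fun _ => iSup_le fun hl => le_iSup_of_le (hl.trans h) le_rfl

lemma enorm_le_testSeminorm {d : ℕ} {j : ℕ} (φ : TestFun d) (l : List (Fin d))
    (hl : l.length ≤ j) (x : Torus d) : ‖(wordDeriv l φ).1 x‖ₑ ≤ testSeminorm j φ :=
  le_iSup_of_le l (le_iSup_of_le hl (le_iSup_of_le x le_rfl))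

lemma testSeminorm_pd {d : ℕ} (j : ℕ) (i : Fin d) (φ : TestFun d) :
    testSeminorm j (pd i φ) ≤ testSeminorm (j + 1) φ := by
  refine iSup_le fun l => iSup_le fun hl => iSup_le fun x => ?_
  have h : wordDeriv l (pd i φ) = wordDeriv (l ++ [i]) φ := by
    simp [wordDeriv]
  rw [h]
  exact enorm_le_testSeminorm φ _ (by simpa using hl) x

/-- The space `𝒮'` of real distributions on the torus: the linear functionals on
`C^∞(𝕋^d, ℝ)` that are bounded by a multiple of one of the seminorms. -/
def Dist (d : ℕ) : Submodule ℝ (TestFun d →ₗ[ℝ] ℝ) where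
  carrier := {f | ∃ (c : ℝ≥0) (q : ℕ), ∀ φ, ‖f φ‖ₑ ≤ c * testSeminorm q φ}
  add_mem' := by
    rintro f g ⟨c, q, hf⟩ ⟨c', q', hg⟩
    refine ⟨c + c', max q q', fun φ => ?_⟩
    calc ‖f φ + g φ‖ₑ ≤ ‖f φ‖ₑ + ‖g φ‖ₑ := enorm_add_le _ _
      _ ≤ c * testSeminorm (max q q') φ + c' * testSeminorm (max q q') φ := by
        gcongr
        · exact (hf φ).trans (by gcongr; exact testSeminorm_mono (le_max_left _ _) φ)
        · exact (hg φ).trans (by gcongr; exact testSeminorm_mono (le_max_right _ _) φ)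
      _ = _ := by push_cast; ring
  zero_mem' := ⟨0, 0, fun φ => by simp⟩
  smul_mem' := by
    rintro a f ⟨c, q, hf⟩
    refine ⟨‖a‖₊ * c, q, fun φ => ?_⟩
    calc ‖a • f φ‖ₑ = ‖a‖ₑ * ‖f φ‖ₑ := enorm_smul _ _
      _ ≤ ‖a‖ₑ * (c * testSeminorm q φ) := by gcongr; exact hf φ
      _ = _ := by rw [ENNReal.coe_mul, mul_assoc]; rfl

/-- The distributional Laplacian, `⟨Δf, φ⟩ = ⟨f, Δφ⟩`. -/
def lap {d : ℕ} (f : Dist d) : Dist d :=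
  ⟨f.1 ∘ₗ ∑ i, pd i ∘ₗ pd i, by
    obtain ⟨c, q, hf⟩ := f.2
    refine ⟨c * d, q + 2, fun φ => ?_⟩
    simp only [LinearMap.comp_apply, LinearMap.sum_apply, map_sum]
    calc ‖∑ i, f.1 (pd i (pd i φ))‖ₑ ≤ ∑ i, ‖f.1 (pd i (pd i φ))‖ₑ := enorm_sum_le _ _
      _ ≤ ∑ _i : Fin d, c * testSeminorm (q + 2) φ := by
        gcongr with i
        exact (hf _).trans (by
          gcongr
          exact (testSeminorm_pd q i _).trans (testSeminorm_pd (q + 1) i φ))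
      _ = _ := by simp; ring⟩

/-! ### Convolution -/

/-- The test function `y ↦ φ (x - y)`. -/
def reflect {d : ℕ} (x : Torus d) (φ : TestFun d) : TestFun d :=
  ⟨fun y => φ.1 (x - y), by
    obtain ⟨z, rfl⟩ := isQuotientMap_proj.surjective x
    change ContDiff ℝ (⊤ : ℕ∞) _
    simp only [← proj_sub]
    exact (contDiff_testFun φ).comp (contDiff_const.sub contDiff_id)⟩

/-- The convolution `(K * f)(x) = ⟨f, K(x - ·)⟩` of a smooth function and a distribution. -/
def conv {d : ℕ} (K : TestFun d) (f : Dist d) (x : Torus d) : ℝ := f.1 (reflect x K)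

lemma pd_reflect {d : ℕ} (i : Fin d) (x : Torus d) (φ : TestFun d) :
    pd i (reflect x φ) = -reflect x (pd i φ) := by
  ext y
  change deriv (fun t : ℝ => φ.1 (x - (y + Pi.single i (t : UnitAddCircle)))) 0 =
    -deriv (fun t : ℝ => φ.1 (x - y + Pi.single i (t : UnitAddCircle))) 0
  have := deriv_comp_neg (fun t : ℝ => φ.1 (x - y + Pi.single i (t : UnitAddCircle))) 0
  rw [neg_zero] at this
  rw [← this]
  congr 1
  funext t
  rw [AddCircle.coe_neg, Pi.single_neg, sub_add_eq_sub_sub, sub_eq_add_neg (x - y)]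

lemma wordDeriv_reflect {d : ℕ} (l : List (Fin d)) (x : Torus d) (φ : TestFun d) :
    wordDeriv l (reflect x φ) = (-1 : ℝ) ^ l.length • reflect x (wordDeriv l φ) := by
  induction l with
  | nil => simp [wordDeriv]
  | cons i l ih =>
    have h (ψ : TestFun d) : wordDeriv (i :: l) ψ = pd i (wordDeriv l ψ) := by simp [wordDeriv]
    rw [h, h, ih, map_smul, pd_reflect, List.length_cons, pow_succ]
    module

lemma continuous_conv {d : ℕ} (K : TestFun d) (f : Dist d) : Continuous (conv K f) := by
  obtain ⟨c, q, hf⟩ := f.2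
  rw [continuous_iff_continuousAt]
  intro x
  have key : Tendsto (fun z => testSeminorm q (reflect z K - reflect x K)) (𝓝 x) (𝓝 0) := by
    rw [ENNReal.tendsto_nhds_zero]
    intro ε hε
    have hev : ∀ᶠ z in 𝓝 x, ∀ l ∈ {l : List (Fin d) | l.length ≤ q}, ∀ y : Torus d,
        edist ((wordDeriv l K).1 (z - y)) ((wordDeriv l K).1 (x - y)) ≤ ε := by
      rw [eventually_all_finite (List.finite_length_le _ _)]
      intro l _
      have hu : UniformContinuous (wordDeriv l K).1 :=
        CompactSpace.uniformContinuous_of_continuous (continuous_testFun (wordDeriv l K))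
      obtain ⟨δ, hδ, h⟩ := EMetric.uniformContinuous_iff.1 hu ε hε
      filter_upwards [Metric.eball_mem_nhds x hδ] with z hz y
      refine (h ?_).le
      rw [edist_sub_right]
      exact hz
    filter_upwards [hev] with z hz
    refine iSup_le fun l => iSup_le fun hl => iSup_le fun y => ?_
    have := hz l hl y
    rw [map_sub, wordDeriv_reflect, wordDeriv_reflect]
    change ‖(-1 : ℝ) ^ l.length • (wordDeriv l K).1 (z - y) -
      (-1 : ℝ) ^ l.length • (wordDeriv l K).1 (x - y)‖ₑ ≤ ε
    rw [← smul_sub, enorm_smul, enorm_pow, enorm_neg, enorm_one, one_pow, one_mul, ← edist_eq_enorm_sub]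
    exact this
  unfold ContinuousAt
  rw [tendsto_iff_edist_tendsto_0]
  have h2 : Tendsto (fun z => c * testSeminorm q (reflect z K - reflect x K)) (𝓝 x) (𝓝 0) := by
    simpa using ENNReal.Tendsto.const_mul key (Or.inr ENNReal.coe_ne_top)
  refine tendsto_of_tendsto_of_tendsto_of_le_of_le tendsto_const_nhds h2 (fun _ => zero_le) ?_
  intro z
  change edist (f.1 _) (f.1 _) ≤ _
  rw [edist_eq_enorm_sub, ← map_sub]
  exact hf _

lemma integrable_mul_testFun {d : ℕ} {u : Torus d → ℝ} (hu : Continuous u) (φ : TestFun d) :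
    Integrable (fun x => u x * φ.1 x) :=
  (hu.mul (continuous_testFun φ)).integrable_of_hasCompactSupport (HasCompactSupport.of_compactSpace _)

/-- A continuous function `u`, seen as the distribution `φ ↦ ∫ u φ`. -/
def ofContinuous {d : ℕ} (u : Torus d → ℝ) (hu : Continuous u) : Dist d :=
  ⟨{ toFun := fun φ => ∫ x, u x * φ.1 x
     map_add' := fun φ ψ => by
      rw [← integral_add (integrable_mul_testFun hu φ) (integrable_mul_testFun hu ψ)]
      simp [mul_add]
     map_smul' := fun a φ => by
      simp only [RingHom.id_apply, smul_eq_mul]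
      rw [← integral_const_mul]
      congr 1
      funext x
      change u x * (a * φ.1 x) = _
      ring }, by
    obtain ⟨M, hM⟩ := isCompact_univ.exists_bound_of_continuousOn (f := u) hu.continuousOn
    refine ⟨M.toNNReal, 0, fun φ => ?_⟩
    calc ‖∫ x, u x * φ.1 x‖ₑ ≤ ∫⁻ x, ‖u x * φ.1 x‖ₑ := enorm_integral_le_lintegral_enorm _
      _ ≤ ∫⁻ _x : Torus d, M.toNNReal * testSeminorm 0 φ := by
        refine lintegral_mono fun x => ?_
        rw [enorm_mul]
        gcongr
        · rw [← ofReal_norm]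
          exact ENNReal.ofReal_le_ofReal (hM x (Set.mem_univ x))
        · exact enorm_le_testSeminorm φ [] (by simp) x
      _ = _ := by
        have h : volume (Set.univ : Set (Torus d)) = 1 := by
          rw [← Set.pi_univ, volume_pi_pi]
          simp [AddCircle.measure_univ]
        rw [lintegral_const, h, mul_one]⟩

/-! ### Cosine series -/

/-- The Fourier mode `x ↦ cos (2π⟨x, m⟩)` on the torus, for `m ∈ ℤ^d`. -/
def cosMode {d : ℕ} (m : Fin d → ℤ) (x : Torus d) : ℝ := (UnitAddTorus.mFourier m x).re

lemma cosMode_proj {d : ℕ} (m : Fin d → ℤ) (x : EuclideanSpace ℝ (Fin d)) :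
    cosMode m (proj x) = Real.cos (2 * Real.pi * ∑ i, x i * m i) := by
  have h : UnitAddTorus.mFourier m (proj x) =
      Complex.exp ((2 * Real.pi * ∑ i, x i * m i : ℝ) * Complex.I) := by
    simp only [UnitAddTorus.mFourier, ContinuousMap.coe_mk, proj, fourier_coe_apply]
    rw [← Complex.exp_sum]
    congr 1
    push_cast
    rw [Finset.mul_sum, Finset.sum_mul]
    refine Finset.sum_congr rfl fun i _ => ?_
    ring
  rw [cosMode, h, Complex.exp_ofReal_mul_I_re]

/-- The sum `∑_{m ∈ ℤ^d} a(m) cos (2π⟨x, m⟩)`. -/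
def cosSeries {d : ℕ} (a : (Fin d → ℤ) → ℝ) (x : Torus d) : ℝ := ∑' m, a m * cosMode m x

lemma norm_iteratedFDeriv_cosMode {d : ℕ} (m : Fin d → ℤ) (k : ℕ)
    (x : EuclideanSpace ℝ (Fin d)) :
    ‖iteratedFDeriv ℝ k (fun x : EuclideanSpace ℝ (Fin d) => cosMode m (proj x)) x‖ ≤
      (2 * Real.pi * ∑ i, |(m i : ℝ)|) ^ k := by
  let L : EuclideanSpace ℝ (Fin d) →L[ℝ] ℝ :=
    (2 * Real.pi) • ∑ i, (m i : ℝ) • (EuclideanSpace.proj i : EuclideanSpace ℝ (Fin d) →L[ℝ] ℝ)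
  have hL : (fun x : EuclideanSpace ℝ (Fin d) => cosMode m (proj x)) = Real.cos ∘ L := by
    funext y
    rw [cosMode_proj]
    simp [L, mul_comm]
  have hn : ‖L‖ ≤ 2 * Real.pi * ∑ i, |(m i : ℝ)| := by
    refine L.opNorm_le_bound (by positivity) fun y => ?_
    have : L y = 2 * Real.pi * ∑ i, (m i : ℝ) * y i := by simp [L]
    rw [this, norm_mul, Real.norm_of_nonneg (by positivity), mul_assoc (2 * Real.pi), Finset.sum_mul]
    gcongr
    refine (norm_sum_le _ _).trans (Finset.sum_le_sum fun i _ => ?_)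
    rw [norm_mul, Real.norm_eq_abs]
    gcongr
    exact PiLp.norm_apply_le y i
  rw [hL, ContinuousLinearMap.iteratedFDeriv_comp_right L Real.contDiff_cos x
    (i := k) (n := (k : WithTop ℕ∞)) le_rfl]
  refine (ContinuousMultilinearMap.norm_compContinuousLinearMap_le _ _).trans ?_
  rw [Finset.prod_const, Finset.card_univ, Fintype.card_fin, norm_iteratedFDeriv_eq_norm_iteratedDeriv]
  have h1 : ‖iteratedDeriv k Real.cos (L x)‖ ≤ 1 := by
    rw [Real.norm_eq_abs]
    exact Real.abs_iteratedDeriv_cos_le_one k _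
  calc _ ≤ 1 * (2 * Real.pi * ∑ i, |(m i : ℝ)|) ^ k := by gcongr
    _ = _ := one_mul _

lemma contDiff_cosSeries {d : ℕ} (a : (Fin d → ℤ) → ℝ)
    (ha : ∀ k : ℕ, Summable fun m : Fin d → ℤ => |a m| * (∑ i, |(m i : ℝ)|) ^ k) :
    ContDiff ℝ (⊤ : ℕ∞) (fun x : EuclideanSpace ℝ (Fin d) => cosSeries a (proj x)) := by
  have hs (m : Fin d → ℤ) :
      ContDiff ℝ (⊤ : ℕ∞) (fun x : EuclideanSpace ℝ (Fin d) => cosMode m (proj x)) := by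
    simp only [cosMode_proj]
    fun_prop
  refine contDiff_tsum (v := fun k m => (2 * Real.pi) ^ k * (|a m| * (∑ i, |(m i : ℝ)|) ^ k))
    (fun m => contDiff_const.mul (hs m)) (fun k _ => (ha k).mul_left _) ?_
  intro k m x _
  have h := iteratedFDeriv_const_smul_apply (𝕜 := ℝ) (i := k) (a := a m) (x := x)
    ((hs m).contDiffAt.of_le (by exact_mod_cast le_top))
  have h' : (fun x : EuclideanSpace ℝ (Fin d) => a m * cosMode m (proj x)) =
      a m • fun x : EuclideanSpace ℝ (Fin d) => cosMode m (proj x) := rfl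
  rw [h', h, norm_smul, Real.norm_eq_abs]
  calc _ ≤ |a m| * (2 * Real.pi * ∑ i, |(m i : ℝ)|) ^ k := by
        gcongr
        exact norm_iteratedFDeriv_cosMode m k x
    _ = _ := by rw [mul_pow]; ring

/-- A cosine series with rapidly decreasing coefficients, as a smooth function. -/
def cosTest {d : ℕ} (a : (Fin d → ℤ) → ℝ)
    (ha : ∀ k : ℕ, Summable fun m : Fin d → ℤ => |a m| * (∑ i, |(m i : ℝ)|) ^ k) : TestFun d :=
  ⟨cosSeries a, contDiff_cosSeries a ha⟩

/-! ### Littlewood-Paley blocks and Besov spaces -/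

/-- A dyadic partition of unity `(ρ₋₁, ρ₀)` on `ℝ^d`. -/
structure DyadicPartition (d : ℕ) where
  /-- the low-frequency cutoff `ρ₋₁` -/
  low : EuclideanSpace ℝ (Fin d) → ℝ
  /-- the annular cutoff `ρ₀` -/
  ann : EuclideanSpace ℝ (Fin d) → ℝ
  low_nonneg : ∀ x, 0 ≤ low x
  ann_nonneg : ∀ x, 0 ≤ ann x
  low_radial : ∀ x y, ‖x‖ = ‖y‖ → low x = low y
  ann_radial : ∀ x y, ‖x‖ = ‖y‖ → ann x = ann y
  low_smooth : ContDiff ℝ (⊤ : ℕ∞) low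
  ann_smooth : ContDiff ℝ (⊤ : ℕ∞) ann
  low_support : tsupport low ⊆ {y | ‖y‖ ≤ 4 / 3}
  ann_support : tsupport ann ⊆ {y | 3 / 4 ≤ ‖y‖ ∧ ‖y‖ ≤ 8 / 3}
  sum_eq_one : ∀ x, HasSum (fun q : ℕ => ann ((2 : ℝ)⁻¹ ^ q • x)) (1 - low x)

/-- An integer frequency as a vector of `ℝ^d`. -/
def freq {d : ℕ} (m : Fin d → ℤ) : EuclideanSpace ℝ (Fin d) := WithLp.toLp 2 fun i => (m i : ℝ)

/-- The dyadic cutoffs with index shifted by one: `rho 0 = ρ₋₁` and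
`rho (q + 1) = ρ_q = ρ₀(2^{-q} ·)`. -/
def DyadicPartition.rho {d : ℕ} (χ : DyadicPartition d) : ℕ → EuclideanSpace ℝ (Fin d) → ℝ
  | 0, x => χ.low x
  | q + 1, x => χ.ann ((2 : ℝ)⁻¹ ^ q • x)

lemma DyadicPartition.exists_bound {d : ℕ} (χ : DyadicPartition d) (k : ℕ) :
    ∃ R : ℝ, ∀ x, χ.rho k x ≠ 0 → ‖x‖ ≤ R := by
  cases k with
  | zero => exact ⟨4 / 3, fun x hx => χ.low_support (subset_tsupport _ hx)⟩
  | succ q =>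
    refine ⟨2 ^ q * (8 / 3), fun x hx => ?_⟩
    have h := (χ.ann_support (subset_tsupport _ hx)).2
    rw [norm_smul, norm_pow, norm_inv, Real.norm_ofNat, inv_pow,
      inv_mul_le_iff₀ (by positivity)] at h
    exact h

lemma DyadicPartition.finite_support {d : ℕ} (χ : DyadicPartition d) (k : ℕ) :
    (Function.support fun m : Fin d → ℤ => χ.rho k (freq m)).Finite := by
  obtain ⟨R, hR⟩ := χ.exists_bound k
  refine (Set.Finite.pi' (t := fun _ : Fin d => Set.Icc (-⌈R⌉) ⌈R⌉)
    fun _ => Set.finite_Icc _ _).subset fun m hm i => ?_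
  have h1 : |(m i : ℝ)| ≤ R := (PiLp.norm_apply_le (freq m) i).trans (hR _ hm)
  have h2 : |m i| ≤ ⌈R⌉ := by
    have : ((|m i| : ℤ) : ℝ) ≤ (⌈R⌉ : ℝ) := by
      push_cast
      exact h1.trans (Int.le_ceil R)
    exact_mod_cast this
  exact abs_le.1 h2

/-- The kernel `K_{k-1} = ∑_{m ∈ ℤ^d} ρ_{k-1}(m) cos (2π⟨·, m⟩)`. -/
def DyadicPartition.kernel {d : ℕ} (χ : DyadicPartition d) (k : ℕ) : TestFun d :=
  cosTest (fun m => χ.rho k (freq m)) fun j =>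
    summable_of_hasFiniteSupport ((χ.finite_support k).subset fun m hm h => hm (by simp [h]))

/-- The Littlewood-Paley block `Δ_{k-1} f = K_{k-1} * f`. -/
def DyadicPartition.block {d : ℕ} (χ : DyadicPartition d) (k : ℕ) (f : Dist d) : Torus d → ℝ :=
  conv (χ.kernel k) f

/-- The Besov norm `‖f‖_α = sup_{k ∈ ℕ} 2^{α(k-1)} ‖Δ_{k-1} f‖_{L^∞}`, with values in `[0, ∞]`. -/
def DyadicPartition.besov {d : ℕ} (χ : DyadicPartition d) (α : ℝ) (f : Dist d) : ℝ≥0∞ :=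
  ⨆ k : ℕ, ENNReal.ofReal ((2 : ℝ) ^ (α * ((k : ℝ) - 1))) * eLpNorm (χ.block k f) ⊤ volume

/-- The Besov space `𝒞^α`: the distributions with `2^{αq} ‖Δ_q f‖_{L^∞} → 0`. -/
def DyadicPartition.MemC {d : ℕ} (χ : DyadicPartition d) (α : ℝ) (f : Dist d) : Prop :=
  Tendsto (fun q : ℕ =>
    ENNReal.ofReal ((2 : ℝ) ^ (α * (q : ℝ))) * eLpNorm (χ.block (q + 1) f) ⊤ volume) atTop (𝓝 0)

/-- `f` restricts to an element of `C_U 𝒞^α`: a map `[0, U] → 𝒞^α` that is continuous for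
`‖·‖_α`. -/
def DyadicPartition.MemCC {d : ℕ} (χ : DyadicPartition d) (U α : ℝ) (f : ℝ → Dist d) : Prop :=
  (∀ t ∈ Set.Icc 0 U, χ.MemC α (f t)) ∧
    ∀ t ∈ Set.Icc 0 U, Tendsto (fun s => χ.besov α (f s - f t)) (𝓝[Set.Icc 0 U] t) (𝓝 0)

/-- The norm `‖f‖_{C_U 𝒞^α} = sup_{r ∈ [0, U]} ‖f(r)‖_α`, with values in `[0, ∞]`. -/
def DyadicPartition.supBesov {d : ℕ} (χ : DyadicPartition d) (U α : ℝ) (f : ℝ → Dist d) : ℝ≥0∞ :=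
  ⨆ r ∈ Set.Icc 0 U, χ.besov α (f r)

/-! ### Products -/

/-- The partial sum `∑_{k ≤ N} Δ_{k-1} f`. -/
def DyadicPartition.partialSum {d : ℕ} (χ : DyadicPartition d) (N : ℕ) (f : Dist d)
    (x : Torus d) : ℝ :=
  ∑ k ∈ Finset.range (N + 1), χ.block k f x

/-- `h` is the product of `f` and `g`: the partial sums of `∑_{i,j} Δ_i f Δ_j g` converge to `h`
in the sense of distributions. -/
def DyadicPartition.IsProd {d : ℕ} (χ : DyadicPartition d) (f g h : Dist d) : Prop :=
  ∀ φ : TestFun d, Tendsto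
    (fun N : ℕ => ∫ x, χ.partialSum N f x * χ.partialSum N g x * φ.1 x) atTop (𝓝 (h.1 φ))

open Classical in
/-- The product of two distributions (zero by convention if the product does not exist). -/
def DyadicPartition.mul {d : ℕ} (χ : DyadicPartition d) (f g : Dist d) : Dist d :=
  if h : ∃ p, χ.IsProd f g p then h.choose else 0

/-- The product does not depend on a choice. -/
lemma DyadicPartition.IsProd.mul_eq {d : ℕ} {χ : DyadicPartition d} {f g p : Dist d}
    (h : χ.IsProd f g p) : χ.mul f g = p := by
  have hex : ∃ p, χ.IsProd f g p := ⟨p, h⟩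
  rw [DyadicPartition.mul, dif_pos hex]
  ext φ
  exact tendsto_nhds_unique (hex.choose_spec φ) (h φ)

/-! ### The semigroup generated by `-Δ²` -/

lemma summable_prod_pi {d : ℕ} {w : ℤ → ℝ} (hw : Summable w) (h0 : ∀ n, 0 ≤ w n) :
    Summable fun m : Fin d → ℤ => ∏ i, w (m i) := by
  refine summable_of_sum_le (c := ∏ _i : Fin d, ∑' n, w n)
    (fun m => Finset.prod_nonneg fun i _ => h0 _) fun s => ?_
  calc ∑ m ∈ s, ∏ i, w (m i)
      ≤ ∑ m ∈ Fintype.piFinset fun i : Fin d => s.image fun m => m i, ∏ i, w (m i) := by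
        refine Finset.sum_le_sum_of_subset_of_nonneg (fun m hm => ?_)
          fun m _ _ => Finset.prod_nonneg fun i _ => h0 _
        rw [Fintype.mem_piFinset]
        exact fun i => Finset.mem_image_of_mem _ hm
    _ = ∏ i : Fin d, ∑ n ∈ s.image fun m => m i, w n := (Finset.prod_univ_sum _ _).symm
    _ ≤ _ := Finset.prod_le_prod (fun i _ => Finset.sum_nonneg fun n _ => h0 n)
        fun i _ => hw.sum_le_tsum _ fun n _ => h0 n

lemma summable_heat {d : ℕ} {r : ℝ} (hr : 0 < r) (k : ℕ) :
    Summable fun m : Fin d → ℤ =>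
      |Real.exp (-(r * (2 * Real.pi * ‖freq m‖) ^ 4))| * (∑ i, |(m i : ℝ)|) ^ k := by
  have hw : Summable fun n : ℤ => (1 + (n : ℝ) ^ 2)⁻¹ := by
    have h2 : Summable fun n : ℤ => 1 / (n : ℝ) ^ 2 :=
      Real.summable_one_div_int_pow.2 one_lt_two
    refine Summable.of_norm_bounded_eventually h2 ?_
    filter_upwards [(Set.finite_singleton (0 : ℤ)).compl_mem_cofinite] with n hn
    have hn' : (n : ℝ) ≠ 0 := by exact_mod_cast hn
    rw [Real.norm_of_nonneg (by positivity), one_div]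
    gcongr
    linarith
  obtain ⟨C, hC⟩ : ∃ C : ℝ, ∀ t : ℝ, 0 ≤ t → (1 + t) ^ (k + d) * Real.exp (-(r * t)) ≤ C := by
    have ht : Tendsto (fun t : ℝ => (1 + t) ^ (k + d) * Real.exp (-(r * t))) atTop (𝓝 0) := by
      have h1 := (Real.tendsto_pow_mul_exp_neg_atTop_nhds_zero (k + d)).comp
        (tendsto_atTop_add_const_left atTop r (tendsto_id.const_mul_atTop hr))
      have h2 := h1.const_mul (r⁻¹ ^ (k + d) * Real.exp r)
      rw [mul_zero] at h2
      refine h2.congr fun t => ?_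
      have : r + r * t = r * (1 + t) := by ring
      simp only [Function.comp, id, this]
      rw [mul_pow, show -(r * (1 + t)) = -r + -(r * t) by ring, Real.exp_add, Real.exp_neg r,
        inv_pow]
      field_simp
    have hcont : Continuous fun t : ℝ => (1 + t) ^ (k + d) * Real.exp (-(r * t)) := by fun_prop
    obtain ⟨T, hT⟩ := eventually_atTop.1 (ht.eventually (gt_mem_nhds one_pos))
    obtain ⟨M, hM⟩ := (isCompact_Icc (a := (0 : ℝ)) (b := T)).exists_bound_of_continuousOn
      hcont.continuousOn
    refine ⟨max M 1, fun t ht0 => ?_⟩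
    rcases le_total t T with h | h
    · exact (le_abs_self _).trans ((hM t ⟨ht0, h⟩).trans (le_max_left _ _))
    · exact (hT t h).le.trans (le_max_right _ _)
  refine Summable.of_nonneg_of_le (fun m => by positivity) (fun m => ?_)
    ((summable_prod_pi hw fun n => by positivity).mul_left C)
  set N : ℝ := ∑ i, (m i : ℝ) ^ 2 with hN
  have hN0 : 0 ≤ N := Finset.sum_nonneg fun i _ => sq_nonneg _
  have hfreq : ‖freq m‖ ^ 2 = N := by
    rw [EuclideanSpace.norm_sq_eq]
    simp [freq, hN]
  have hNsq : N ≤ N ^ 2 := by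
    have : ∃ a : ℕ, N = a := ⟨∑ i, (m i).natAbs ^ 2, by
      rw [hN]
      push_cast
      exact Finset.sum_congr rfl fun i _ => by rw [Nat.cast_natAbs, Int.cast_abs, sq_abs]⟩
    obtain ⟨a, ha⟩ := this
    rw [ha]
    exact_mod_cast Nat.le_self_pow two_ne_zero a
  have hexp : N ≤ (2 * Real.pi * ‖freq m‖) ^ 4 := by
    have h1 : (2 * Real.pi * ‖freq m‖) ^ 4 = (2 * Real.pi) ^ 4 * N ^ 2 := by
      rw [← hfreq]; ring
    have h2 : (1 : ℝ) ≤ (2 * Real.pi) ^ 4 := one_le_pow₀ (by linarith [Real.pi_gt_three])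
    rw [h1]
    nlinarith [sq_nonneg N]
  have hsum : ∑ i, |(m i : ℝ)| ≤ 1 + N := by
    have : ∑ i, |(m i : ℝ)| ≤ N := Finset.sum_le_sum fun i _ => by
      have := Int.natAbs_le_self_sq (m i)
      rw [← Int.cast_abs, Int.abs_eq_natAbs]
      exact_mod_cast this
    linarith
  have hprod : ∏ i, (1 + (m i : ℝ) ^ 2) ≤ (1 + N) ^ d := by
    calc ∏ i, (1 + (m i : ℝ) ^ 2) ≤ ∏ _i : Fin d, (1 + N) := by
          refine Finset.prod_le_prod (fun i _ => by positivity) fun i _ => ?_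
          have := Finset.single_le_sum (f := fun i => (m i : ℝ) ^ 2)
            (fun i _ => sq_nonneg _) (Finset.mem_univ i)
          simpa using this
      _ = _ := by simp
  have hpos : 0 < ∏ i, (1 + (m i : ℝ) ^ 2) := Finset.prod_pos fun i _ => by positivity
  rw [Finset.prod_inv_distrib, ← div_eq_mul_inv, le_div_iff₀ hpos, Real.abs_exp]
  calc _ ≤ Real.exp (-(r * N)) * (1 + N) ^ k * (1 + N) ^ d := by gcongr
    _ = (1 + N) ^ (k + d) * Real.exp (-(r * N)) := by rw [pow_add]; ring
    _ ≤ C := hC N hN0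

/-- The kernel `η_r = ∑_{m ∈ ℤ^d} e^{-r|2πm|⁴} cos (2π⟨·, m⟩)`, for `r > 0`. -/
def heatKernel {d : ℕ} (r : ℝ) (hr : 0 < r) : TestFun d :=
  cosTest (fun m => Real.exp (-(r * (2 * Real.pi * ‖freq m‖) ^ 4))) (summable_heat hr)

/-- The semigroup `P_r f = η_r * f` for `r > 0`, `P_0 f = f`. -/
def semigroup {d : ℕ} (r : ℝ) (f : Dist d) : Dist d :=
  if hr : 0 < r then ofContinuous (conv (heatKernel r hr) f) (continuous_conv _ f) else f

/-! ### The mild equation -/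

/-- The nonlinearity `f³ + 3f²a + 3fb + c - f - a`. -/
def DyadicPartition.nonlin {d : ℕ} (χ : DyadicPartition d) (f a b c : Dist d) : Dist d :=
  χ.mul (χ.mul f f) f + (3 : ℝ) • χ.mul (χ.mul f f) a + (3 : ℝ) • χ.mul f b + c - f - a

/-- `f` is, on `[0, β)`, an element of `⋂_{U < β} C_U 𝒞^α` that solves
`f(r) = P_r g + ∫_0^r P_{r-q} (Δ (f³ + 3f²a + 3fb + c - f - a)(q)) dq` for every `r ∈ [0, β)`.
The integral of distributions is taken weakly, that is, after testing against every smooth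
function. -/
def DyadicPartition.IsMildSolution {d : ℕ} (χ : DyadicPartition d) (α : ℝ) (g : Dist d)
    (a b c : ℝ → Dist d) (β : ℝ≥0∞) (f : ℝ → Dist d) : Prop :=
  (∀ U : ℝ, 0 ≤ U → ENNReal.ofReal U < β → χ.MemCC U α f) ∧
  ∀ r : ℝ, 0 ≤ r → ENNReal.ofReal r < β → ∀ φ : TestFun d,
    IntervalIntegrable
      (fun q => (semigroup (r - q) (lap (χ.nonlin (f q) (a q) (b q) (c q)))).1 φ) volume 0 r ∧
    (f r).1 φ = (semigroup r g).1 φ +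
      ∫ q in (0 : ℝ)..r, (semigroup (r - q) (lap (χ.nonlin (f q) (a q) (b q) (c q)))).1 φ

/-- `f` is the unique solution on `[0, β)`, in the sense that every solution on `[0, β)` agrees
with it there. -/
def DyadicPartition.IsUniqueMildSolution {d : ℕ} (χ : DyadicPartition d) (α : ℝ) (g : Dist d)
    (a b c : ℝ → Dist d) (β : ℝ≥0∞) (f : ℝ → Dist d) : Prop :=
  χ.IsMildSolution α g a b c β f ∧
  ∀ h : ℝ → Dist d, χ.IsMildSolution α g a b c β h →
    ∀ r : ℝ, 0 ≤ r → ENNReal.ofReal r < β → h r = f r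

/-- If `β` is finite, then `‖f(q)‖_α → ∞` as `q ↑ β`. -/
def DyadicPartition.BlowsUpAt {d : ℕ} (χ : DyadicPartition d) (α : ℝ) (β : ℝ≥0∞)
    (f : ℝ → Dist d) : Prop :=
  β ≠ ⊤ → Tendsto (fun q => χ.besov α (f q)) (𝓝[<] β.toReal) (𝓝 ⊤)

end

end CahnHilliard

namespace CahnHilliard

open UnitAddTorus
open scoped FourierTransform SchwartzMap ComplexConjugate

noncomputable section

/-! ### Fourier analysis on the torus -/

/-! Both equations have the form f' = -Δ²f + ΔN(t, f) with N cubic in f. They are solved as fixed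
point problems in 𝒞^α, where N takes values in 𝒞^{-γ} for a small γ > 0. Three analytic facts carry
this.

Smoothing. A Fourier multiplier with symbol φ(εm) averages translates with weight 𝓕φ, so it is
bounded on L^∞ by ‖𝓕φ‖_{L¹}, whatever ε is (`norm_sum_multiplier_le`). Localizing the symbols of P_r
and Δ to a dyadic annulus and rescaling bounds P_rΔ on the k-th block by C 4^k / (1 + r 16^k). Hence
P_rΔ maps 𝒞^{-γ} to 𝒞^α with norm at most C r^{-θ}, θ = (α+2+γ)/4 < 1
(`exists_besovBound_semigroup_lap`), an integrable singularity.

Products. The k-th block of a product of blocks i and j vanishes unless the frequencies are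
compatible (`block_mul_eq_zero`). Geometric series then give bounded products 𝒞^α × 𝒞^α → 𝒞^α and
𝒞^α × 𝒞^{-γ} → 𝒞^{-γ} (`exists_mul_bound`, `exists_mul_bound_neg`), without splitting into
paraproducts. So N is locally Lipschitz.

Function spaces. The spaces `Bes χ β` are complete for β > -2, because pairing a block with a test
function gains 4^{-k} (`exists_integral_block_le`). Testing against a smooth function is then a
continuous functional, which identifies the weakly defined integral with a Bochner integral
(`duhamel_apply`). On the closed subspace `little χ α` the semigroup is strongly continuous.

The rest is an abstract theory of mild solutions for a `SmoothingPair`. Weighting by e^{-λt} makes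
the Duhamel operator small and gives a Gronwall inequality and global solutions for Lipschitz
nonlinearities. A radial truncation of N gives continuation of bounded solutions. A lower bound on
the time in which the norm can grow (`exists_delay`) upgrades unboundedness at a finite lifetime to
convergence of the norm to infinity.

For the stability estimate (`exists_stability`) the constant may depend on the data, hence on the
two maximal solutions. On a fixed short interval [0, V] these are bounded functions, so one
Lipschitz constant serves all σ. For U ≥ V the trivial bound 2σ on the difference is already below
the right side once c is large, provided the data differ; if they do not, the solutions coincide.
The delicate point is the coefficient 1 of ‖g₅ - g₁‖, since P_r is bounded but not contractive: for
the fixed element g₅ - g₁ of the little space one has ‖P_r x‖ ≤ (1 + Br)‖x‖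
(`exists_norm_semigroup_le`), and the error Br is absorbed by the exponential. -/

instance isProbabilityMeasure_torus {d : ℕ} :
    IsProbabilityMeasure (volume : Measure (Torus d)) :=
  ⟨by rw [← Set.pi_univ, volume_pi_pi]; simp [AddCircle.measure_univ]⟩

lemma mFourier_proj {d : ℕ} (m : Fin d → ℤ) (x : EuclideanSpace ℝ (Fin d)) :
    mFourier m (proj x) = Complex.exp ((2 * Real.pi * ∑ i, x i * m i : ℝ) * Complex.I) := by
  simp only [mFourier, ContinuousMap.coe_mk, proj, fourier_coe_apply]
  rw [← Complex.exp_sum]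
  congr 1
  push_cast
  rw [Finset.mul_sum, Finset.sum_mul]
  refine Finset.sum_congr rfl fun i _ => ?_
  ring

lemma mFourier_apply_add {d : ℕ} (m : Fin d → ℤ) (x y : Torus d) :
    mFourier m (x + y) = mFourier m x * mFourier m y := by
  simp only [mFourier, ContinuousMap.coe_mk, Pi.add_apply, fourier_apply, smul_add,
    AddCircle.toCircle_add, Circle.coe_mul, Finset.prod_mul_distrib]

lemma mFourier_apply_neg {d : ℕ} (m : Fin d → ℤ) (x : Torus d) :
    mFourier m (-x) = conj (mFourier m x) := by
  rw [← mFourier_neg]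
  simp [mFourier, fourier_apply]

lemma norm_mFourier_apply {d : ℕ} (m : Fin d → ℤ) (x : Torus d) : ‖mFourier m x‖ = 1 := by
  simp only [mFourier, fourier_apply, ContinuousMap.coe_mk, norm_prod, Circle.norm_coe,
    Finset.prod_const_one]

lemma mFourier_single_coe {d : ℕ} (m : Fin d → ℤ) (i : Fin d) (t : ℝ) :
    mFourier m (Pi.single i (t : UnitAddCircle)) =
      Complex.exp ((2 * Real.pi * (m i * t) : ℝ) * Complex.I) := by
  have h : (Pi.single i (t : UnitAddCircle) : Torus d) = proj (EuclideanSpace.single i t) := by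
    funext j
    by_cases h : j = i
    · subst h; simp [proj]
    · simp [proj, h]
  rw [h, mFourier_proj]
  congr 4
  rw [Finset.sum_eq_single i] <;> simp +contextual [mul_comm]

/-- Translating by half a period in a direction with m_i ≠ 0 changes the sign of the mode, while the
integral is translation invariant. -/
lemma integral_mFourier {d : ℕ} (m : Fin d → ℤ) :
    ∫ x, mFourier m x = if m = 0 then 1 else 0 := by
  split_ifs with h
  · simp [h, mFourier_zero]
  · obtain ⟨i, hi⟩ := Function.ne_iff.1 h
    have hi' : (m i : ℝ) ≠ 0 := by exact_mod_cast hi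
    have h1 : mFourier m (Pi.single i (((2 * (m i : ℝ))⁻¹ : ℝ) : UnitAddCircle)) = -1 := by
      rw [mFourier_single_coe]
      rw [show (2 * Real.pi * (m i * (2 * (m i : ℝ))⁻¹) : ℝ) = Real.pi by field_simp]
      exact Complex.exp_pi_mul_I
    have h2 := integral_add_right_eq_self (μ := (volume : Measure (Torus d)))
      (fun x => mFourier m x) (Pi.single i (((2 * (m i : ℝ))⁻¹ : ℝ) : UnitAddCircle))
    simp only [mFourier_apply_add, h1, mul_neg, mul_one, integral_neg] at h2
    have h3 : (2 : ℂ) * ∫ x, mFourier m x = 0 := by linear_combination -h2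
    simpa using h3

lemma integrable_continuousMap {d : ℕ} {F : Type*} [NormedAddCommGroup F] (u : C(Torus d, F)) :
    Integrable (fun x => u x) :=
  u.continuous.integrable_of_hasCompactSupport (HasCompactSupport.of_compactSpace _)

/-- The Fourier coefficient `∫ e_{-m} u` as a continuous functional. -/
def coeff {d : ℕ} (m : Fin d → ℤ) : C(Torus d, ℂ) →L[ℂ] ℂ :=
  LinearMap.mkContinuous
    { toFun := fun u => ∫ x, mFourier (-m) x * u x
      map_add' := fun u v => by
        refine Eq.trans ?_ (integral_add (integrable_continuousMap (mFourier (-m) * u))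
          (integrable_continuousMap (mFourier (-m) * v)))
        simp [mul_add]
      map_smul' := fun c u => by
        simp only [RingHom.id_apply, smul_eq_mul, ContinuousMap.smul_apply]
        rw [← integral_const_mul]
        congr 1
        funext x
        ring } 1 fun u => by
    refine (norm_integral_le_of_norm_le_const (C := ‖u‖) (ae_of_all _ fun x => ?_)).trans ?_
    · rw [norm_mul, norm_mFourier_apply, one_mul]
      exact u.norm_coe_le_norm x
    · simp

lemma coeff_apply {d : ℕ} (m : Fin d → ℤ) (u : C(Torus d, ℂ)) :
    coeff m u = ∫ x, mFourier (-m) x * u x := rfl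

lemma norm_coeff_le {d : ℕ} (m : Fin d → ℤ) (u : C(Torus d, ℂ)) : ‖coeff m u‖ ≤ ‖u‖ := by
  refine (norm_integral_le_of_norm_le_const (C := ‖u‖) (ae_of_all _ fun x => ?_)).trans ?_
  · rw [norm_mul, norm_mFourier_apply, one_mul]
    exact u.norm_coe_le_norm x
  · simp

lemma coeff_mFourier_mul {d : ℕ} (m n : Fin d → ℤ) (u : C(Torus d, ℂ)) :
    coeff m (mFourier n * u) = coeff (m - n) u := by
  simp only [coeff_apply, ContinuousMap.mul_apply]
  congr 1
  funext x
  rw [← mul_assoc, ← mFourier_add]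
  congr 3
  abel

lemma coeff_mFourier {d : ℕ} (m n : Fin d → ℤ) :
    coeff m (mFourier n) = if m = n then 1 else 0 := by
  have h := coeff_mFourier_mul m n 1
  rw [mul_one] at h
  rw [h, coeff_apply]
  simp only [ContinuousMap.one_apply, mul_one]
  rw [integral_mFourier]
  simp [sub_eq_zero, eq_comm]

lemma dense_span_mFourier {d : ℕ} :
    Dense (Submodule.span ℂ (Set.range (mFourier (d := Fin d))) : Set C(Torus d, ℂ)) := by
  rw [Submodule.dense_iff_topologicalClosure_eq_top]
  exact span_mFourier_closure_eq_top

/-! ### Fourier multipliers as averages of translates -/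

/-- The `L¹` norm of the Fourier transform of a Schwartz function. -/
def fourierL1 {d : ℕ} (φ : 𝓢(EuclideanSpace ℝ (Fin d), ℂ)) : ℝ := ∫ y, ‖𝓕 φ y‖

lemma fourierL1_nonneg {d : ℕ} (φ : 𝓢(EuclideanSpace ℝ (Fin d), ℂ)) : 0 ≤ fourierL1 φ :=
  integral_nonneg fun _ => norm_nonneg _

lemma continuous_proj {d : ℕ} : Continuous (proj : EuclideanSpace ℝ (Fin d) → Torus d) :=
  isQuotientMap_proj.continuous

lemma sum_mul_eq_inner_freq {d : ℕ} (x : EuclideanSpace ℝ (Fin d)) (m : Fin d → ℤ) :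
    ∑ i, x i * m i = inner ℝ x (freq m) := by
  simp [PiLp.inner_apply, freq, mul_comm]

/-- A Fourier multiplier acts on the torus by averaging translations. -/
lemma sum_multiplier_eq_integral {d : ℕ} (φ : 𝓢(EuclideanSpace ℝ (Fin d), ℂ)) (ε : ℝ)
    (F : Finset (Fin d → ℤ)) (hF : ∀ m, m ∉ F → φ (ε • freq m) = 0)
    (u : C(Torus d, ℂ)) (x : Torus d) :
    ∑ m ∈ F, φ (ε • freq m) * coeff m u * mFourier m x =
      ∫ y, 𝓕 φ y * u (x + proj (ε • y)) := by
  have hint (u : C(Torus d, ℂ)) : Integrable fun y => 𝓕 φ y * u (x + proj (ε • y)) := by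
    refine (𝓕 φ).integrable.mul_bdd (c := ‖u‖) ?_ (ae_of_all _ fun y => u.norm_coe_le_norm _)
    exact (u.continuous.comp (continuous_const.add
      (continuous_proj.comp (continuous_const_smul ε)))).aestronglyMeasurable
  let L1 : C(Torus d, ℂ) →L[ℂ] ℂ :=
    ∑ m ∈ F, (φ (ε • freq m) * mFourier m x) • coeff m
  let L2 : C(Torus d, ℂ) →L[ℂ] ℂ := LinearMap.mkContinuous
    { toFun := fun u => ∫ y, 𝓕 φ y * u (x + proj (ε • y))
      map_add' := fun u v => by
        rw [← integral_add (hint u) (hint v)]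
        simp [mul_add]
      map_smul' := fun c u => by
        simp only [RingHom.id_apply, smul_eq_mul, ContinuousMap.smul_apply]
        rw [← integral_const_mul]
        congr 1
        funext x
        ring } (fourierL1 φ) fun u => by
    simp only [LinearMap.coe_mk, AddHom.coe_mk]
    rw [fourierL1, ← integral_mul_const]
    refine norm_integral_le_of_norm_le ((𝓕 φ).integrable.norm.mul_const _) (ae_of_all _ fun y => ?_)
    rw [norm_mul]
    gcongr
    exact u.norm_coe_le_norm _
  -- Both sides are continuous in u, so it suffices to compare them on the modes, where the identity
  -- is Fourier inversion for φ at the point ε • freq n.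
  have h : L1 = L2 := by
    refine ContinuousLinearMap.ext_on dense_span_mFourier ?_
    rintro _ ⟨n, rfl⟩
    have h1 : L1 (mFourier n) = φ (ε • freq n) * mFourier n x := by
      simp only [L1, sum_apply, smul_apply, coeff_mFourier,
        smul_eq_mul, mul_ite, mul_one, mul_zero, Finset.sum_ite_eq']
      split_ifs with hn
      · rfl
      · rw [hF n hn, zero_mul]
    have h2 : L2 (mFourier n) = ∫ y, 𝓕 φ y * mFourier n (x + proj (ε • y)) := rfl
    have h3 : 𝓕⁻ (𝓕 φ) (ε • freq n) = φ (ε • freq n) := by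
      rw [FourierTransform.fourierInv_fourier_eq]
    rw [SchwartzMap.fourierInv_coe, Real.fourierInv_eq'] at h3
    rw [h1, h2, ← h3, ← integral_mul_const]
    congr 1
    funext y
    rw [mFourier_apply_add, mFourier_proj, sum_mul_eq_inner_freq, inner_smul_left, inner_smul_right,
      smul_eq_mul, ← mul_assoc (2 * Real.pi)]
    simp only [conj_trivial, mul_assoc]
    ring
  have := congrArg (fun L => L u) h
  refine Eq.trans ?_ this
  simp only [L1, sum_apply, smul_apply, smul_eq_mul]
  refine Finset.sum_congr rfl fun m _ => ?_
  ring

/-- The bound does not see ε: this is the source of all estimates that are uniform over the dyadic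
blocks. -/
lemma norm_sum_multiplier_le {d : ℕ} (φ : 𝓢(EuclideanSpace ℝ (Fin d), ℂ)) (ε : ℝ)
    (F : Finset (Fin d → ℤ)) (hF : ∀ m, m ∉ F → φ (ε • freq m) = 0)
    (u : C(Torus d, ℂ)) (x : Torus d) :
    ‖∑ m ∈ F, φ (ε • freq m) * coeff m u * mFourier m x‖ ≤ fourierL1 φ * ‖u‖ := by
  rw [sum_multiplier_eq_integral φ ε F hF, fourierL1, ← integral_mul_const]
  refine norm_integral_le_of_norm_le ((𝓕 φ).integrable.norm.mul_const _) (ae_of_all _ fun y => ?_)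
  rw [norm_mul]
  gcongr
  exact u.norm_coe_le_norm _

/-! ### Fourier modes as test functions -/

lemma hasDerivAt_mFourier {d : ℕ} (m : Fin d → ℤ) (i : Fin d) (x : Torus d) :
    HasDerivAt (fun t : ℝ => mFourier m (x + Pi.single i (t : UnitAddCircle)))
      (2 * Real.pi * m i * Complex.I * mFourier m x) 0 := by
  simp only [mFourier_apply_add, mFourier_single_coe]
  have h1 : HasDerivAt (fun t : ℝ => ((2 * Real.pi * (m i * t) : ℝ) * Complex.I : ℂ))
      (2 * Real.pi * m i * Complex.I) 0 := by
    have := (((hasDerivAt_id (0 : ℝ)).const_mul (m i : ℝ)).const_mul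
      (2 * Real.pi)).ofReal_comp.mul_const Complex.I
    refine this.congr_deriv ?_
    simp
  refine (h1.cexp.const_mul (mFourier m x)).congr_deriv ?_
  simp only [mul_zero, Complex.ofReal_zero, zero_mul, Complex.exp_zero, one_mul]
  ring

/-- The Fourier mode `x ↦ sin (2π⟨x, m⟩)`. -/
def sinMode {d : ℕ} (m : Fin d → ℤ) (x : Torus d) : ℝ := (mFourier m x).im

lemma sinMode_proj {d : ℕ} (m : Fin d → ℤ) (x : EuclideanSpace ℝ (Fin d)) :
    sinMode m (proj x) = Real.sin (2 * Real.pi * ∑ i, x i * m i) := by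
  rw [sinMode, mFourier_proj, Complex.exp_ofReal_mul_I_im]

/-- The mode `cos (2π⟨·, m⟩)` as a test function. -/
def cosT {d : ℕ} (m : Fin d → ℤ) : TestFun d :=
  ⟨cosMode m, by
    change ContDiff ℝ (⊤ : ℕ∞) _
    simp only [cosMode_proj]
    fun_prop⟩

/-- The mode `sin (2π⟨·, m⟩)` as a test function. -/
def sinT {d : ℕ} (m : Fin d → ℤ) : TestFun d :=
  ⟨sinMode m, by
    change ContDiff ℝ (⊤ : ℕ∞) _
    simp only [sinMode_proj]
    fun_prop⟩

lemma pd_apply_eq {d : ℕ} {i : Fin d} {φ : TestFun d} {x : Torus d} {D : ℝ}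
    (h : HasDerivAt (fun t : ℝ => φ.1 (x + Pi.single i (t : UnitAddCircle))) D 0) :
    (pd i φ).1 x = D := h.deriv

lemma coe_smul_testFun {d : ℕ} (c : ℝ) (φ : TestFun d) (x : Torus d) :
    (c • φ).1 x = c * φ.1 x := rfl

lemma coe_add_testFun {d : ℕ} (φ ψ : TestFun d) (x : Torus d) :
    (φ + ψ).1 x = φ.1 x + ψ.1 x := rfl

lemma pd_cosT {d : ℕ} (i : Fin d) (m : Fin d → ℤ) :
    pd i (cosT m) = (-(2 * Real.pi * m i)) • sinT m := by
  refine Subtype.ext (funext fun x => ?_)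
  have h := Complex.reCLM.hasFDerivAt.comp_hasDerivAt (0 : ℝ) (hasDerivAt_mFourier m i x)
  have h' : (pd i (cosT m)).1 x = _ := pd_apply_eq (φ := cosT m) h
  rw [h', coe_smul_testFun]
  simp [sinT, sinMode]

lemma pd_sinT {d : ℕ} (i : Fin d) (m : Fin d → ℤ) :
    pd i (sinT m) = (2 * Real.pi * m i) • cosT m := by
  refine Subtype.ext (funext fun x => ?_)
  have h := Complex.imCLM.hasFDerivAt.comp_hasDerivAt (0 : ℝ) (hasDerivAt_mFourier m i x)
  have h' : (pd i (sinT m)).1 x = _ := pd_apply_eq (φ := sinT m) h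
  rw [h', coe_smul_testFun]
  simp [cosT, cosMode]

/-! ### Integration by parts for Fourier coefficients -/

/-- A real continuous function, seen as a complex one. -/
def cx {d : ℕ} (u : Torus d → ℝ) (hu : Continuous u) : C(Torus d, ℂ) :=
  ⟨fun x => (u x : ℂ), Complex.continuous_ofReal.comp hu⟩

@[simp] lemma cx_apply {d : ℕ} (u : Torus d → ℝ) (hu : Continuous u) (x : Torus d) :
    cx u hu x = (u x : ℂ) := rfl

lemma norm_cx_le {d : ℕ} {u : Torus d → ℝ} (hu : Continuous u) {M : ℝ} (hM : 0 ≤ M)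
    (h : ∀ x, |u x| ≤ M) : ‖cx u hu‖ ≤ M := by
  refine (ContinuousMap.norm_le _ hM).2 fun x => ?_
  simpa using h x

lemma hasDerivAt_testFun_translate {d : ℕ} (φ : TestFun d) (i : Fin d) (x : Torus d) (t₀ : ℝ) :
    HasDerivAt (fun t : ℝ => φ.1 (x + Pi.single i (t : UnitAddCircle)))
      ((pd i φ).1 (x + Pi.single i (t₀ : UnitAddCircle))) t₀ := by
  have h := (differentiableAt_testFun φ i (x + Pi.single i (t₀ : UnitAddCircle))).hasDerivAt
  rw [← sub_self t₀] at h
  have h2 := h.comp_sub_const t₀ t₀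
  rw [sub_self] at h2
  refine h2.congr_of_eventuallyEq (Eventually.of_forall fun t => ?_)
  change φ.1 _ = φ.1 _
  rw [add_assoc, ← Pi.single_add, ← AddCircle.coe_add, add_sub_cancel]

lemma exists_bound_testFun {d : ℕ} (φ : TestFun d) : ∃ M, 0 ≤ M ∧ ∀ x, |φ.1 x| ≤ M := by
  obtain ⟨M, hM⟩ := isCompact_univ.exists_bound_of_continuousOn (continuous_testFun φ).continuousOn
  exact ⟨max M 0, le_max_right _ _, fun x => (hM x (Set.mem_univ x)).trans (le_max_left _ _)⟩

lemma continuous_translate_testFun {d : ℕ} (φ : TestFun d) (a : Torus d) :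
    Continuous fun x => φ.1 (x + a) :=
  (continuous_testFun φ).comp (continuous_id.add continuous_const)

lemma hasDerivAt_integral_translate {d : ℕ} (u : C(Torus d, ℂ)) (φ : TestFun d) (i : Fin d) :
    HasDerivAt (fun t : ℝ => ∫ x, u x * (φ.1 (x + Pi.single i (t : UnitAddCircle)) : ℂ))
      (∫ x, u x * ((pd i φ).1 (x + Pi.single i ((0 : ℝ) : UnitAddCircle)) : ℂ)) 0 := by
  obtain ⟨M, hM0, hM⟩ := exists_bound_testFun (pd i φ)
  refine (hasDerivAt_integral_of_dominated_loc_of_deriv_le (μ := (volume : Measure (Torus d)))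
    (F := fun (t : ℝ) x => u x * (φ.1 (x + Pi.single i (t : UnitAddCircle)) : ℂ))
    (F' := fun (t : ℝ) x => u x * ((pd i φ).1 (x + Pi.single i (t : UnitAddCircle)) : ℂ))
    (x₀ := 0) (s := Set.univ) (bound := fun _ => ‖u‖ * M) Filter.univ_mem
    (Eventually.of_forall fun t => ?_) ?_ ?_ ?_ (integrable_const _) ?_).2
  · exact (u * cx _ (continuous_translate_testFun φ _)).continuous.aestronglyMeasurable
  · exact integrable_continuousMap (u * cx _ (continuous_translate_testFun φ _))
  · exact (u * cx _ (continuous_translate_testFun (pd i φ) _)).continuous.aestronglyMeasurable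
  · refine ae_of_all _ fun x t _ => ?_
    rw [norm_mul, Complex.norm_real]
    exact mul_le_mul (u.norm_coe_le_norm x) (hM _) (norm_nonneg _) (norm_nonneg _)
  · exact ae_of_all _ fun x t _ => ((hasDerivAt_testFun_translate φ i x t).ofReal_comp).const_mul _

lemma integral_mFourier_mul_translate {d : ℕ} (m : Fin d → ℤ) (u : C(Torus d, ℂ)) (a : Torus d) :
    ∫ x, mFourier (-m) x * u (x + a) = coeff m u * mFourier m a := by
  have h := integral_add_right_eq_self (μ := (volume : Measure (Torus d)))
    (fun x => mFourier (-m) x * u x * mFourier m a) a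
  rw [coeff_apply, ← integral_mul_const, ← h]
  congr 1
  funext x
  rw [mFourier_apply_add]
  have : mFourier (-m) a * mFourier m a = 1 := by
    rw [← mFourier_add, neg_add_cancel, mFourier_zero, ContinuousMap.one_apply]
  linear_combination -(mFourier (-m) x * u (x + a)) * this

/-- Integration by parts. -/
lemma coeff_pd {d : ℕ} (m : Fin d → ℤ) (i : Fin d) (φ : TestFun d) :
    coeff m (cx (pd i φ).1 (continuous_testFun _)) =
      2 * Real.pi * m i * Complex.I * coeff m (cx φ.1 (continuous_testFun _)) := by
  -- The m-th coefficient of the translates of φ is differentiated in two ways: under the integral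
  -- sign, and after moving the translation onto the mode.
  have h1 := hasDerivAt_integral_translate (mFourier (-m)) φ i
  have h2 (t : ℝ) := integral_mFourier_mul_translate m (cx φ.1 (continuous_testFun _))
    (Pi.single i (t : UnitAddCircle))
  simp only [cx_apply] at h2
  simp only [h2] at h1
  have h3 := (hasDerivAt_mFourier m i 0).const_mul (coeff m (cx φ.1 (continuous_testFun _)))
  simp only [zero_add] at h3
  have h4 := h1.unique h3
  have h5 : mFourier m (0 : Torus d) = 1 := by
    simp only [mFourier, ContinuousMap.coe_mk, Pi.zero_apply, fourier_eval_zero,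
      Finset.prod_const_one]
  rw [h5] at h4
  simp only [AddCircle.coe_zero, Pi.single_zero, add_zero] at h4
  rw [coeff_apply]
  simp only [cx_apply]
  rw [h4]
  ring

end

end CahnHilliard

namespace CahnHilliard

open UnitAddTorus
open scoped FourierTransform SchwartzMap ComplexConjugate

noncomputable section

/-! ### Reconstruction of a distribution from its blocks -/

lemma freq_zero {d : ℕ} : freq (0 : Fin d → ℤ) = 0 := by
  ext i; simp [freq]

lemma freq_neg {d : ℕ} (m : Fin d → ℤ) : freq (-m) = -freq m := by
  ext i; simp [freq]

lemma freq_sub {d : ℕ} (m n : Fin d → ℤ) : freq (m - n) = freq m - freq n := by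
  ext i; simp [freq]

lemma DyadicPartition.rho_nonneg {d : ℕ} (χ : DyadicPartition d) (k : ℕ)
    (x : EuclideanSpace ℝ (Fin d)) : 0 ≤ χ.rho k x := by
  cases k with
  | zero => exact χ.low_nonneg x
  | succ q => exact χ.ann_nonneg _

lemma DyadicPartition.rho_neg {d : ℕ} (χ : DyadicPartition d) (k : ℕ)
    (x : EuclideanSpace ℝ (Fin d)) : χ.rho k (-x) = χ.rho k x := by
  cases k with
  | zero => exact χ.low_radial _ _ (norm_neg x)
  | succ q => exact χ.ann_radial _ _ (by rw [smul_neg, norm_neg])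

/-- Compare the partition identity at x with the one at 2^{-N}x: the tails agree. Thus a truncated
sum of blocks is a multiplier with one dilated cutoff. -/
lemma DyadicPartition.sum_rho {d : ℕ} (χ : DyadicPartition d) (N : ℕ)
    (x : EuclideanSpace ℝ (Fin d)) :
    ∑ k ∈ Finset.range (N + 1), χ.rho k x = χ.low ((2 : ℝ)⁻¹ ^ N • x) := by
  rw [Finset.sum_range_succ']
  have h1 := (hasSum_nat_add_iff' N).2 (χ.sum_eq_one x)
  have h2 := χ.sum_eq_one ((2 : ℝ)⁻¹ ^ N • x)
  simp only [smul_smul, ← pow_add] at h2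
  have h3 := h1.unique h2
  simp only [rho]
  linarith

lemma DyadicPartition.low_zero {d : ℕ} (χ : DyadicPartition d) : χ.low 0 = 1 := by
  have h := χ.sum_eq_one 0
  have h0 : χ.ann 0 = 0 := by
    by_contra h0
    have := (χ.ann_support (subset_tsupport _ h0)).1
    norm_num at this
  simp only [smul_zero, h0] at h
  have := h.unique hasSum_zero
  linarith

lemma DyadicPartition.rho_le_one {d : ℕ} (χ : DyadicPartition d) (k : ℕ)
    (x : EuclideanSpace ℝ (Fin d)) : χ.rho k x ≤ 1 := by
  have h (y) : χ.low y ≤ 1 := by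
    have := (χ.sum_eq_one y).nonneg fun q => χ.ann_nonneg _
    linarith
  calc χ.rho k x ≤ ∑ j ∈ Finset.range (k + 1), χ.rho j x :=
        Finset.single_le_sum (f := fun j => χ.rho j x) (fun j _ => χ.rho_nonneg j x) (by simp)
    _ ≤ 1 := by rw [χ.sum_rho]; exact h _

lemma DyadicPartition.norm_le_of_rho_ne_zero {d : ℕ} (χ : DyadicPartition d) {k : ℕ}
    {x : EuclideanSpace ℝ (Fin d)} (hx : χ.rho k x ≠ 0) : ‖x‖ ≤ 4 / 3 * 2 ^ k := by
  cases k with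
  | zero => simpa using χ.low_support (subset_tsupport _ hx)
  | succ q =>
    have h := (χ.ann_support (subset_tsupport _ hx)).2
    rw [norm_smul, norm_pow, norm_inv, Real.norm_ofNat, inv_pow,
      inv_mul_le_iff₀ (by positivity)] at h
    rw [pow_succ]
    linarith

lemma DyadicPartition.le_norm_of_rho_ne_zero {d : ℕ} (χ : DyadicPartition d) {k : ℕ} (hk : k ≠ 0)
    {x : EuclideanSpace ℝ (Fin d)} (hx : χ.rho k x ≠ 0) : 3 / 8 * 2 ^ k ≤ ‖x‖ := by
  obtain ⟨q, rfl⟩ := Nat.exists_eq_succ_of_ne_zero hk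
  have h := (χ.ann_support (subset_tsupport _ hx)).1
  rw [norm_smul, norm_pow, norm_inv, Real.norm_ofNat, inv_pow, ← div_eq_inv_mul,
    le_div_iff₀ (by positivity)] at h
  rw [Nat.succ_eq_add_one, pow_succ]
  linarith

/-- The finite set of frequencies of the `k`-th block. -/
def DyadicPartition.modes {d : ℕ} (χ : DyadicPartition d) (k : ℕ) : Finset (Fin d → ℤ) :=
  (χ.finite_support k).toFinset

lemma DyadicPartition.mem_modes {d : ℕ} (χ : DyadicPartition d) {k : ℕ} {m : Fin d → ℤ} :
    m ∈ χ.modes k ↔ χ.rho k (freq m) ≠ 0 := by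
  simp [modes]

/-! ### Convergence of frequency truncations -/

/-- The complexification of a compactly supported smooth function, as a Schwartz function. -/
def schwartzOf {d : ℕ} (φ : EuclideanSpace ℝ (Fin d) → ℝ) (h1 : HasCompactSupport φ)
    (h2 : ContDiff ℝ (⊤ : ℕ∞) φ) : 𝓢(EuclideanSpace ℝ (Fin d), ℂ) :=
  HasCompactSupport.toSchwartzMap (f := fun x => (φ x : ℂ))
    (h1.comp_left (g := fun t : ℝ => (t : ℂ)) Complex.ofReal_zero)
    (Complex.ofRealCLM.contDiff.comp h2)

lemma schwartzOf_apply {d : ℕ} (φ : EuclideanSpace ℝ (Fin d) → ℝ) (h1 : HasCompactSupport φ)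
    (h2 : ContDiff ℝ (⊤ : ℕ∞) φ) (x) : schwartzOf φ h1 h2 x = (φ x : ℂ) := rfl

lemma hasCompactSupport_of_subset_ball {d : ℕ} {φ : EuclideanSpace ℝ (Fin d) → ℝ} {R : ℝ}
    (h : ∀ x, φ x ≠ 0 → ‖x‖ ≤ R) : HasCompactSupport φ :=
  HasCompactSupport.of_support_subset_isCompact (isCompact_closedBall 0 R) fun x hx => by
    simpa using h x hx

lemma DyadicPartition.low_compact {d : ℕ} (χ : DyadicPartition d) : HasCompactSupport χ.low :=
  hasCompactSupport_of_subset_ball fun _ hx => χ.low_support (subset_tsupport _ hx)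

lemma DyadicPartition.ann_compact {d : ℕ} (χ : DyadicPartition d) : HasCompactSupport χ.ann :=
  hasCompactSupport_of_subset_ball fun _ hx => (χ.ann_support (subset_tsupport _ hx)).2

/-- The frequency truncation `∑_{k ≤ N} Δ_{k-1}` on complex continuous functions. -/
def DyadicPartition.trunc {d : ℕ} (χ : DyadicPartition d) (N : ℕ) :
    C(Torus d, ℂ) →L[ℂ] C(Torus d, ℂ) :=
  ∑ k ∈ Finset.range (N + 1), ∑ m ∈ χ.modes k,
    (χ.rho k (freq m) : ℂ) • (coeff m).smulRight (mFourier m)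

lemma DyadicPartition.trunc_apply {d : ℕ} (χ : DyadicPartition d) (N : ℕ) (u : C(Torus d, ℂ)) :
    χ.trunc N u = ∑ k ∈ Finset.range (N + 1), ∑ m ∈ χ.modes k,
      (χ.rho k (freq m) : ℂ) • coeff m u • mFourier m := by
  simp [trunc, sum_apply, smul_apply]

lemma DyadicPartition.trunc_eq_sum {d : ℕ} (χ : DyadicPartition d) (N : ℕ)
    (F : Finset (Fin d → ℤ)) (hF : ∀ k ≤ N, χ.modes k ⊆ F) (u : C(Torus d, ℂ)) :
    χ.trunc N u = ∑ m ∈ F, (χ.low ((2 : ℝ)⁻¹ ^ N • freq m) : ℂ) • coeff m u • mFourier m := by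
  rw [trunc_apply]
  have (k) (hk : k ∈ Finset.range (N + 1)) :
      ∑ m ∈ χ.modes k, (χ.rho k (freq m) : ℂ) • coeff m u • mFourier m =
      ∑ m ∈ F, (χ.rho k (freq m) : ℂ) • coeff m u • mFourier m := by
    refine Finset.sum_subset (hF k (by simpa [Nat.lt_succ_iff] using hk)) fun m _ hm => ?_
    rw [χ.mem_modes, not_not] at hm
    rw [hm, Complex.ofReal_zero]
    ext x
    simp only [ContinuousMap.smul_apply, zero_smul, ContinuousMap.zero_apply]
  rw [Finset.sum_congr rfl this, Finset.sum_comm]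
  refine Finset.sum_congr rfl fun m _ => ?_
  rw [← Finset.sum_smul, ← χ.sum_rho]
  push_cast
  rfl

lemma DyadicPartition.exists_modes_finset {d : ℕ} (χ : DyadicPartition d) (N : ℕ)
    (G : Finset (Fin d → ℤ)) : ∃ F : Finset (Fin d → ℤ), G ⊆ F ∧ ∀ k ≤ N, χ.modes k ⊆ F := by
  classical
  refine ⟨G ∪ (Finset.range (N + 1)).biUnion χ.modes, Finset.subset_union_left, fun k hk => ?_⟩
  exact (Finset.subset_biUnion_of_mem χ.modes (by simpa [Nat.lt_succ_iff] using hk)).trans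
    Finset.subset_union_right

lemma DyadicPartition.low_eq_zero_of_notMem {d : ℕ} (χ : DyadicPartition d) (N : ℕ)
    {F : Finset (Fin d → ℤ)} (hF : ∀ k ≤ N, χ.modes k ⊆ F) {m : Fin d → ℤ} (hm : m ∉ F) :
    χ.low ((2 : ℝ)⁻¹ ^ N • freq m) = 0 := by
  rw [← χ.sum_rho]
  refine Finset.sum_eq_zero fun k hk => ?_
  by_contra h
  exact hm (hF k (by simpa [Nat.lt_succ_iff] using hk) (χ.mem_modes.2 h))

/-- By `trunc_eq_sum` the symbol is a dilation of ρ₋₁, so the multiplier bound is uniform in N. -/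
lemma DyadicPartition.norm_trunc_le {d : ℕ} (χ : DyadicPartition d) (N : ℕ) (u : C(Torus d, ℂ)) :
    ‖χ.trunc N u‖ ≤ fourierL1 (schwartzOf χ.low χ.low_compact χ.low_smooth) * ‖u‖ := by
  obtain ⟨F, -, hF⟩ := χ.exists_modes_finset N ∅
  refine (ContinuousMap.norm_le _ (mul_nonneg (fourierL1_nonneg _) (norm_nonneg _))).2 fun x => ?_
  have h := norm_sum_multiplier_le (schwartzOf χ.low χ.low_compact χ.low_smooth)
    ((2 : ℝ)⁻¹ ^ N) F (fun m hm => by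
      rw [schwartzOf_apply, χ.low_eq_zero_of_notMem N hF hm, Complex.ofReal_zero]) u x
  rw [χ.trunc_eq_sum N F hF]
  refine le_trans (le_of_eq ?_) h
  simp only [schwartzOf_apply, ContinuousMap.coe_sum, ContinuousMap.coe_smul, Finset.sum_apply,
    Pi.smul_apply, smul_eq_mul, mul_assoc]

lemma DyadicPartition.tendsto_low {d : ℕ} (χ : DyadicPartition d)
    (x : EuclideanSpace ℝ (Fin d)) :
    Tendsto (fun N : ℕ => χ.low ((2 : ℝ)⁻¹ ^ N • x)) atTop (𝓝 1) := by
  have h1 : Tendsto (fun N : ℕ => (2 : ℝ)⁻¹ ^ N • x) atTop (𝓝 ((0 : ℝ) • x)) :=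
    (tendsto_pow_atTop_nhds_zero_of_lt_one (by norm_num) (by norm_num)).smul_const x
  rw [zero_smul] at h1
  have h2 := (χ.low_smooth.continuous.tendsto 0).comp h1
  rwa [χ.low_zero] at h2

/-- Convergence is clear on trigonometric polynomials, which are dense; uniform boundedness of the
truncations extends it to all continuous functions. -/
lemma DyadicPartition.tendsto_trunc {d : ℕ} (χ : DyadicPartition d) (u : C(Torus d, ℂ)) :
    Tendsto (fun N => χ.trunc N u) atTop (𝓝 u) := by
  set C := fourierL1 (schwartzOf χ.low χ.low_compact χ.low_smooth) with hC
  have hC0 : 0 ≤ C := fourierL1_nonneg _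
  have hspan : ∀ v ∈ Submodule.span ℂ (Set.range (mFourier (d := Fin d))),
      Tendsto (fun N => χ.trunc N v) atTop (𝓝 v) := by
    intro v hv
    induction hv using Submodule.span_induction with
    | mem v hv =>
      obtain ⟨n, rfl⟩ := hv
      have h (N) : χ.trunc N (mFourier n) =
          (χ.low ((2 : ℝ)⁻¹ ^ N • freq n) : ℂ) • mFourier n := by
        obtain ⟨F, hG, hF⟩ := χ.exists_modes_finset N {n}
        rw [χ.trunc_eq_sum N F hF, Finset.sum_eq_single n]
        · simp [coeff_mFourier]
        · intro m _ hm
          rw [coeff_mFourier, if_neg hm]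
          ext x
          simp only [ContinuousMap.smul_apply, zero_smul, smul_zero, ContinuousMap.zero_apply]
        · intro hn
          exact absurd (hG (Finset.mem_singleton_self n)) hn
      simp only [h]
      have := ((Complex.continuous_ofReal.tendsto 1).comp (χ.tendsto_low (freq n))).smul_const
        (mFourier n : C(Torus d, ℂ))
      simpa using this
    | zero => simp
    | add v w _ _ hv hw => simpa using hv.add hw
    | smul c v _ hv => simpa using hv.const_smul c
  rw [Metric.tendsto_atTop]
  intro ε hε
  obtain ⟨v, hv, hvu⟩ := Metric.mem_closure_iff.1 (dense_span_mFourier u) (ε / (C + 2))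
    (by positivity)
  obtain ⟨N, hN⟩ := Metric.tendsto_atTop.1 (hspan v hv) (ε / (C + 2)) (by positivity)
  refine ⟨N, fun n hn => ?_⟩
  have h1 : dist (χ.trunc n u) (χ.trunc n v) ≤ C * dist u v := by
    rw [dist_eq_norm, dist_eq_norm, ← map_sub]
    exact χ.norm_trunc_le n _
  have h2 := hN n hn
  calc dist (χ.trunc n u) u ≤ dist (χ.trunc n u) (χ.trunc n v) + dist (χ.trunc n v) v + dist v u :=
        dist_triangle4 _ _ _ _
    _ < C * (ε / (C + 2)) + ε / (C + 2) + ε / (C + 2) := by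
        rw [dist_comm v u]
        have : C * dist u v ≤ C * (ε / (C + 2)) := by gcongr
        linarith
    _ = ε := by field_simp; ring

/-- The mode-wise truncation of a test function. -/
def DyadicPartition.truncTest {d : ℕ} (χ : DyadicPartition d) (N : ℕ) (φ : TestFun d) :
    TestFun d :=
  ∑ k ∈ Finset.range (N + 1), ∑ m ∈ χ.modes k, χ.rho k (freq m) •
    ((coeff m (cx φ.1 (continuous_testFun _))).re • cosT m -
      (coeff m (cx φ.1 (continuous_testFun _))).im • sinT m)

lemma coe_sum_testFun {d : ℕ} {ι : Type*} (s : Finset ι) (φ : ι → TestFun d) (x : Torus d) :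
    (∑ i ∈ s, φ i).1 x = ∑ i ∈ s, (φ i).1 x := by
  rw [Submodule.coe_sum, Finset.sum_apply]

lemma coe_sub_testFun {d : ℕ} (φ ψ : TestFun d) (x : Torus d) :
    (φ - ψ).1 x = φ.1 x - ψ.1 x := rfl

lemma DyadicPartition.truncTest_apply {d : ℕ} (χ : DyadicPartition d) (N : ℕ) (φ : TestFun d)
    (x : Torus d) :
    (χ.truncTest N φ).1 x = (χ.trunc N (cx φ.1 (continuous_testFun _)) x).re := by
  rw [trunc_apply, truncTest, coe_sum_testFun]
  simp only [ContinuousMap.coe_sum, Finset.sum_apply, Complex.re_sum, coe_sum_testFun,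
    coe_smul_testFun, coe_sub_testFun, ContinuousMap.coe_smul, Pi.smul_apply, smul_eq_mul,
    Complex.mul_re, Complex.ofReal_re, Complex.ofReal_im, zero_mul, sub_zero]
  rfl

lemma DyadicPartition.pd_truncTest {d : ℕ} (χ : DyadicPartition d) (N : ℕ) (φ : TestFun d)
    (i : Fin d) : pd i (χ.truncTest N φ) = χ.truncTest N (pd i φ) := by
  simp only [truncTest, map_sum, map_smul, map_sub, pd_cosT, pd_sinT, coeff_pd]
  refine Finset.sum_congr rfl fun k _ => Finset.sum_congr rfl fun m _ => ?_
  have h1 (z : ℂ) : (2 * Real.pi * m i * Complex.I * z).re = -(2 * Real.pi * m i * z.im) := by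
    simp
  have h2 (z : ℂ) : (2 * Real.pi * m i * Complex.I * z).im = 2 * Real.pi * m i * z.re := by
    simp
  rw [h1, h2]
  module

lemma DyadicPartition.wordDeriv_truncTest {d : ℕ} (χ : DyadicPartition d) (N : ℕ) (φ : TestFun d)
    (l : List (Fin d)) : wordDeriv l (χ.truncTest N φ) = χ.truncTest N (wordDeriv l φ) := by
  induction l with
  | nil => simp [wordDeriv]
  | cons i l ih =>
    have h (ψ : TestFun d) : wordDeriv (i :: l) ψ = pd i (wordDeriv l ψ) := by simp [wordDeriv]
    rw [h, h, ih, χ.pd_truncTest]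

/-- Truncation commutes with derivatives, so uniform convergence applies to each of the finitely
many derivatives in the seminorm. -/
lemma DyadicPartition.tendsto_truncTest {d : ℕ} (χ : DyadicPartition d) (φ : TestFun d) (q : ℕ) :
    Tendsto (fun N => testSeminorm q (χ.truncTest N φ - φ)) atTop (𝓝 0) := by
  rw [ENNReal.tendsto_nhds_zero]
  intro ε hε
  have hev : ∀ᶠ N in atTop, ∀ l ∈ {l : List (Fin d) | l.length ≤ q},
      ‖χ.trunc N (cx (wordDeriv l φ).1 (continuous_testFun _)) -
        cx (wordDeriv l φ).1 (continuous_testFun _)‖ₑ ≤ ε := by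
    rw [eventually_all_finite (List.finite_length_le _ _)]
    intro l _
    have h := tendsto_iff_edist_tendsto_0.1
      (χ.tendsto_trunc (cx (wordDeriv l φ).1 (continuous_testFun _)))
    filter_upwards [ENNReal.tendsto_nhds_zero.1 h ε hε] with N hN
    rwa [← edist_eq_enorm_sub]
  filter_upwards [hev] with N hN
  refine iSup_le fun l => iSup_le fun hl => iSup_le fun x => (le_trans ?_ (hN l hl))
  rw [map_sub, wordDeriv_truncTest, coe_sub_testFun, truncTest_apply]
  set v := cx (wordDeriv l φ).1 (continuous_testFun _) with hv
  have h1 : (wordDeriv l φ).1 x = (v x).re := by simp [hv]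
  rw [h1, ← Complex.sub_re, ← ofReal_norm, ← ofReal_norm]
  refine ENNReal.ofReal_le_ofReal ?_
  exact (Complex.abs_re_le_norm _).trans ((χ.trunc N v - v).norm_coe_le_norm x)

lemma DyadicPartition.tendsto_apply_truncTest {d : ℕ} (χ : DyadicPartition d) (f : Dist d)
    (φ : TestFun d) : Tendsto (fun N => f.1 (χ.truncTest N φ)) atTop (𝓝 (f.1 φ)) := by
  obtain ⟨c, q, hf⟩ := f.2
  rw [tendsto_iff_edist_tendsto_0]
  have h2 : Tendsto (fun N => c * testSeminorm q (χ.truncTest N φ - φ)) atTop (𝓝 0) := by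
    simpa using ENNReal.Tendsto.const_mul (χ.tendsto_truncTest φ q) (Or.inr ENNReal.coe_ne_top)
  refine tendsto_of_tendsto_of_tendsto_of_le_of_le tendsto_const_nhds h2 (fun _ => zero_le) ?_
  intro N
  change edist (f.1 _) (f.1 _) ≤ _
  rw [edist_eq_enorm_sub, ← map_sub]
  exact hf _

end

end CahnHilliard

namespace CahnHilliard

open UnitAddTorus
open scoped FourierTransform SchwartzMap ComplexConjugate

noncomputable section

/-! ### Fourier coefficients of distributions and Fourier multipliers -/

/-- The Fourier coefficient `⟨f, e_{-m}⟩` of a distribution. -/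
def fc {d : ℕ} (m : Fin d → ℤ) : Dist d →ₗ[ℝ] ℂ where
  toFun f := ⟨f.1 (cosT m), -f.1 (sinT m)⟩
  map_add' f g := by
    apply Complex.ext
    · rfl
    · change -(f.1 (sinT m) + g.1 (sinT m)) = -f.1 (sinT m) + -g.1 (sinT m)
      ring
  map_smul' c f := by
    apply Complex.ext
    · change c * f.1 (cosT m) = ((c : ℂ) * ⟨f.1 (cosT m), -f.1 (sinT m)⟩ : ℂ).re
      simp
    · change -(c * f.1 (sinT m)) = ((c : ℂ) * ⟨f.1 (cosT m), -f.1 (sinT m)⟩ : ℂ).im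
      simp

lemma fc_re {d : ℕ} (m : Fin d → ℤ) (f : Dist d) : (fc m f).re = f.1 (cosT m) := rfl

lemma fc_im {d : ℕ} (m : Fin d → ℤ) (f : Dist d) : (fc m f).im = -f.1 (sinT m) := rfl

lemma cosT_neg {d : ℕ} (m : Fin d → ℤ) : cosT (-m) = cosT m := by
  refine Subtype.ext (funext fun x => ?_)
  change (mFourier (-m) x).re = (mFourier m x).re
  rw [mFourier_neg, Complex.conj_re]

lemma sinT_neg {d : ℕ} (m : Fin d → ℤ) : sinT (-m) = -sinT m := by
  refine Subtype.ext (funext fun x => ?_)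
  change (mFourier (-m) x).im = -(mFourier m x).im
  rw [mFourier_neg, Complex.conj_im]

lemma fc_neg_freq {d : ℕ} (m : Fin d → ℤ) (f : Dist d) : fc (-m) f = conj (fc m f) := by
  apply Complex.ext
  · rw [Complex.conj_re, fc_re, fc_re, cosT_neg]
  · rw [Complex.conj_im, fc_im, fc_im, sinT_neg, map_neg]

lemma ofContinuous_apply {d : ℕ} (u : Torus d → ℝ) (hu : Continuous u) (φ : TestFun d) :
    (ofContinuous u hu).1 φ = ∫ x, u x * φ.1 x := rfl

lemma integral_mFourier_mul_testFun {d : ℕ} (m : Fin d → ℤ) (u : Torus d → ℝ)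
    (hu : Continuous u) : ∫ x, mFourier m x * (u x : ℂ) = conj (coeff m (cx u hu)) := by
  rw [coeff_apply, ← integral_conj]
  congr 1
  funext x
  rw [map_mul, ← mFourier_neg, neg_neg, cx_apply, Complex.conj_ofReal]

lemma fc_ofContinuous {d : ℕ} (m : Fin d → ℤ) (u : Torus d → ℝ) (hu : Continuous u) :
    fc m (ofContinuous u hu) = coeff m (cx u hu) := by
  have hint : Integrable fun x => mFourier m x * (u x : ℂ) :=
    integrable_continuousMap (mFourier m * cx u hu)
  have h := integral_mFourier_mul_testFun m u hu
  have h2 : coeff m (cx u hu) = conj (∫ x, mFourier m x * (u x : ℂ)) := by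
    rw [h, Complex.conj_conj]
  rw [h2]
  apply Complex.ext
  · rw [Complex.conj_re, fc_re, ofContinuous_apply]
    refine Eq.trans ?_ (integral_re hint)
    congr 1
    funext x
    simp [cosT, cosMode, mul_comm]
  · rw [Complex.conj_im, fc_im, ofContinuous_apply]
    refine congrArg Neg.neg (Eq.trans ?_ (integral_im hint))
    congr 1
    funext x
    simp [sinT, sinMode, mul_comm]

lemma fc_lap {d : ℕ} (m : Fin d → ℤ) (f : Dist d) :
    fc m (lap f) = ((-(2 * Real.pi * ‖freq m‖) ^ 2 : ℝ) : ℂ) * fc m f := by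
  have hn : (2 * Real.pi * ‖freq m‖) ^ 2 = ∑ i, (2 * Real.pi * m i) * (2 * Real.pi * m i) := by
    rw [mul_pow, EuclideanSpace.norm_sq_eq, Finset.mul_sum]
    refine Finset.sum_congr rfl fun i _ => ?_
    simp only [freq, Real.norm_eq_abs, sq_abs]
    ring
  have h1 : (∑ i, pd i ∘ₗ pd i) (cosT m) = (-(2 * Real.pi * ‖freq m‖) ^ 2) • cosT m := by
    simp only [LinearMap.sum_apply, LinearMap.comp_apply, pd_cosT, map_smul, pd_sinT, smul_smul]
    rw [hn, ← Finset.sum_neg_distrib, Finset.sum_smul]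
    simp
  have h2 : (∑ i, pd i ∘ₗ pd i) (sinT m) = (-(2 * Real.pi * ‖freq m‖) ^ 2) • sinT m := by
    simp only [LinearMap.sum_apply, LinearMap.comp_apply, pd_cosT, map_smul, pd_sinT, smul_smul]
    rw [hn, ← Finset.sum_neg_distrib, Finset.sum_smul]
    simp
  apply Complex.ext
  · rw [Complex.re_ofReal_mul, fc_re, fc_re]
    change f.1 ((∑ i, pd i ∘ₗ pd i) (cosT m)) = _
    rw [h1, map_smul, smul_eq_mul]
  · rw [Complex.im_ofReal_mul, fc_im, fc_im]
    change -f.1 ((∑ i, pd i ∘ₗ pd i) (sinT m)) = _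
    rw [h2, map_smul, smul_eq_mul]
    ring

lemma DyadicPartition.apply_truncTest {d : ℕ} (χ : DyadicPartition d) (N : ℕ) (f : Dist d)
    (φ : TestFun d) : f.1 (χ.truncTest N φ) = ∑ k ∈ Finset.range (N + 1), ∑ m ∈ χ.modes k,
      χ.rho k (freq m) * (fc m f * conj (coeff m (cx φ.1 (continuous_testFun _)))).re := by
  simp only [truncTest, map_sum, map_smul, map_sub, smul_eq_mul]
  refine Finset.sum_congr rfl fun k _ => Finset.sum_congr rfl fun m _ => ?_
  rw [Complex.mul_re, fc_re, fc_im, Complex.conj_re, Complex.conj_im]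
  ring

/-- On a truncated test function f is a finite combination of its coefficients, and the truncations
converge in every seminorm. Identities for P_r and Δ below are checked through this. -/
lemma DyadicPartition.fc_ext {d : ℕ} (χ : DyadicPartition d) {f g : Dist d}
    (h : ∀ m, fc m f = fc m g) : f = g := by
  refine Subtype.ext (LinearMap.ext fun φ => ?_)
  refine tendsto_nhds_unique (χ.tendsto_apply_truncTest f φ) ?_
  simpa only [χ.apply_truncTest, h] using χ.tendsto_apply_truncTest g φ

lemma exists_wordDeriv_mode {d : ℕ} (m : Fin d → ℤ) (l : List (Fin d)) (p q : ℝ) :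
    ∃ a b : ℝ, |a| + |b| ≤ (2 * Real.pi * (1 + ∑ i, |(m i : ℝ)|)) ^ l.length * (|p| + |q|) ∧
      wordDeriv l (p • cosT m + q • sinT m) = a • cosT m + b • sinT m := by
  induction l with
  | nil => exact ⟨p, q, by simp, by simp [wordDeriv]⟩
  | cons i l ih =>
    obtain ⟨a, b, hab, h⟩ := ih
    refine ⟨2 * Real.pi * m i * b, -(2 * Real.pi * m i) * a, ?_, ?_⟩
    · have h1 : |(m i : ℝ)| ≤ 1 + ∑ i, |(m i : ℝ)| := by
        have := Finset.single_le_sum (f := fun i => |(m i : ℝ)|) (fun i _ => abs_nonneg _)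
          (Finset.mem_univ i)
        linarith
      rw [abs_mul _ b, abs_mul _ a, abs_neg, ← mul_add, List.length_cons, pow_succ',
        mul_assoc _ (_ ^ _), add_comm |b|]
      have h2 : |2 * Real.pi * (m i : ℝ)| = 2 * Real.pi * |(m i : ℝ)| := by
        rw [abs_mul, abs_of_pos (by positivity)]
      rw [h2]
      gcongr
    · have h' (ψ : TestFun d) : wordDeriv (i :: l) ψ = pd i (wordDeriv l ψ) := by simp [wordDeriv]
      rw [h', h, map_add, map_smul, map_smul, pd_cosT, pd_sinT]
      module

lemma testSeminorm_mode_le {d : ℕ} (m : Fin d → ℤ) (p q : ℝ) (j : ℕ) :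
    testSeminorm j (p • cosT m + q • sinT m) ≤
      ENNReal.ofReal ((2 * Real.pi * (1 + ∑ i, |(m i : ℝ)|)) ^ j * (|p| + |q|)) := by
  refine iSup_le fun l => iSup_le fun hl => iSup_le fun x => ?_
  obtain ⟨a, b, hab, h⟩ := exists_wordDeriv_mode m l p q
  rw [h, ← ofReal_norm]
  refine ENNReal.ofReal_le_ofReal ?_
  rw [coe_add_testFun, coe_smul_testFun, coe_smul_testFun]
  have h0 : 0 ≤ ∑ i, |(m i : ℝ)| := Finset.sum_nonneg fun i _ => abs_nonneg _
  have h1 : |(cosT m).1 x| ≤ 1 :=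
    (Complex.abs_re_le_norm _).trans (norm_mFourier_apply m x).le
  have h2 : |(sinT m).1 x| ≤ 1 :=
    (Complex.abs_im_le_norm _).trans (norm_mFourier_apply m x).le
  calc ‖a * (cosT m).1 x + b * (sinT m).1 x‖ ≤ |a| * |(cosT m).1 x| + |b| * |(sinT m).1 x| := by
        rw [← abs_mul, ← abs_mul]; exact abs_add_le _ _
    _ ≤ |a| * 1 + |b| * 1 := by gcongr
    _ ≤ (2 * Real.pi * (1 + ∑ i, |(m i : ℝ)|)) ^ l.length * (|p| + |q|) := by linarith
    _ ≤ _ := by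
      gcongr
      have := Real.pi_gt_three
      nlinarith

/-- The seminorm of order j of a mode grows like the j-th power of its frequency, so distributions
have polynomially bounded coefficients. -/
lemma exists_fc_bound {d : ℕ} (f : Dist d) :
    ∃ (C : ℝ) (j : ℕ), 0 ≤ C ∧ ∀ m, ‖fc m f‖ ≤ C * (1 + ∑ i, |(m i : ℝ)|) ^ j := by
  obtain ⟨c, j, hf⟩ := f.2
  refine ⟨2 * (c * (2 * Real.pi) ^ j), j, by positivity, fun m => ?_⟩
  have key (p q : ℝ) (hpq : |p| + |q| = 1) : |f.1 (p • cosT m + q • sinT m)| ≤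
      c * (2 * Real.pi * (1 + ∑ i, |(m i : ℝ)|)) ^ j := by
    have h1 := (hf (p • cosT m + q • sinT m)).trans
      (mul_le_mul_right (testSeminorm_mode_le m p q j) _)
    rw [hpq, mul_one, ← ENNReal.ofReal_coe_nnreal, ← ENNReal.ofReal_mul (by positivity),
      ← ofReal_norm] at h1
    exact (ENNReal.ofReal_le_ofReal_iff (by positivity)).1 h1
  have h1 := key 1 0 (by simp)
  have h2 := key 0 1 (by simp)
  simp only [one_smul, zero_smul, add_zero, zero_add] at h1 h2
  calc ‖fc m f‖ ≤ |(fc m f).re| + |(fc m f).im| := Complex.norm_le_abs_re_add_abs_im _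
    _ ≤ _ := by
      rw [fc_re, fc_im, abs_neg]
      rw [mul_pow] at h1 h2
      linarith

/-! ### Multipliers with absolutely summable series -/

/-- The coefficients for which the multiplier is absolutely summable. -/
def MultSummable {d : ℕ} (σ : (Fin d → ℤ) → ℝ) (f : Dist d) : Prop :=
  Summable fun m => |σ m| * ‖fc m f‖

lemma multSummable_of_rapid {d : ℕ} {σ : (Fin d → ℤ) → ℝ}
    (hσ : ∀ k : ℕ, Summable fun m : Fin d → ℤ => |σ m| * (∑ i, |(m i : ℝ)|) ^ k) (f : Dist d) :
    MultSummable σ f := by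
  obtain ⟨C, j, hC, h⟩ := exists_fc_bound f
  have hs : Summable fun m : Fin d → ℤ =>
      C * (2 ^ j * (|σ m| + |σ m| * (∑ i, |(m i : ℝ)|) ^ j)) := by
    have h0 := hσ 0
    simp only [pow_zero, mul_one] at h0
    exact ((h0.add (hσ j)).mul_left _).mul_left _
  refine Summable.of_nonneg_of_le (fun m => by positivity) (fun m => ?_) hs
  have h0 : 0 ≤ ∑ i, |(m i : ℝ)| := Finset.sum_nonneg fun i _ => abs_nonneg _
  have h1 : (1 + ∑ i, |(m i : ℝ)|) ^ j ≤ 2 ^ j * (1 + (∑ i, |(m i : ℝ)|) ^ j) := by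
    have := add_pow_le zero_le_one h0 j
    rw [one_pow] at this
    refine this.trans ?_
    gcongr
    · norm_num
    · omega
  calc |σ m| * ‖fc m f‖ ≤ |σ m| * (C * (2 ^ j * (1 + (∑ i, |(m i : ℝ)|) ^ j))) := by
        gcongr
        exact (h m).trans (by gcongr)
    _ = _ := by ring

lemma multSummable_of_finite {d : ℕ} {σ : (Fin d → ℤ) → ℝ} (hσ : (Function.support σ).Finite)
    (f : Dist d) : MultSummable σ f :=
  summable_of_hasFiniteSupport (hσ.subset fun m hm h => hm (by simp [h]))

/-- The Fourier multiplier with symbol `σ`, as a complex function. -/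
def multC {d : ℕ} (σ : (Fin d → ℤ) → ℝ) (f : Dist d) : C(Torus d, ℂ) :=
  ∑' m, ((σ m : ℂ) * fc m f) • mFourier m

/-- The Fourier multiplier with symbol `σ`. -/
def mult {d : ℕ} (σ : (Fin d → ℤ) → ℝ) (f : Dist d) (x : Torus d) : ℝ := (multC σ f x).re

lemma continuous_mult {d : ℕ} (σ : (Fin d → ℤ) → ℝ) (f : Dist d) : Continuous (mult σ f) :=
  Complex.continuous_re.comp (multC σ f).continuous

lemma multC_congr {d : ℕ} {σ τ : (Fin d → ℤ) → ℝ} {f g : Dist d}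
    (h : ∀ m, (σ m : ℂ) * fc m f = τ m * fc m g) : multC σ f = multC τ g := by
  simp only [multC, h]

lemma mult_congr {d : ℕ} {σ τ : (Fin d → ℤ) → ℝ} {f g : Dist d}
    (h : ∀ m, (σ m : ℂ) * fc m f = τ m * fc m g) : mult σ f = mult τ g := by
  funext x
  rw [mult, mult, multC_congr h]

lemma MultSummable.hasSum {d : ℕ} {σ : (Fin d → ℤ) → ℝ} {f : Dist d} (h : MultSummable σ f) :
    HasSum (fun m => ((σ m : ℂ) * fc m f) • mFourier m) (multC σ f) := by
  refine Summable.hasSum (Summable.of_norm ?_)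
  refine h.congr fun m => ?_
  rw [norm_smul, mFourier_norm, norm_mul, Complex.norm_real, mul_one, Real.norm_eq_abs]

lemma MultSummable.hasSum_apply {d : ℕ} {σ : (Fin d → ℤ) → ℝ} {f : Dist d} (h : MultSummable σ f)
    (x : Torus d) : HasSum (fun m => σ m * (fc m f * mFourier m x).re) (mult σ f x) := by
  have h1 := h.hasSum.mapL (Complex.reCLM.comp
    ((ContinuousMap.evalCLM ℂ x : C(Torus d, ℂ) →L[ℂ] ℂ).restrictScalars ℝ))
  have h2 (m) : σ m * (fc m f * mFourier m x).re = (Complex.reCLM.comp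
      ((ContinuousMap.evalCLM ℂ x : C(Torus d, ℂ) →L[ℂ] ℂ).restrictScalars ℝ))
      (((σ m : ℂ) * fc m f) • mFourier m) := by
    simp [mul_assoc]
  simp only [h2]
  exact h1

lemma coeff_multC {d : ℕ} {σ : (Fin d → ℤ) → ℝ} {f : Dist d} (h : MultSummable σ f)
    (m : Fin d → ℤ) : coeff m (multC σ f) = σ m * fc m f := by
  have h1 := h.hasSum.mapL (coeff m)
  refine h1.unique ?_
  have h2 := hasSum_ite_eq m ((σ m : ℂ) * fc m f)
  convert h2 using 1
  funext n
  rw [map_smul, coeff_mFourier, smul_eq_mul, mul_ite, mul_one, mul_zero]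
  by_cases hn : m = n
  · subst hn; simp
  · rw [if_neg hn, if_neg (Ne.symm hn)]

/-- Coefficients of a real distribution at m and -m are conjugate, and an even real symbol preserves
this. So `multC σ f` is real-valued and the real part in `mult` loses nothing. -/
lemma cx_mult {d : ℕ} {σ : (Fin d → ℤ) → ℝ} {f : Dist d} (h : MultSummable σ f)
    (hσ : ∀ m, σ (-m) = σ m) : cx (mult σ f) (continuous_mult σ f) = multC σ f := by
  ext x
  rw [cx_apply, mult]
  refine Complex.conj_eq_iff_re.1 ?_
  have h1 := h.hasSum.mapL (ContinuousMap.evalCLM ℂ x : C(Torus d, ℂ) →L[ℂ] ℂ)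
  have h2 := (Equiv.neg (Fin d → ℤ)).hasSum_iff.2 h1
  have h3 := Complex.hasSum_conj'.2 h1
  refine h3.unique ?_
  have h4 (m) : conj ((ContinuousMap.evalCLM ℂ x : C(Torus d, ℂ) →L[ℂ] ℂ)
      (((σ m : ℂ) * fc m f) • mFourier m)) = ((fun b => (ContinuousMap.evalCLM ℂ x :
        C(Torus d, ℂ) →L[ℂ] ℂ) (((σ b : ℂ) * fc b f) • mFourier b)) ∘ Equiv.neg _) m := by
    simp only [ContinuousMap.evalCLM_apply, ContinuousMap.smul_apply, smul_eq_mul, map_mul,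
      Complex.conj_ofReal, Function.comp_apply, Equiv.neg_apply, hσ, fc_neg_freq, mFourier_neg]
  simp only [h4]
  exact h2

lemma fc_ofContinuous_mult {d : ℕ} {σ : (Fin d → ℤ) → ℝ} {f : Dist d} (h : MultSummable σ f)
    (hσ : ∀ m, σ (-m) = σ m) (m : Fin d → ℤ) :
    fc m (ofContinuous (mult σ f) (continuous_mult σ f)) = σ m * fc m f := by
  rw [fc_ofContinuous, cx_mult h hσ, coeff_multC h]

/-- The double sum weights b m by ρ₋₁(2^{-N}m), which lies in [0, 1] and tends to 1; dominated
convergence applies. -/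
lemma DyadicPartition.tendsto_sum_modes {d : ℕ} (χ : DyadicPartition d) {b : (Fin d → ℤ) → ℝ}
    (hb : Summable b) :
    Tendsto (fun N => ∑ k ∈ Finset.range (N + 1), ∑ m ∈ χ.modes k, χ.rho k (freq m) * b m)
      atTop (𝓝 (∑' m, b m)) := by
  have h1 (N : ℕ) : ∑ k ∈ Finset.range (N + 1), ∑ m ∈ χ.modes k, χ.rho k (freq m) * b m =
      ∑' m, χ.low ((2 : ℝ)⁻¹ ^ N • freq m) * b m := by
    obtain ⟨F, -, hF⟩ := χ.exists_modes_finset N ∅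
    rw [tsum_eq_sum (s := F) fun m hm => by rw [χ.low_eq_zero_of_notMem N hF hm, zero_mul]]
    simp only [← χ.sum_rho, Finset.sum_mul]
    rw [Finset.sum_comm]
    refine Finset.sum_congr rfl fun k hk => ?_
    refine Finset.sum_subset (hF k (by simpa [Nat.lt_succ_iff] using hk)) fun m _ hm => ?_
    rw [χ.mem_modes, not_not] at hm
    rw [hm, zero_mul]
  simp only [h1]
  refine tendsto_tsum_of_dominated_convergence hb.norm (fun m => ?_)
    (Eventually.of_forall fun N m => ?_)
  · simpa using (χ.tendsto_low (freq m)).mul_const (b m)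
  · rw [norm_mul]
    refine mul_le_of_le_one_left (norm_nonneg _) ?_
    rw [Real.norm_of_nonneg (χ.low_nonneg _)]
    exact χ.rho_le_one 0 _

/-- The reflected kernel is the series of the modes e_{-n} with coefficients a(n)e_n(x). Evenness of
a makes this series real and replaces a(-m) by a(m). -/
lemma coeff_reflect_cosTest {d : ℕ} (a : (Fin d → ℤ) → ℝ)
    (ha : ∀ k : ℕ, Summable fun m : Fin d → ℤ => |a m| * (∑ i, |(m i : ℝ)|) ^ k)
    (hev : ∀ m, a (-m) = a m) (x : Torus d) (m : Fin d → ℤ) :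
    coeff m (cx (reflect x (cosTest a ha)).1 (continuous_testFun _)) =
      a m * conj (mFourier m x) := by
  have hs : Summable fun n : Fin d → ℤ => |a n| := by simpa using ha 0
  have hS : Summable fun n : Fin d → ℤ =>
      ((a n : ℂ) * mFourier n x) • (mFourier (-n) : C(Torus d, ℂ)) := by
    refine Summable.of_norm (hs.congr fun n => ?_)
    rw [norm_smul, mFourier_norm, norm_mul, norm_mFourier_apply, Complex.norm_real, mul_one,
      mul_one, Real.norm_eq_abs]
  have hev (y : Torus d) : (∑' n : Fin d → ℤ,
      ((a n : ℂ) * mFourier n x) • (mFourier (-n) : C(Torus d, ℂ))) y =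
      ((reflect x (cosTest a ha)).1 y : ℂ) := by
    have h1 := hS.hasSum.mapL (ContinuousMap.evalCLM ℂ y : C(Torus d, ℂ) →L[ℂ] ℂ)
    have h1' : HasSum (fun n : Fin d → ℤ => (a n : ℂ) * mFourier n (x - y)) ((∑' n : Fin d → ℤ,
      ((a n : ℂ) * mFourier n x) • (mFourier (-n) : C(Torus d, ℂ))) y) := by
      have h0 (n : Fin d → ℤ) : (a n : ℂ) * mFourier n (x - y) =
          (ContinuousMap.evalCLM ℂ y : C(Torus d, ℂ) →L[ℂ] ℂ)
            (((a n : ℂ) * mFourier n x) • (mFourier (-n) : C(Torus d, ℂ))) := by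
        simp only [ContinuousMap.evalCLM_apply, ContinuousMap.smul_apply, smul_eq_mul]
        rw [sub_eq_add_neg, mFourier_apply_add, mFourier_apply_neg, mFourier_neg, mul_assoc]
      simp only [h0]
      exact h1
    have h2 := (Equiv.neg (Fin d → ℤ)).hasSum_iff.2 h1'
    have h3 := Complex.hasSum_conj'.2 h1'
    have h4 : conj ((∑' n : Fin d → ℤ,
        ((a n : ℂ) * mFourier n x) • (mFourier (-n) : C(Torus d, ℂ))) y) = (∑' n : Fin d → ℤ,
        ((a n : ℂ) * mFourier n x) • (mFourier (-n) : C(Torus d, ℂ))) y := by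
      refine h3.unique ?_
      convert h2 using 1
      funext n
      simp only [map_mul, Complex.conj_ofReal, Function.comp_apply, Equiv.neg_apply, hev,
        mFourier_neg]
    rw [← Complex.conj_eq_iff_re.1 h4]
    congr 1
    refine ((Complex.reCLM.hasSum h1').unique ?_)
    change HasSum _ (∑' n, a n * cosMode n (x - y))
    convert Summable.hasSum (f := fun n => a n * cosMode n (x - y)) ?_ using 1
    · funext n
      simp [cosMode]
    · refine Summable.of_norm_bounded hs fun n => ?_
      rw [norm_mul, Real.norm_eq_abs]
      refine mul_le_of_le_one_right (abs_nonneg _) ?_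
      exact (Complex.abs_re_le_norm _).trans (norm_mFourier_apply n _).le
  have heq : cx (reflect x (cosTest a ha)).1 (continuous_testFun _) = ∑' n : Fin d → ℤ,
      ((a n : ℂ) * mFourier n x) • (mFourier (-n) : C(Torus d, ℂ)) := by
    ext y
    exact (hev y).symm
  rw [heq]
  refine (hS.hasSum.mapL (coeff m)).unique ?_
  have h2 := hasSum_ite_eq (-m) ((a m : ℂ) * conj (mFourier m x))
  convert h2 using 1
  funext n
  rw [map_smul, coeff_mFourier, smul_eq_mul, mul_ite, mul_one, mul_zero]
  by_cases hn : n = -m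
  · subst hn
    simp [‹∀ m, a (-m) = a m›, mFourier_neg]
  · rw [if_neg hn, if_neg fun h => hn (by rw [h, neg_neg])]

/-- Truncate the kernel and pass to the limit on both sides. This turns the blocks and the
semigroup, which are defined as convolutions, into Fourier multipliers. -/
lemma DyadicPartition.conv_cosTest {d : ℕ} (χ : DyadicPartition d) (a : (Fin d → ℤ) → ℝ)
    (ha : ∀ k : ℕ, Summable fun m : Fin d → ℤ => |a m| * (∑ i, |(m i : ℝ)|) ^ k)
    (hev : ∀ m, a (-m) = a m) (f : Dist d) : conv (cosTest a ha) f = mult a f := by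
  funext x
  have h1 := χ.tendsto_apply_truncTest f (reflect x (cosTest a ha))
  refine tendsto_nhds_unique h1 ?_
  have h2 := (multSummable_of_rapid ha f).hasSum_apply x
  rw [← h2.tsum_eq]
  refine (χ.tendsto_sum_modes h2.summable).congr fun N => ?_
  rw [χ.apply_truncTest]
  refine Finset.sum_congr rfl fun k _ => Finset.sum_congr rfl fun m _ => ?_
  rw [coeff_reflect_cosTest a ha hev, map_mul, Complex.conj_conj, Complex.conj_ofReal,
    mul_left_comm (fc m f), Complex.re_ofReal_mul]

lemma DyadicPartition.rho_even {d : ℕ} (χ : DyadicPartition d) (k : ℕ) (m : Fin d → ℤ) :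
    χ.rho k (freq (-m)) = χ.rho k (freq m) := by rw [freq_neg, χ.rho_neg]

lemma DyadicPartition.block_eq_mult {d : ℕ} (χ : DyadicPartition d) (k : ℕ) (f : Dist d) :
    χ.block k f = mult (fun m => χ.rho k (freq m)) f :=
  χ.conv_cosTest _ _ (χ.rho_even k) f

lemma DyadicPartition.continuous_block {d : ℕ} (χ : DyadicPartition d) (k : ℕ) (f : Dist d) :
    Continuous (χ.block k f) := continuous_conv _ _

lemma ofContinuous_congr {d : ℕ} {u v : Torus d → ℝ} (hu : Continuous u) (hv : Continuous v)
    (h : u = v) : ofContinuous u hu = ofContinuous v hv := by subst h; rfl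

lemma DyadicPartition.fc_block {d : ℕ} (χ : DyadicPartition d) (k : ℕ) (f : Dist d)
    (m : Fin d → ℤ) : fc m (ofContinuous (χ.block k f) (χ.continuous_block k f)) =
      χ.rho k (freq m) * fc m f := by
  rw [ofContinuous_congr _ (continuous_mult _ f) (χ.block_eq_mult k f)]
  exact fc_ofContinuous_mult (multSummable_of_finite (χ.finite_support k) f) (χ.rho_even k) m

/-- The symbol of the semigroup. -/
def heatSymbol {d : ℕ} (r : ℝ) (m : Fin d → ℤ) : ℝ :=
  Real.exp (-(r * (2 * Real.pi * ‖freq m‖) ^ 4))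

lemma heatSymbol_even {d : ℕ} (r : ℝ) (m : Fin d → ℤ) : heatSymbol r (-m) = heatSymbol r m := by
  rw [heatSymbol, heatSymbol, freq_neg, norm_neg]

lemma DyadicPartition.fc_semigroup {d : ℕ} (χ : DyadicPartition d) {r : ℝ} (hr : 0 ≤ r)
    (f : Dist d) (m : Fin d → ℤ) : fc m (semigroup r f) = heatSymbol r m * fc m f := by
  rcases hr.eq_or_lt with rfl | hr
  · simp [semigroup, heatSymbol]
  · rw [semigroup, dif_pos hr]
    have h := χ.conv_cosTest (heatSymbol r) (summable_heat hr) (heatSymbol_even r) f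
    rw [ofContinuous_congr (continuous_conv (heatKernel r hr) f) (continuous_mult _ f) h]
    exact fc_ofContinuous_mult (multSummable_of_rapid (summable_heat hr) f) (heatSymbol_even r) m

/-- Parseval for a trigonometric polynomial. The right side is the k-th term in `apply_truncTest`,
so summing over k recovers f. -/
lemma DyadicPartition.integral_block_mul {d : ℕ} (χ : DyadicPartition d) (k : ℕ) (f : Dist d)
    (φ : TestFun d) : ∫ x, χ.block k f x * φ.1 x = ∑ m ∈ χ.modes k,
      χ.rho k (freq m) * (fc m f * conj (coeff m (cx φ.1 (continuous_testFun _)))).re := by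
  have h1 (x : Torus d) : χ.block k f x =
      ∑ m ∈ χ.modes k, χ.rho k (freq m) * (fc m f * mFourier m x).re := by
    rw [block_eq_mult]
    have h := (multSummable_of_finite (χ.finite_support k) f).hasSum_apply x
    refine h.unique (hasSum_sum_of_ne_finset_zero fun m hm => ?_)
    rw [χ.mem_modes, not_not] at hm
    rw [hm, zero_mul]
  have h3 (m : Fin d → ℤ) : Integrable fun x => fc m f * (mFourier m x * (φ.1 x : ℂ)) :=
    (integrable_continuousMap (mFourier m * cx φ.1 (continuous_testFun _))).const_mul _
  have h2 (m : Fin d → ℤ) (x : Torus d) :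
      χ.rho k (freq m) * (fc m f * mFourier m x).re * φ.1 x =
      χ.rho k (freq m) * (fc m f * (mFourier m x * (φ.1 x : ℂ))).re := by
    rw [← mul_assoc (fc m f), mul_comm _ (φ.1 x : ℂ), Complex.re_ofReal_mul]
    ring
  simp only [h1, Finset.sum_mul, h2]
  refine (integral_finsetSum _ fun m _ => ((h3 m).re.const_mul _)).trans ?_
  refine Finset.sum_congr rfl fun m _ => ?_
  rw [integral_const_mul]
  congr 1
  refine (integral_re (h3 m)).trans ?_
  rw [integral_const_mul, integral_mFourier_mul_testFun m φ.1 (continuous_testFun _)]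
  rfl

lemma DyadicPartition.tendsto_sum_block {d : ℕ} (χ : DyadicPartition d) (f : Dist d)
    (φ : TestFun d) :
    Tendsto (fun N => ∑ k ∈ Finset.range (N + 1), ∫ x, χ.block k f x * φ.1 x) atTop
      (𝓝 (f.1 φ)) := by
  simp only [χ.integral_block_mul, ← χ.apply_truncTest]
  exact χ.tendsto_apply_truncTest f φ

/-! ### Boundedness of multipliers -/

lemma finite_freq_le {d : ℕ} (R : ℝ) : {m : Fin d → ℤ | ‖freq m‖ ≤ R}.Finite := by
  refine (Set.Finite.pi' (t := fun _ : Fin d => Set.Icc (-⌈R⌉) ⌈R⌉)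
    fun _ => Set.finite_Icc _ _).subset fun m hm i => ?_
  have h1 : |(m i : ℝ)| ≤ R := (PiLp.norm_apply_le (freq m) i).trans hm
  have h2 : |m i| ≤ ⌈R⌉ := by
    have : ((|m i| : ℤ) : ℝ) ≤ (⌈R⌉ : ℝ) := by
      push_cast
      exact h1.trans (Int.le_ceil R)
    exact_mod_cast this
  exact abs_le.1 h2

lemma finite_support_dilation {d : ℕ} {φ : EuclideanSpace ℝ (Fin d) → ℝ}
    (h1 : HasCompactSupport φ) {ε : ℝ} (hε : 0 < ε) :
    (Function.support fun m : Fin d → ℤ => φ (ε • freq m)).Finite := by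
  obtain ⟨R, hR⟩ := h1.isCompact.isBounded.exists_norm_le
  refine (finite_freq_le (ε⁻¹ * R)).subset fun m hm => ?_
  have h := hR _ (subset_tsupport _ hm)
  rw [norm_smul, Real.norm_of_nonneg hε.le] at h
  change ‖freq m‖ ≤ ε⁻¹ * R
  rw [← div_eq_inv_mul, le_div_iff₀ hε]
  linarith

/-- The form of `norm_sum_multiplier_le` in which it is applied, with u a single block and ε =
2^{-k}. -/
lemma abs_mult_ofContinuous_le {d : ℕ} (φ : EuclideanSpace ℝ (Fin d) → ℝ)
    (h1 : HasCompactSupport φ) (h2 : ContDiff ℝ (⊤ : ℕ∞) φ) {ε : ℝ} (hε : 0 < ε)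
    {u : Torus d → ℝ} (hu : Continuous u) {M : ℝ} (hM : ∀ x, |u x| ≤ M) (x : Torus d) :
    |mult (fun m => φ (ε • freq m)) (ofContinuous u hu) x| ≤
      fourierL1 (schwartzOf φ h1 h2) * M := by
  have hfin := finite_support_dilation h1 hε
  have hF (m) (hm : m ∉ hfin.toFinset) : φ (ε • freq m) = 0 := by
    by_contra h
    exact hm (hfin.mem_toFinset.2 h)
  have h := norm_sum_multiplier_le (schwartzOf φ h1 h2) ε hfin.toFinset (fun m hm => by
    rw [schwartzOf_apply, hF m hm, Complex.ofReal_zero]) (cx u hu) x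
  refine (Complex.abs_re_le_norm _).trans ((le_of_eq ?_).trans (h.trans ?_))
  · rw [multC, tsum_eq_sum (s := hfin.toFinset) fun m hm => ?_]
    · simp only [ContinuousMap.coe_sum, Finset.sum_apply, ContinuousMap.coe_smul, Pi.smul_apply,
        smul_eq_mul, schwartzOf_apply, fc_ofContinuous]
    · rw [hF m hm]
      ext x
      simp only [ContinuousMap.smul_apply, Complex.ofReal_zero, zero_mul, zero_smul,
        ContinuousMap.zero_apply]
  · exact mul_le_mul_of_nonneg_left
      (norm_cx_le hu ((abs_nonneg _).trans (hM 0)) hM) (fourierL1_nonneg _)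

end

end CahnHilliard

namespace CahnHilliard

open UnitAddTorus
open scoped FourierTransform SchwartzMap ComplexConjugate

noncomputable section

/-! ### `L¹` bounds for Fourier transforms of cutoffs -/

/-- The Fourier transform followed by the inclusion into L¹ is continuous on Schwartz space, hence
dominated by finitely many seminorms. -/
lemma exists_fourierL1_le {d : ℕ} : ∃ (s : Finset (ℕ × ℕ)) (C : ℝ), 0 ≤ C ∧
    ∀ (φ : 𝓢(EuclideanSpace ℝ (Fin d), ℂ)) (B : ℝ), 0 ≤ B →
      (∀ p ∈ s, SchwartzMap.seminorm ℝ p.1 p.2 φ ≤ B) → fourierL1 φ ≤ C * B := by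
  let L : 𝓢(EuclideanSpace ℝ (Fin d), ℂ) →L[ℝ]
      Lp ℂ 1 (volume : Measure (EuclideanSpace ℝ (Fin d))) :=
    (SchwartzMap.toLpCLM ℝ ℂ 1 volume).comp
      ((FourierTransform.fourierCLE ℂ 𝓢(EuclideanSpace ℝ (Fin d), ℂ) :
        𝓢(EuclideanSpace ℝ (Fin d), ℂ) →L[ℂ] 𝓢(EuclideanSpace ℝ (Fin d), ℂ)).restrictScalars ℝ)
  have hL (φ) : fourierL1 φ = ‖L φ‖ := by
    rw [fourierL1]
    exact SchwartzMap.norm_toLp_one.symm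
  obtain ⟨s, C, -, hC⟩ := Seminorm.bound_of_continuous
    (schwartz_withSeminorms ℝ (EuclideanSpace ℝ (Fin d)) ℂ)
    ((normSeminorm ℝ (Lp ℂ 1 (volume : Measure (EuclideanSpace ℝ (Fin d))))).comp L.toLinearMap)
    (by exact L.continuous.norm)
  refine ⟨s, C, C.2, fun φ B hB h => ?_⟩
  rw [hL]
  refine (hC φ).trans ?_
  rw [smul_apply]
  change (C : ℝ) * _ ≤ _
  gcongr
  exact Seminorm.finset_sup_apply_le hB fun p hp => h p hp

/-- For supports in the ball of radius 2 the polynomial weights in the Schwartz seminorms cost a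
constant, so sup bounds on derivatives suffice. -/
lemma exists_fourierL1_schwartzOf_le {d : ℕ} : ∃ (N : ℕ) (C : ℝ), 0 ≤ C ∧
    ∀ (φ : EuclideanSpace ℝ (Fin d) → ℝ) (h1 : HasCompactSupport φ) (h2 : ContDiff ℝ (⊤ : ℕ∞) φ)
      (B : ℝ), 0 ≤ B → (∀ x, φ x ≠ 0 → ‖x‖ ≤ 2) →
      (∀ n ≤ N, ∀ x, ‖iteratedFDeriv ℝ n φ x‖ ≤ B) → fourierL1 (schwartzOf φ h1 h2) ≤ C * B := by
  obtain ⟨s, C, hC0, hC⟩ := exists_fourierL1_le (d := d)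
  refine ⟨s.sup Prod.snd, C * 2 ^ (s.sup Prod.fst), by positivity,
    fun φ h1 h2 B hB hsupp hder => ?_⟩
  rw [mul_assoc]
  refine hC _ _ (by positivity) fun p hp => ?_
  refine SchwartzMap.seminorm_le_bound ℝ _ _ _ (by positivity) fun x => ?_
  have hn : ‖iteratedFDeriv ℝ p.2 (schwartzOf φ h1 h2) x‖ ≤ ‖iteratedFDeriv ℝ p.2 φ x‖ := by
    exact (Complex.ofRealLI.norm_iteratedFDeriv_comp_left (f := φ) (x := x)
      (h2.contDiffAt) (by exact_mod_cast le_top)).le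
  by_cases hx : ‖x‖ ≤ 2
  · calc ‖x‖ ^ p.1 * ‖iteratedFDeriv ℝ p.2 (schwartzOf φ h1 h2) x‖ ≤ 2 ^ p.1 * B := by
          gcongr
          exact hn.trans (hder _ (Finset.le_sup (f := Prod.snd) hp) x)
      _ ≤ _ := by
          gcongr
          · norm_num
          · exact Finset.le_sup (f := Prod.fst) hp
  · have h0 : iteratedFDeriv ℝ p.2 φ x = 0 := by
      by_contra h
      have h3 : x ∈ tsupport φ := support_iteratedFDeriv_subset p.2 h
      have h4 : tsupport φ ⊆ Metric.closedBall 0 2 :=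
        closure_minimal (fun y hy => by simpa using hsupp y hy) Metric.isClosed_closedBall
      exact hx (by simpa using h4 h3)
    rw [h0, norm_zero] at hn
    rw [le_antisymm hn (norm_nonneg _), mul_zero]
    positivity

/-! ### Symbols cut off to a dyadic annulus -/

/-- A bump function which is `1` on the ball of radius `a` and vanishes outside that of
radius `b`. -/
def bump {d : ℕ} (a b : ℝ) (ha : 0 < a) (hab : a < b) : ContDiffBump (0 : EuclideanSpace ℝ (Fin d)) :=
  ⟨a, b, ha, hab⟩

/-- A cutoff to a neighbourhood of the annulus `3/8 ≤ |x| ≤ 4/3`. -/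
def fat {d : ℕ} (x : EuclideanSpace ℝ (Fin d)) : ℝ :=
  bump (4 / 3) 2 (by norm_num) (by norm_num) x - bump (1 / 4) (3 / 8) (by norm_num) (by norm_num) x

lemma contDiff_fat {d : ℕ} : ContDiff ℝ (⊤ : ℕ∞) (fat : EuclideanSpace ℝ (Fin d) → ℝ) :=
  (ContDiffBump.contDiff _).sub (ContDiffBump.contDiff _)

lemma fat_eq_one {d : ℕ} {x : EuclideanSpace ℝ (Fin d)} (h1 : 3 / 8 ≤ ‖x‖) (h2 : ‖x‖ ≤ 4 / 3) :
    fat x = 1 := by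
  rw [fat, ContDiffBump.one_of_mem_closedBall _ (by simpa [bump] using h2),
    ContDiffBump.zero_of_le_dist _ (by simpa [bump] using h1), sub_zero]

lemma norm_le_of_fat_ne_zero {d : ℕ} {x : EuclideanSpace ℝ (Fin d)} (h : fat x ≠ 0) :
    1 / 4 ≤ ‖x‖ ∧ ‖x‖ ≤ 2 := by
  constructor
  · by_contra! h1
    apply h
    rw [fat, ContDiffBump.one_of_mem_closedBall _ (by simp [bump]; linarith),
      ContDiffBump.one_of_mem_closedBall _ (by simp [bump]; linarith), sub_self]
  · by_contra! h1
    apply h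
    rw [fat, ContDiffBump.zero_of_le_dist _ (by simp [bump]; linarith),
      ContDiffBump.zero_of_le_dist _ (by simp [bump]; linarith), sub_self]

lemma norm_mem_of_mem_tsupport_fat {d : ℕ} {x : EuclideanSpace ℝ (Fin d)}
    (h : x ∈ tsupport (fat (d := d))) : 1 / 4 ≤ ‖x‖ ∧ ‖x‖ ≤ 2 := by
  have hc : IsClosed {x : EuclideanSpace ℝ (Fin d) | 1 / 4 ≤ ‖x‖ ∧ ‖x‖ ≤ 2} :=
    (isClosed_le continuous_const continuous_norm).inter
      (isClosed_le continuous_norm continuous_const)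
  exact closure_minimal (fun y hy => norm_le_of_fat_ne_zero hy) hc h

lemma fat_mul_compact {d : ℕ} (g : EuclideanSpace ℝ (Fin d) → ℝ) :
    HasCompactSupport fun x => fat x * g x :=
  hasCompactSupport_of_subset_ball (R := 2) fun _ hx =>
    (norm_le_of_fat_ne_zero (left_ne_zero_of_mul hx)).2

lemma contDiff_quartic {d : ℕ} (s : ℝ) : ContDiff ℝ (⊤ : ℕ∞)
    fun x : EuclideanSpace ℝ (Fin d) => -(s * (2 * Real.pi * ‖x‖) ^ 4) := by
  have h : (fun x : EuclideanSpace ℝ (Fin d) => -(s * (2 * Real.pi * ‖x‖) ^ 4)) =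
      fun x => -(s * ((2 * Real.pi) ^ 4 * (‖x‖ ^ 2) ^ 2)) := by
    funext x; ring
  rw [h]
  have := contDiff_norm_sq ℝ (E := EuclideanSpace ℝ (Fin d)) (n := (⊤ : ℕ∞))
  fun_prop

/-- The localized symbol of the semigroup. -/
def heatCut {d : ℕ} (s : ℝ) (x : EuclideanSpace ℝ (Fin d)) : ℝ :=
  fat x * Real.exp (-(s * (2 * Real.pi * ‖x‖) ^ 4))

lemma heatCut_compact {d : ℕ} (s : ℝ) : HasCompactSupport (heatCut (d := d) s) :=
  fat_mul_compact _

lemma contDiff_heatCut {d : ℕ} (s : ℝ) : ContDiff ℝ (⊤ : ℕ∞) (heatCut (d := d) s) :=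
  contDiff_fat.mul (contDiff_quartic s).exp

lemma exists_iteratedFDeriv_bound {d : ℕ} {φ : EuclideanSpace ℝ (Fin d) → ℝ}
    (h : ContDiff ℝ (⊤ : ℕ∞) φ) (N : ℕ) :
    ∃ A : ℝ, 1 ≤ A ∧ ∀ n ≤ N, ∀ x, ‖x‖ ≤ 2 → ‖iteratedFDeriv ℝ n φ x‖ ≤ A := by
  have h1 (n : ℕ) : ∃ A : ℝ, ∀ x, ‖x‖ ≤ 2 → ‖iteratedFDeriv ℝ n φ x‖ ≤ A := by
    obtain ⟨A, hA⟩ := (isCompact_closedBall (0 : EuclideanSpace ℝ (Fin d)) 2).exists_bound_of_continuousOn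
      (h.continuous_iteratedFDeriv (m := n) (by exact_mod_cast le_top)).continuousOn
    exact ⟨A, fun x hx => hA x (by simpa using hx)⟩
  choose A hA using h1
  refine ⟨1 + ∑ n ∈ Finset.range (N + 1), |A n|, ?_, fun n hn x hx => ?_⟩
  · have : 0 ≤ ∑ n ∈ Finset.range (N + 1), |A n| := Finset.sum_nonneg fun n _ => abs_nonneg _
    linarith
  · have := Finset.single_le_sum (f := fun n => |A n|) (s := Finset.range (N + 1))
      (fun n _ => abs_nonneg _) (Finset.mem_range.2 (Nat.lt_succ_of_le hn))
    have h2 := hA n x hx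
    have h3 := le_abs_self (A n)
    linarith

/-- Away from the origin the exponential decays at least like e^{-s}, while each derivative loses at
most a multiple of 1 + s. The exponential therefore wins, leaving the decay in s on which parabolic
smoothing rests. -/
lemma exists_iteratedFDeriv_heatCut_le {d : ℕ} (N : ℕ) : ∃ C : ℝ, 0 ≤ C ∧
    ∀ s : ℝ, 0 ≤ s → ∀ n ≤ N, ∀ x : EuclideanSpace ℝ (Fin d),
      ‖iteratedFDeriv ℝ n (heatCut s) x‖ ≤ C / (1 + s) := by
  obtain ⟨A, hA1, hA⟩ := exists_iteratedFDeriv_bound (contDiff_fat (d := d)) N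
  obtain ⟨D, hD1, hD⟩ := exists_iteratedFDeriv_bound (contDiff_quartic (d := d) 1) N
  refine ⟨2 ^ N * (A * (N.factorial * D ^ N * ((N + 1).factorial * Real.exp 1))), by positivity,
    fun s hs n hn x => ?_⟩
  -- From (1+s)^{N+1} ≤ (N+1)! e^{1+s}: the losses of N derivatives are absorbed with one power of 1
  -- + s to spare.
  have hdecay : Real.exp (-s) * (1 + s) ^ N ≤ (N + 1).factorial * Real.exp 1 / (1 + s) := by
    have h1 := Real.pow_div_factorial_le_exp (1 + s) (by positivity) (N + 1)
    rw [div_le_iff₀ (by positivity), Real.exp_add] at h1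
    rw [le_div_iff₀ (by positivity), mul_assoc, ← pow_succ, Real.exp_neg, ← div_eq_inv_mul,
      div_le_iff₀ (Real.exp_pos s)]
    linarith
  by_cases hx : x ∈ tsupport (fat (d := d))
  swap
  · have h0 : iteratedFDeriv ℝ n (heatCut s) x = 0 := by
      by_contra h
      refine hx (closure_mono ?_ (support_iteratedFDeriv_subset n h))
      exact Function.support_mul_subset_left _ _
    rw [h0, norm_zero]
    positivity
  obtain ⟨hx1, hx2⟩ := norm_mem_of_mem_tsupport_fat hx
  have hexp (j : ℕ) (hj : j ≤ n) : ‖iteratedFDeriv ℝ j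
      (fun x : EuclideanSpace ℝ (Fin d) => Real.exp (-(s * (2 * Real.pi * ‖x‖) ^ 4))) x‖ ≤
      N.factorial * D ^ N * (Real.exp (-s) * (1 + s) ^ N) := by
    -- On the support of `fat` one has ‖x‖ ≥ 1/4, so 2π‖x‖ > 1.
    have hpx : s ≤ s * (2 * Real.pi * ‖x‖) ^ 4 := by
      refine le_mul_of_one_le_right hs (one_le_pow₀ ?_)
      have := Real.pi_gt_three
      nlinarith
    -- The exponent is linear in s, so its derivatives are at most (1+s)D; as this number is at
    -- least 1, it is also below its i-th power, the form the composition bound requires.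
    have h := norm_iteratedFDeriv_comp_le (g := Real.exp)
      (f := fun x : EuclideanSpace ℝ (Fin d) => -(s * (2 * Real.pi * ‖x‖) ^ 4)) (n := j)
      (N := (⊤ : ℕ∞)) Real.contDiff_exp (contDiff_quartic s) (by exact_mod_cast le_top) x
      (C := Real.exp (-s)) (D := (1 + s) * D) (fun i _ => by
        rw [norm_iteratedFDeriv_eq_norm_iteratedDeriv, iteratedDeriv_eq_iterate,
          Real.iter_deriv_exp, Real.norm_eq_abs, Real.abs_exp]
        exact Real.exp_le_exp.2 (by linarith)) (fun i hi1 hi => by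
        have h1 : (fun x : EuclideanSpace ℝ (Fin d) => -(s * (2 * Real.pi * ‖x‖) ^ 4)) =
            s • fun x : EuclideanSpace ℝ (Fin d) => -(1 * (2 * Real.pi * ‖x‖) ^ 4) := by
          funext x; simp
        rw [h1, iteratedFDeriv_const_smul_apply ((contDiff_quartic 1).contDiffAt.of_le
          (by exact_mod_cast le_top)), norm_smul, Real.norm_of_nonneg hs]
        calc s * _ ≤ (1 + s) * D := by
              gcongr
              · linarith
              · exact hD i (hi.trans (hj.trans hn)) x hx2
          _ ≤ ((1 + s) * D) ^ i := by
              refine le_self_pow₀ ?_ (by omega)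
              nlinarith)
    refine h.trans ?_
    have h1 : (j.factorial : ℝ) ≤ N.factorial := by
      exact_mod_cast Nat.factorial_le (hj.trans hn)
    have h2 : ((1 + s) * D) ^ j ≤ ((1 + s) * D) ^ N :=
      pow_le_pow_right₀ (by nlinarith) (hj.trans hn)
    calc _ ≤ (N.factorial : ℝ) * Real.exp (-s) * ((1 + s) * D) ^ N := by gcongr
      _ = _ := by rw [mul_pow]; ring
  have hmul := norm_iteratedFDeriv_mul_le (N := (⊤ : ℕ∞)) (contDiff_fat (d := d))
    (contDiff_quartic s).exp x (n := n) (by exact_mod_cast le_top)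
  refine hmul.trans ?_
  calc _ ≤ ∑ i ∈ Finset.range (n + 1), (n.choose i : ℝ) * A *
        (N.factorial * D ^ N * (Real.exp (-s) * (1 + s) ^ N)) := by
        refine Finset.sum_le_sum fun i hi => ?_
        have hi' : i ≤ n := Nat.lt_succ_iff.1 (Finset.mem_range.1 hi)
        gcongr
        · exact hA i (hi'.trans hn) x hx2
        · exact hexp (n - i) (Nat.sub_le _ _)
    _ = 2 ^ n * (A * (N.factorial * D ^ N * (Real.exp (-s) * (1 + s) ^ N))) := by
        rw [← Finset.sum_mul, ← Finset.sum_mul]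
        have := Nat.sum_range_choose n
        have h2 : ∑ i ∈ Finset.range (n + 1), (n.choose i : ℝ) = 2 ^ n := by exact_mod_cast this
        rw [h2]
        ring
    _ ≤ 2 ^ N * (A * (N.factorial * D ^ N * ((N + 1).factorial * Real.exp 1 / (1 + s)))) := by
        gcongr
        norm_num
    _ = _ := by ring

lemma exists_fourierL1_heatCut_le {d : ℕ} : ∃ C : ℝ, 0 ≤ C ∧ ∀ s : ℝ, 0 ≤ s →
    fourierL1 (schwartzOf (heatCut (d := d) s) (heatCut_compact s) (contDiff_heatCut s)) ≤
      C / (1 + s) := by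
  obtain ⟨N, C, hC0, hC⟩ := exists_fourierL1_schwartzOf_le (d := d)
  obtain ⟨B, hB0, hB⟩ := exists_iteratedFDeriv_heatCut_le (d := d) N
  refine ⟨C * B, by positivity, fun s hs => ?_⟩
  rw [mul_div_assoc]
  exact hC _ _ _ _ (by positivity)
    (fun x hx => (norm_le_of_fat_ne_zero (left_ne_zero_of_mul hx)).2) (hB s hs)

/-- The localized symbol of the Laplacian. -/
def lapCut {d : ℕ} (x : EuclideanSpace ℝ (Fin d)) : ℝ := fat x * (-(2 * Real.pi * ‖x‖) ^ 2)

lemma lapCut_compact {d : ℕ} : HasCompactSupport (lapCut (d := d)) := fat_mul_compact _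

lemma contDiff_lapCut {d : ℕ} : ContDiff ℝ (⊤ : ℕ∞) (lapCut (d := d)) := by
  have := contDiff_norm_sq ℝ (E := EuclideanSpace ℝ (Fin d)) (n := (⊤ : ℕ∞))
  refine contDiff_fat.mul ?_
  simp only [mul_pow]
  fun_prop

/-- The localized symbol of the inverse Laplacian. -/
def invCut {d : ℕ} (x : EuclideanSpace ℝ (Fin d)) : ℝ :=
  -- The bump only keeps the denominator from vanishing at 0; it lives where `fat` is zero, so the
  -- symbol is not altered.
  fat x * (-((2 * Real.pi * ‖x‖) ^ 2 +
    bump (1 / 8) (1 / 4) (by norm_num) (by norm_num) x)⁻¹)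

lemma invCut_compact {d : ℕ} : HasCompactSupport (invCut (d := d)) := fat_mul_compact _

lemma contDiff_invCut {d : ℕ} : ContDiff ℝ (⊤ : ℕ∞) (invCut (d := d)) := by
  have h := contDiff_norm_sq ℝ (E := EuclideanSpace ℝ (Fin d)) (n := (⊤ : ℕ∞))
  refine contDiff_fat.mul (ContDiff.neg (ContDiff.inv ?_ fun x => ?_))
  · refine ContDiff.add ?_ (ContDiffBump.contDiff _)
    simp only [mul_pow]
    fun_prop
  · by_cases hx : x = 0
    · subst hx
      rw [ContDiffBump.one_of_mem_closedBall _ (by simp [bump])]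
      simp
    · have h1 : 0 < ‖x‖ := norm_pos_iff.2 hx
      have h2 := ContDiffBump.nonneg (x := x)
        (bump (d := d) (1 / 8) (1 / 4) (by norm_num) (by norm_num))
      positivity

lemma invCut_eq {d : ℕ} {x : EuclideanSpace ℝ (Fin d)} (h1 : 3 / 8 ≤ ‖x‖) (h2 : ‖x‖ ≤ 4 / 3) :
    invCut x = -((2 * Real.pi * ‖x‖) ^ 2)⁻¹ := by
  rw [invCut, fat_eq_one h1 h2, ContDiffBump.zero_of_le_dist _ (by simp [bump]; linarith),
    add_zero, one_mul]

end

end CahnHilliard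

namespace CahnHilliard

open UnitAddTorus
open scoped FourierTransform SchwartzMap ComplexConjugate

noncomputable section

/-! ### Estimates on Littlewood-Paley blocks -/

lemma fc_sub {d : ℕ} (m : Fin d → ℤ) (f g : Dist d) : fc m (f - g) = fc m f - fc m g :=
  map_sub (fc m) f g

lemma mult_const_mul {d : ℕ} {σ : (Fin d → ℤ) → ℝ} {f : Dist d} (h : MultSummable σ f) (c : ℝ)
    (x : Torus d) : mult (fun m => c * σ m) f x = c * mult σ f x := by
  have h' : MultSummable (fun m => c * σ m) f := by
    refine (h.mul_left |c|).congr fun m => ?_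
    rw [abs_mul, mul_assoc]
  refine (h'.hasSum_apply x).unique ?_
  simpa only [mul_assoc] using (h.hasSum_apply x).mul_left c

lemma DyadicPartition.block_add {d : ℕ} (χ : DyadicPartition d) (k : ℕ) (f g : Dist d)
    (x : Torus d) : χ.block k (f + g) x = χ.block k f x + χ.block k g x := rfl

lemma DyadicPartition.block_sub {d : ℕ} (χ : DyadicPartition d) (k : ℕ) (f g : Dist d)
    (x : Torus d) : χ.block k (f - g) x = χ.block k f x - χ.block k g x := rfl

lemma DyadicPartition.block_smul {d : ℕ} (χ : DyadicPartition d) (k : ℕ) (c : ℝ) (f : Dist d)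
    (x : Torus d) : χ.block k (c • f) x = c * χ.block k f x := rfl

lemma DyadicPartition.exists_block_ofContinuous_le {d : ℕ} (χ : DyadicPartition d) :
    ∃ C : ℝ, 0 ≤ C ∧ ∀ (k : ℕ) (u : Torus d → ℝ) (hu : Continuous u) (M : ℝ), (∀ x, |u x| ≤ M) →
      ∀ x, |χ.block k (ofContinuous u hu) x| ≤ C * M := by
  refine ⟨fourierL1 (schwartzOf χ.low χ.low_compact χ.low_smooth) +
    fourierL1 (schwartzOf χ.ann χ.ann_compact χ.ann_smooth),
    add_nonneg (fourierL1_nonneg _) (fourierL1_nonneg _), fun k u hu M hM x => ?_⟩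
  have hM0 : 0 ≤ M := (abs_nonneg _).trans (hM x)
  have h1 := mul_nonneg (fourierL1_nonneg (schwartzOf χ.low χ.low_compact χ.low_smooth)) hM0
  have h2 := mul_nonneg (fourierL1_nonneg (schwartzOf χ.ann χ.ann_compact χ.ann_smooth)) hM0
  rw [χ.block_eq_mult, add_mul]
  cases k with
  | zero =>
    have h := abs_mult_ofContinuous_le χ.low χ.low_compact χ.low_smooth one_pos hu hM x
    simp only [one_smul] at h
    exact h.trans (le_add_of_nonneg_right h2)
  | succ q =>
    have h := abs_mult_ofContinuous_le χ.ann χ.ann_compact χ.ann_smooth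
      (ε := (2 : ℝ)⁻¹ ^ q) (by positivity) hu hM x
    exact h.trans (le_add_of_nonneg_left h1)

lemma DyadicPartition.norm_rho_mul_fc_le {d : ℕ} (χ : DyadicPartition d) {k : ℕ} {f : Dist d}
    {M : ℝ} (hM : ∀ x, |χ.block k f x| ≤ M) (m : Fin d → ℤ) :
    ‖(χ.rho k (freq m) : ℂ) * fc m f‖ ≤ M := by
  rw [← χ.fc_block, fc_ofContinuous]
  exact (norm_coeff_le _ _).trans (norm_cx_le _ ((abs_nonneg _).trans (hM 0)) hM)

/-- A crude bound by the number of modes. It serves for a fixed block, or with B = 0, where the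
growth of that number in k is harmless. -/
lemma DyadicPartition.abs_block_le_of_fc {d : ℕ} (χ : DyadicPartition d) {k : ℕ} {f : Dist d}
    {B : ℝ} (hB : ∀ m ∈ χ.modes k, ‖(χ.rho k (freq m) : ℂ) * fc m f‖ ≤ B) (x : Torus d) :
    |χ.block k f x| ≤ (χ.modes k).card * B := by
  rw [block_eq_mult]
  have h := (multSummable_of_finite (χ.finite_support k) f).hasSum_apply x
  have h2 : mult (fun m => χ.rho k (freq m)) f x =
      ∑ m ∈ χ.modes k, χ.rho k (freq m) * (fc m f * mFourier m x).re := by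
    refine h.unique (hasSum_sum_of_ne_finset_zero fun m hm => ?_)
    rw [χ.mem_modes, not_not] at hm
    rw [hm, zero_mul]
  rw [h2, ← nsmul_eq_mul]
  refine (Finset.abs_sum_le_sum_abs _ _).trans (Finset.sum_le_card_nsmul _ _ _ fun m hm => ?_)
  refine le_trans ?_ (hB m hm)
  rw [← Complex.re_ofReal_mul, ← mul_assoc]
  refine (Complex.abs_re_le_norm _).trans ?_
  rw [norm_mul _ (mFourier m x), norm_mFourier_apply, mul_one]

/-! ### The semigroup and the Laplacian on single blocks -/

lemma norm_dilation {d : ℕ} (k : ℕ) (x : EuclideanSpace ℝ (Fin d)) :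
    ‖(2 : ℝ)⁻¹ ^ k • x‖ = ‖x‖ / 2 ^ k := by
  rw [norm_smul, norm_pow, norm_inv, Real.norm_ofNat, inv_pow, div_eq_inv_mul]

lemma DyadicPartition.norm_dilation_mem {d : ℕ} (χ : DyadicPartition d) {k : ℕ} (hk : k ≠ 0)
    {x : EuclideanSpace ℝ (Fin d)} (hx : χ.rho k x ≠ 0) :
    3 / 8 ≤ ‖(2 : ℝ)⁻¹ ^ k • x‖ ∧ ‖(2 : ℝ)⁻¹ ^ k • x‖ ≤ 4 / 3 := by
  rw [norm_dilation, le_div_iff₀ (by positivity), div_le_iff₀ (by positivity)]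
  exact ⟨χ.le_norm_of_rho_ne_zero hk hx, χ.norm_le_of_rho_ne_zero hx⟩

/-- A block of `g` is a multiplier applied to a block of `f`. -/
lemma DyadicPartition.block_eq_mult_block {d : ℕ} (χ : DyadicPartition d) {k : ℕ} {f g : Dist d}
    {σ : (Fin d → ℤ) → ℝ}
    (h : ∀ m, χ.rho k (freq m) ≠ 0 → fc m g = σ m * fc m f) :
    χ.block k g = mult σ (ofContinuous (χ.block k f) (χ.continuous_block k f)) := by
  rw [block_eq_mult]
  refine mult_congr fun m => ?_
  rw [χ.fc_block]
  by_cases hm : χ.rho k (freq m) = 0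
  · simp [hm]
  · rw [h m hm]
    ring

/-- For k ≠ 0 the frequencies of the block, scaled by 2^{-k}, lie where `fat` is 1. So P_r acts on
the block through `heatCut (r * 16 ^ k)` at scale 2^{-k}, and the L¹ bound for that cutoff applies.
-/
lemma DyadicPartition.exists_block_semigroup_le {d : ℕ} (χ : DyadicPartition d) :
    ∃ C : ℝ, 0 ≤ C ∧ ∀ (k : ℕ), k ≠ 0 → ∀ (r : ℝ), 0 ≤ r → ∀ (f : Dist d) (M : ℝ),
      (∀ x, |χ.block k f x| ≤ M) →
      ∀ x, |χ.block k (semigroup r f) x| ≤ C / (1 + r * 16 ^ k) * M := by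
  obtain ⟨C, hC0, hC⟩ := exists_fourierL1_heatCut_le (d := d)
  refine ⟨C, hC0, fun k hk r hr f M hM x => ?_⟩
  have hM0 : 0 ≤ M := (abs_nonneg _).trans (hM x)
  have h := χ.block_eq_mult_block (k := k) (f := f) (g := semigroup r f)
    (σ := fun m => heatCut (r * 16 ^ k) ((2 : ℝ)⁻¹ ^ k • freq m)) fun m hm => by
      obtain ⟨h1, h2⟩ := χ.norm_dilation_mem hk hm
      rw [χ.fc_semigroup hr, heatCut, fat_eq_one h1 h2, one_mul, norm_dilation, heatSymbol]
      congr 4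
      rw [← mul_div_assoc, div_pow, ← pow_mul, mul_comm k, pow_mul]
      norm_num
      field_simp
  rw [h]
  refine (abs_mult_ofContinuous_le _ (heatCut_compact _) (contDiff_heatCut _) (by positivity)
    _ hM x).trans ?_
  gcongr
  exact hC _ (by positivity)

lemma DyadicPartition.exists_block_lap_le {d : ℕ} (χ : DyadicPartition d) :
    ∃ C : ℝ, 0 ≤ C ∧ ∀ (k : ℕ), k ≠ 0 → ∀ (f : Dist d) (M : ℝ), (∀ x, |χ.block k f x| ≤ M) →
      ∀ x, |χ.block k (lap f) x| ≤ C * 4 ^ k * M := by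
  refine ⟨_, fourierL1_nonneg (schwartzOf (d := d) lapCut lapCut_compact contDiff_lapCut),
    fun k hk f M hM x => ?_⟩
  have hM0 : 0 ≤ M := (abs_nonneg _).trans (hM x)
  have h := χ.block_eq_mult_block (k := k) (f := f) (g := lap f)
    (σ := fun m => 4 ^ k * lapCut ((2 : ℝ)⁻¹ ^ k • freq m)) fun m hm => by
      obtain ⟨h1, h2⟩ := χ.norm_dilation_mem hk hm
      rw [fc_lap, lapCut, fat_eq_one h1 h2, one_mul, norm_dilation]
      congr 2
      rw [← mul_div_assoc, div_pow, ← pow_mul, mul_comm k, pow_mul]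
      norm_num
      field_simp
  rw [h, mult_const_mul (multSummable_of_finite
    (finite_support_dilation lapCut_compact (by positivity)) _), abs_mul,
    abs_of_nonneg (by positivity), mul_comm _ (4 ^ k : ℝ), mul_assoc]
  gcongr
  exact abs_mult_ofContinuous_le _ lapCut_compact contDiff_lapCut (by positivity) _ hM x

lemma heatSymbol_le_one {d : ℕ} {r : ℝ} (hr : 0 ≤ r) (m : Fin d → ℤ) : heatSymbol r m ≤ 1 := by
  rw [heatSymbol, Real.exp_le_one_iff]
  have : 0 ≤ r * (2 * Real.pi * ‖freq m‖) ^ 4 := by positivity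
  linarith

lemma heatSymbol_nonneg {d : ℕ} (r : ℝ) (m : Fin d → ℤ) : 0 ≤ heatSymbol r m :=
  (Real.exp_pos _).le

lemma one_le_norm_freq {d : ℕ} {m : Fin d → ℤ} (hm : m ≠ 0) : 1 ≤ ‖freq m‖ := by
  obtain ⟨i, hi⟩ := Function.ne_iff.1 hm
  refine le_trans ?_ (PiLp.norm_apply_le (freq m) i)
  have : (1 : ℤ) ≤ |m i| := Int.one_le_abs hi
  change (1 : ℝ) ≤ |(m i : ℝ)|
  exact_mod_cast this

lemma heatSymbol_le {d : ℕ} {r : ℝ} (hr : 0 ≤ r) {m : Fin d → ℤ} (hm : m ≠ 0) :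
    heatSymbol r m ≤ (1 + r)⁻¹ := by
  have h1 := one_le_norm_freq hm
  have h2 : r ≤ r * (2 * Real.pi * ‖freq m‖) ^ 4 := by
    refine le_mul_of_one_le_right hr (one_le_pow₀ ?_)
    have := Real.pi_gt_three
    nlinarith
  rw [heatSymbol, Real.exp_neg]
  gcongr
  have := Real.add_one_le_exp (r * (2 * Real.pi * ‖freq m‖) ^ 4)
  linarith

/-- The semigroup is bounded on each block. -/
lemma DyadicPartition.exists_block_semigroup_le' {d : ℕ} (χ : DyadicPartition d) :
    ∃ C : ℝ, 0 ≤ C ∧ ∀ (k : ℕ) (r : ℝ), 0 ≤ r → ∀ (f : Dist d) (M : ℝ),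
      (∀ x, |χ.block k f x| ≤ M) → ∀ x, |χ.block k (semigroup r f) x| ≤ C * M := by
  obtain ⟨C, hC0, hC⟩ := χ.exists_block_semigroup_le
  refine ⟨C + (χ.modes 0).card, by positivity, fun k r hr f M hM x => ?_⟩
  have hM0 : 0 ≤ M := (abs_nonneg _).trans (hM x)
  rw [add_mul]
  -- The lowest block contains frequencies near 0, where no annulus is available; it is treated mode
  -- by mode.
  by_cases hk : k = 0
  · subst hk
    refine (χ.abs_block_le_of_fc (B := M) (fun m _ => ?_) x).trans
      (le_add_of_nonneg_left (by positivity))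
    rw [χ.fc_semigroup hr, mul_left_comm, norm_mul, Complex.norm_real,
      Real.norm_of_nonneg (heatSymbol_nonneg r m)]
    exact (mul_le_of_le_one_left (norm_nonneg _) (heatSymbol_le_one hr m)).trans
      (χ.norm_rho_mul_fc_le hM m)
  · refine (hC k hk r hr f M hM x).trans (le_add_of_le_of_nonneg ?_ (by positivity))
    gcongr
    refine div_le_self hC0 ?_
    have : 0 ≤ r * 16 ^ k := by positivity
    linarith

/-- The smoothing estimate for `P_r Δ` on each block. -/
lemma DyadicPartition.exists_block_semigroup_lap_le {d : ℕ} (χ : DyadicPartition d) :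
    ∃ C : ℝ, 0 ≤ C ∧ ∀ (k : ℕ) (r : ℝ), 0 ≤ r → ∀ (f : Dist d) (M : ℝ),
      (∀ x, |χ.block k f x| ≤ M) →
      ∀ x, |χ.block k (semigroup r (lap f)) x| ≤ C * (4 ^ k / (1 + r * 16 ^ k)) * M := by
  obtain ⟨C, hC0, hC⟩ := χ.exists_block_semigroup_le
  obtain ⟨D, hD0, hD⟩ := χ.exists_block_lap_le
  refine ⟨C * D + (χ.modes 0).card * (2 * Real.pi * (4 / 3)) ^ 2, by positivity,
    fun k r hr f M hM x => ?_⟩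
  have hM0 : 0 ≤ M := (abs_nonneg _).trans (hM x)
  rw [add_mul, add_mul]
  by_cases hk : k = 0
  · subst hk
    refine (χ.abs_block_le_of_fc (B := (2 * Real.pi * (4 / 3)) ^ 2 * (1 + r)⁻¹ * M)
      (fun m hm => ?_) x).trans ?_
    · rw [χ.fc_semigroup hr, fc_lap]
      -- The zero mode does not decay under P_r, but the Laplacian removes it; all other modes decay
      -- at least like 1/(1 + r).
      by_cases hm0 : m = 0
      · subst hm0
        simp only [freq_zero, norm_zero, mul_zero]
        norm_num
        positivity
      · have h1 := χ.norm_le_of_rho_ne_zero (χ.mem_modes.1 hm)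
        rw [pow_zero, mul_one] at h1
        have h2 : ((χ.rho 0 (freq m) : ℂ) * (heatSymbol r m *
            (((-(2 * Real.pi * ‖freq m‖) ^ 2 : ℝ) : ℂ) * fc m f))) =
            ((-((2 * Real.pi * ‖freq m‖) ^ 2 * heatSymbol r m) : ℝ) : ℂ) *
              ((χ.rho 0 (freq m) : ℂ) * fc m f) := by
          push_cast; ring
        rw [h2, norm_mul, Complex.norm_real, norm_neg, Real.norm_of_nonneg
          (mul_nonneg (by positivity) (heatSymbol_nonneg r m))]
        gcongr
        · exact heatSymbol_nonneg r m
        · exact heatSymbol_le hr hm0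
        · exact χ.norm_rho_mul_fc_le hM m
    · refine (le_of_eq ?_).trans (le_add_of_nonneg_left (by positivity))
      simp only [pow_zero, mul_one]
      ring
  · refine (hC k hk r hr _ _ (hD k hk f M hM) x).trans ((le_of_eq ?_).trans
      (le_add_of_nonneg_right (by positivity)))
    ring

/-- The semigroup converges to the identity on each block. -/
lemma DyadicPartition.exists_block_semigroup_sub_le {d : ℕ} (χ : DyadicPartition d) (k : ℕ) :
    ∃ C : ℝ, 0 ≤ C ∧ ∀ (r : ℝ), 0 ≤ r → ∀ (f : Dist d) (M : ℝ), (∀ x, |χ.block k f x| ≤ M) →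
      ∀ x, |χ.block k (semigroup r f - f) x| ≤ C * r * M := by
  refine ⟨(χ.modes k).card * (2 * Real.pi * (4 / 3 * 2 ^ k)) ^ 4, by positivity,
    fun r hr f M hM x => ?_⟩
  have hM0 : 0 ≤ M := (abs_nonneg _).trans (hM x)
  refine (χ.abs_block_le_of_fc (B := (2 * Real.pi * (4 / 3 * 2 ^ k)) ^ 4 * r * M)
    (fun m hm => ?_) x).trans (le_of_eq (by ring))
  have h1 := χ.norm_le_of_rho_ne_zero (χ.mem_modes.1 hm)
  have h2 : ((χ.rho k (freq m) : ℂ) * fc m (semigroup r f - f)) =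
      ((-(1 - heatSymbol r m) : ℝ) : ℂ) * ((χ.rho k (freq m) : ℂ) * fc m f) := by
    rw [fc_sub, χ.fc_semigroup hr]
    push_cast; ring
  have h3 : 1 - heatSymbol r m ≤ (2 * Real.pi * (4 / 3 * 2 ^ k)) ^ 4 * r := by
    have h4 := Real.add_one_le_exp (-(r * (2 * Real.pi * ‖freq m‖) ^ 4))
    have h5 : r * (2 * Real.pi * ‖freq m‖) ^ 4 ≤ r * (2 * Real.pi * (4 / 3 * 2 ^ k)) ^ 4 := by
      gcongr
    rw [heatSymbol]
    linarith
  have h4 := heatSymbol_le_one hr m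
  rw [h2, norm_mul, Complex.norm_real, norm_neg, Real.norm_of_nonneg (by linarith)]
  gcongr
  exact χ.norm_rho_mul_fc_le hM m

/-- The Laplacian on test functions. -/
def lapT {d : ℕ} : TestFun d →ₗ[ℝ] TestFun d := ∑ i, pd i ∘ₗ pd i

lemma abs_ofContinuous_apply_le {d : ℕ} {u : Torus d → ℝ} (hu : Continuous u) (φ : TestFun d)
    {M L : ℝ} (hM : ∀ x, |u x| ≤ M) (hL : ∀ x, |φ.1 x| ≤ L) :
    |(ofContinuous u hu).1 φ| ≤ M * L := by
  have h := norm_integral_le_of_norm_le_const (μ := (volume : Measure (Torus d)))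
    (f := fun x => u x * φ.1 x) (C := M * L) (ae_of_all _ fun x => by
      rw [norm_mul]
      exact mul_le_mul (hM x) (hL x) (norm_nonneg _) ((abs_nonneg _).trans (hM x)))
  simpa using! h

/-- Testing a block against a smooth function gains two derivatives. -/
lemma DyadicPartition.exists_integral_block_le {d : ℕ} (χ : DyadicPartition d) :
    ∃ C : ℝ, 0 ≤ C ∧ ∀ (k : ℕ) (f : Dist d) (φ : TestFun d) (M L : ℝ),
      (∀ x, |χ.block k f x| ≤ M) → (∀ x, |φ.1 x| ≤ L) → (∀ x, |(lapT φ).1 x| ≤ L) →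
      |∫ x, χ.block k f x * φ.1 x| ≤ C * (4 ^ k)⁻¹ * M * L := by
  set D := fourierL1 (schwartzOf (d := d) invCut invCut_compact contDiff_invCut) with hD
  have hD0 : 0 ≤ D := fourierL1_nonneg _
  refine ⟨D + 1, by positivity, fun k f φ M L hM hL hL' => ?_⟩
  have hM0 : 0 ≤ M := (abs_nonneg _).trans (hM 0)
  have hL0 : 0 ≤ L := (abs_nonneg _).trans (hL 0)
  by_cases hk : k = 0
  · subst hk
    refine (abs_ofContinuous_apply_le (χ.continuous_block 0 f) φ hM hL).trans ?_
    have : 0 ≤ D * (M * L) := by positivity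
    rw [pow_zero, inv_one, mul_one]
    linarith
  · have hfin := finite_support_dilation (d := d) invCut_compact
      (ε := (2 : ℝ)⁻¹ ^ k) (by positivity)
    set w := mult (fun m => invCut ((2 : ℝ)⁻¹ ^ k • freq m))
      (ofContinuous (χ.block k f) (χ.continuous_block k f)) with hw
    have hev (m : Fin d → ℤ) : invCut ((2 : ℝ)⁻¹ ^ k • freq (-m)) =
        invCut ((2 : ℝ)⁻¹ ^ k • freq m) := by
      rw [freq_neg, smul_neg, invCut, invCut, norm_neg, fat, fat, ContDiffBump.neg,
        ContDiffBump.neg, ContDiffBump.neg]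
    -- The block is 4^{-k} times the Laplacian of w, where w is controlled by the block uniformly in
    -- k; the Laplacian is then moved to the test function.
    have h1 : ofContinuous (χ.block k f) (χ.continuous_block k f) =
        ((4 : ℝ) ^ k)⁻¹ • lap (ofContinuous w (continuous_mult _ _)) := by
      refine χ.fc_ext fun m => ?_
      rw [map_smul, fc_lap, fc_ofContinuous_mult (multSummable_of_finite hfin _) hev, χ.fc_block]
      by_cases hm : χ.rho k (freq m) = 0
      · simp [hm]
      · obtain ⟨h1, h2⟩ := χ.norm_dilation_mem hk hm
        have hne : ‖freq m‖ ≠ 0 := by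
          have := χ.le_norm_of_rho_ne_zero hk hm
          have h4 : (0 : ℝ) < 2 ^ k := by positivity
          intro h5
          rw [h5] at this
          linarith
        have h3 : ((4 : ℝ) ^ k)⁻¹ * (-(2 * Real.pi * ‖freq m‖) ^ 2 *
            invCut ((2 : ℝ)⁻¹ ^ k • freq m)) = 1 := by
          rw [invCut_eq h1 h2, norm_dilation, ← mul_div_assoc, div_pow, ← pow_mul, mul_comm k,
            pow_mul]
          norm_num
          field_simp
        rw [Complex.real_smul, ← mul_assoc (invCut _ : ℂ), mul_comm (invCut _ : ℂ),
          mul_assoc _ (invCut _ : ℂ), ← mul_assoc _ (invCut _ : ℂ), mul_left_comm, ← mul_assoc,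
          ← mul_assoc] 
        have h4 := congrArg (fun t : ℝ => (t : ℂ)) h3
        push_cast at h4 ⊢
        linear_combination -((χ.rho k (freq m) : ℂ) * fc m f) * h4
    have h2 : ∫ x, χ.block k f x * φ.1 x =
        ((4 : ℝ) ^ k)⁻¹ * (ofContinuous w (continuous_mult _ _)).1 (lapT φ) :=
      congrArg (fun f : Dist d => f.1 φ) h1
    have h3 := abs_ofContinuous_apply_le (continuous_mult _ _) (lapT φ)
      (abs_mult_ofContinuous_le _ invCut_compact contDiff_invCut
        (ε := (2 : ℝ)⁻¹ ^ k) (by positivity) (χ.continuous_block k f) hM) hL'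
    rw [h2, abs_mul, abs_of_nonneg (by positivity)]
    calc _ ≤ ((4 : ℝ) ^ k)⁻¹ * (D * M * L) := by gcongr
      _ ≤ ((4 : ℝ) ^ k)⁻¹ * ((D + 1) * M * L) := by gcongr; linarith
      _ = _ := by ring

/-! ### Frequency localization of products -/

lemma fc_ofContinuous_mul {d : ℕ} {σ : (Fin d → ℤ) → ℝ} {f : Dist d}
    (hfin : (Function.support σ).Finite) (hσ : ∀ m, σ (-m) = σ m) {v : Torus d → ℝ}
    (hv : Continuous v) (m : Fin d → ℤ) :
    fc m (ofContinuous (fun x => mult σ f x * v x) ((continuous_mult σ f).mul hv)) =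
      ∑ n ∈ hfin.toFinset, (σ n * fc n f) * fc (m - n) (ofContinuous v hv) := by
  have h0 := multSummable_of_finite hfin f
  have h1 : cx (fun x => mult σ f x * v x) ((continuous_mult σ f).mul hv) =
      multC σ f * cx v hv := by
    rw [← cx_mult h0 hσ]
    ext x
    simp
  have h2 : multC σ f = ∑ n ∈ hfin.toFinset, ((σ n : ℂ) * fc n f) • mFourier n := by
    refine h0.hasSum.unique (hasSum_sum_of_ne_finset_zero fun n hn => ?_)
    have : σ n = 0 := by
      by_contra h
      exact hn (hfin.mem_toFinset.2 h)
    rw [this]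
    ext x
    simp only [ContinuousMap.smul_apply, Complex.ofReal_zero, zero_mul, zero_smul,
      ContinuousMap.zero_apply]
  rw [fc_ofContinuous, h1, h2, Finset.sum_mul, map_sum]
  refine Finset.sum_congr rfl fun n _ => ?_
  rw [smul_mul_assoc, map_smul, coeff_mFourier_mul, fc_ofContinuous, smul_eq_mul]

/-- Block k lies in 3/8·2^k ≤ |m| ≤ 4/3·2^k, without the lower bound if k = 0. If i and j are at
most k - 3, then sums of their frequencies have size at most 4/3·2·2^k/8 = 2^k/3, and 1/3 < 3/8. The
second alternative is the same argument with j and k exchanged. -/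
lemma DyadicPartition.block_mul_eq_zero {d : ℕ} (χ : DyadicPartition d) {i j k : ℕ} (f g : Dist d)
    (h : max i j + 3 ≤ k ∨ max i k + 3 ≤ j) (x : Torus d) :
    χ.block k (ofContinuous (fun x => χ.block i f x * χ.block j g x)
      ((χ.continuous_block i f).mul (χ.continuous_block j g))) x = 0 := by
  have hfc (m) (hm : χ.rho k (freq m) ≠ 0) :
      fc m (ofContinuous (fun x => χ.block i f x * χ.block j g x)
        ((χ.continuous_block i f).mul (χ.continuous_block j g))) = 0 := by
    have h1 := fc_ofContinuous_mul (f := f) (χ.finite_support i) (χ.rho_even i)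
      (χ.continuous_block j g) m
    have h2 : (fun x => χ.block i f x * χ.block j g x) =
        fun x => mult (fun m => χ.rho i (freq m)) f x * χ.block j g x := by
      rw [χ.block_eq_mult i f]
    refine (congrArg (fc m) (ofContinuous_congr _
      ((continuous_mult _ f).mul (χ.continuous_block j g)) h2)).trans (h1.trans ?_)
    refine Finset.sum_eq_zero fun n _ => ?_
    rw [χ.fc_block]
    by_cases hn : χ.rho i (freq n) = 0
    · simp [hn]
    by_cases hmn : χ.rho j (freq (m - n)) = 0
    · simp [hmn]
    exfalso
    have hi := χ.norm_le_of_rho_ne_zero hn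
    rw [freq_sub] at hmn
    have hpow {a b : ℕ} (hab : a + 3 ≤ b) : (2 : ℝ) ^ a * 8 ≤ 2 ^ b := by
      calc (2 : ℝ) ^ a * 8 = 2 ^ (a + 3) := by rw [pow_add]; norm_num
        _ ≤ 2 ^ b := pow_le_pow_right₀ one_le_two hab
    have hpos (a : ℕ) : (0 : ℝ) < 2 ^ a := by positivity
    rcases h with h | h
    · have h3 := χ.le_norm_of_rho_ne_zero (by omega) hm
      have h4 := χ.norm_le_of_rho_ne_zero hmn
      have h5 : ‖freq m‖ ≤ ‖freq n‖ + ‖freq m - freq n‖ := by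
        simpa using norm_add_le (freq n) (freq m - freq n)
      have h6 := hpow (a := i) (b := k) (by omega)
      have h7 := hpow (a := j) (b := k) (by omega)
      linarith [hpos k]
    · have h3 := χ.le_norm_of_rho_ne_zero (by omega) hmn
      have h4 := χ.norm_le_of_rho_ne_zero hm
      have h5 : ‖freq m - freq n‖ ≤ ‖freq m‖ + ‖freq n‖ := norm_sub_le _ _
      have h6 := hpow (a := i) (b := j) (by omega)
      have h7 := hpow (a := k) (b := j) (by omega)
      linarith [hpos j]
  have h1 := χ.abs_block_le_of_fc (B := 0) (fun m hm => by
    rw [hfc m (χ.mem_modes.1 hm), mul_zero, norm_zero]) x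
  rw [mul_zero] at h1
  exact abs_eq_zero.1 (le_antisymm h1 (abs_nonneg _))

end

end CahnHilliard

namespace CahnHilliard

noncomputable section

/-! ### Besov bounds -/

/-- The dyadic weight `2^{β(k-1)}`. -/
def wt (β : ℝ) (k : ℕ) : ℝ := (2 : ℝ) ^ (β * ((k : ℝ) - 1))

lemma wt_pos (β : ℝ) (k : ℕ) : 0 < wt β k := Real.rpow_pos_of_pos two_pos _

lemma wt_inv (β : ℝ) (k : ℕ) : (wt β k)⁻¹ = wt (-β) k := by
  rw [wt, wt, neg_mul, Real.rpow_neg two_pos.le]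

lemma wt_eq_pow (β : ℝ) (k : ℕ) : wt β k = (2 : ℝ) ^ (-β) * ((2 : ℝ) ^ β) ^ k := by
  rw [wt, ← Real.rpow_natCast, ← Real.rpow_mul two_pos.le, ← Real.rpow_add two_pos]
  congr 1
  ring

/-- `C` bounds the Besov norm `‖f‖_β`. -/
def DyadicPartition.BesovBound {d : ℕ} (χ : DyadicPartition d) (β : ℝ) (f : Dist d) (C : ℝ) :
    Prop :=
  ∀ k x, |χ.block k f x| ≤ C * (wt β k)⁻¹

/-- Nonempty open sets have positive measure, so for continuous functions the essential supremum is
the supremum. -/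
lemma eLpNorm_top_le_iff {d : ℕ} {u : Torus d → ℝ} (hu : Continuous u) {M : ℝ} (hM : 0 ≤ M) :
    eLpNorm u ⊤ volume ≤ ENNReal.ofReal M ↔ ∀ x, |u x| ≤ M := by
  rw [eLpNorm_exponent_top]
  constructor
  · intro h x
    have h1 : ∀ᵐ y : Torus d, ‖u y‖ₑ ≤ ENNReal.ofReal M := by
      filter_upwards [ae_le_eLpNormEssSup (f := u) (μ := (volume : Measure (Torus d)))] with y hy
      exact hy.trans h
    by_contra! hx
    have hopen : IsOpen {y | M < |u y|} := isOpen_lt continuous_const hu.abs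
    have h2 : volume {y | M < |u y|} = 0 := by
      refine measure_mono_null (fun y hy => ?_) (ae_iff.1 h1)
      change ¬ (‖u y‖ₑ ≤ ENNReal.ofReal M)
      rw [← ofReal_norm, ENNReal.ofReal_le_ofReal_iff hM, not_le]
      exact hy
    have h3 := (hopen.measure_eq_zero_iff volume).1 h2
    exact (Set.eq_empty_iff_forall_notMem.1 h3 x) hx
  · intro h
    refine eLpNormEssSup_le_of_ae_enorm_bound (ae_of_all _ fun x => ?_)
    rw [← ofReal_norm]
    exact ENNReal.ofReal_le_ofReal (h x)

lemma ofReal_wt_mul_le_iff {c w : ℝ} (hw : 0 < w) {a : ℝ≥0∞} :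
    ENNReal.ofReal w * a ≤ ENNReal.ofReal c ↔ a ≤ ENNReal.ofReal (c * w⁻¹) := by
  have h0 : ENNReal.ofReal w ≠ 0 := by simpa using hw
  rw [← div_eq_mul_inv, ENNReal.ofReal_div_of_pos hw,
    ENNReal.le_div_iff_mul_le (Or.inl h0) (Or.inl ENNReal.ofReal_ne_top), mul_comm]

lemma DyadicPartition.besov_le_iff {d : ℕ} (χ : DyadicPartition d) {β : ℝ} {f : Dist d} {C : ℝ}
    (hC : 0 ≤ C) : χ.besov β f ≤ ENNReal.ofReal C ↔ χ.BesovBound β f C := by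
  rw [besov, iSup_le_iff]
  refine forall_congr' fun k => ?_
  have := wt_pos β k
  rw [← eLpNorm_top_le_iff (χ.continuous_block k f) (by positivity)]
  exact ofReal_wt_mul_le_iff (wt_pos β k)

lemma DyadicPartition.BesovBound.nonneg {d : ℕ} {χ : DyadicPartition d} {β : ℝ} {f : Dist d}
    {C : ℝ} (h : χ.BesovBound β f C) : 0 ≤ C := by
  have h1 := (abs_nonneg _).trans (h 0 0)
  exact nonneg_of_mul_nonneg_left h1 (inv_pos.2 (wt_pos β 0))

lemma DyadicPartition.BesovBound.mono {d : ℕ} {χ : DyadicPartition d} {β : ℝ} {f : Dist d}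
    {C D : ℝ} (h : χ.BesovBound β f C) (hCD : C ≤ D) : χ.BesovBound β f D := fun k x => by
  have := wt_pos β k
  exact (h k x).trans (by gcongr)

lemma DyadicPartition.besovBound_toReal {d : ℕ} {χ : DyadicPartition d} {β : ℝ} {f : Dist d}
    (h : χ.besov β f ≠ ⊤) : χ.BesovBound β f (χ.besov β f).toReal :=
  (χ.besov_le_iff ENNReal.toReal_nonneg).1 (ENNReal.ofReal_toReal h).ge

lemma DyadicPartition.BesovBound.toReal_le {d : ℕ} {χ : DyadicPartition d} {β : ℝ} {f : Dist d}
    {C : ℝ} (h : χ.BesovBound β f C) : (χ.besov β f).toReal ≤ C :=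
  ENNReal.toReal_le_of_le_ofReal h.nonneg ((χ.besov_le_iff h.nonneg).2 h)

lemma DyadicPartition.BesovBound.ne_top {d : ℕ} {χ : DyadicPartition d} {β : ℝ} {f : Dist d}
    {C : ℝ} (h : χ.BesovBound β f C) : χ.besov β f ≠ ⊤ :=
  (((χ.besov_le_iff h.nonneg).2 h).trans_lt ENNReal.ofReal_lt_top).ne

lemma DyadicPartition.BesovBound.add {d : ℕ} {χ : DyadicPartition d} {β : ℝ} {f g : Dist d}
    {C D : ℝ} (hf : χ.BesovBound β f C) (hg : χ.BesovBound β g D) :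
    χ.BesovBound β (f + g) (C + D) := fun k x => by
  rw [χ.block_add, add_mul]
  exact (abs_add_le _ _).trans (add_le_add (hf k x) (hg k x))

lemma DyadicPartition.BesovBound.smul {d : ℕ} {χ : DyadicPartition d} {β : ℝ} {f : Dist d}
    {C : ℝ} (hf : χ.BesovBound β f C) (c : ℝ) : χ.BesovBound β (c • f) (|c| * C) := fun k x => by
  rw [χ.block_smul, abs_mul, mul_assoc]
  gcongr
  exact hf k x

lemma DyadicPartition.memC_iff {d : ℕ} (χ : DyadicPartition d) {β : ℝ} {f : Dist d} :
    χ.MemC β f ↔ ∀ ε : ℝ, 0 < ε → ∃ K : ℕ, ∀ k ≥ K, ∀ x, |χ.block k f x| ≤ ε * (wt β k)⁻¹ := by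
  have hk (ε : ℝ) (hε : 0 < ε) (q : ℕ) : ENNReal.ofReal ((2 : ℝ) ^ (β * (q : ℝ))) *
      eLpNorm (χ.block (q + 1) f) ⊤ volume ≤ ENNReal.ofReal ε ↔
      ∀ x, |χ.block (q + 1) f x| ≤ ε * (wt β (q + 1))⁻¹ := by
    have hw : (2 : ℝ) ^ (β * (q : ℝ)) = wt β (q + 1) := by
      rw [wt]; push_cast; rw [add_sub_cancel_right]
    have := wt_pos β (q + 1)
    rw [hw, ofReal_wt_mul_le_iff (wt_pos β (q + 1)),
      eLpNorm_top_le_iff (χ.continuous_block _ f) (by positivity)]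
  rw [MemC, ENNReal.tendsto_nhds_zero]
  constructor
  · intro h ε hε
    obtain ⟨K, hK⟩ := eventually_atTop.1 (h (ENNReal.ofReal ε) (by simpa using hε))
    refine ⟨K + 1, fun k hkK => ?_⟩
    obtain ⟨q, rfl⟩ : ∃ q, k = q + 1 := ⟨k - 1, by omega⟩
    exact (hk ε hε q).1 (hK q (by omega))
  · intro h ε hε
    obtain ⟨δ, hδ, hδε⟩ : ∃ δ : ℝ, 0 < δ ∧ ENNReal.ofReal δ ≤ ε := by
      rcases eq_or_ne ε ⊤ with rfl | hε'
      · exact ⟨1, one_pos, le_top⟩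
      · exact ⟨ε.toReal, ENNReal.toReal_pos hε.ne' hε', (ENNReal.ofReal_toReal hε').le⟩
    obtain ⟨K, hK⟩ := h δ hδ
    filter_upwards [eventually_ge_atTop K] with q hq
    exact ((hk δ hδ q).2 (hK (q + 1) (by omega))).trans hδε

lemma DyadicPartition.exists_bound_block {d : ℕ} (χ : DyadicPartition d) (k : ℕ) (f : Dist d) :
    ∃ M, 0 ≤ M ∧ ∀ x, |χ.block k f x| ≤ M := by
  obtain ⟨M, hM⟩ := isCompact_univ.exists_bound_of_continuousOn
    (χ.continuous_block k f).continuousOn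
  exact ⟨max M 0, le_max_right _ _, fun x => (hM x (Set.mem_univ x)).trans (le_max_left _ _)⟩

lemma DyadicPartition.MemC.exists_besovBound {d : ℕ} {χ : DyadicPartition d} {β : ℝ} {f : Dist d}
    (h : χ.MemC β f) : ∃ C, χ.BesovBound β f C := by
  obtain ⟨K, hK⟩ := χ.memC_iff.1 h 1 one_pos
  choose M hM0 hM using fun k => χ.exists_bound_block k f
  refine ⟨1 + ∑ k ∈ Finset.range K, M k * wt β k, fun k x => ?_⟩
  have hpos := fun k => wt_pos β k
  have hsum : 0 ≤ ∑ k ∈ Finset.range K, M k * wt β k :=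
    Finset.sum_nonneg fun k _ => mul_nonneg (hM0 k) (hpos k).le
  rcases le_or_gt K k with hk | hk
  · refine (hK k hk x).trans ?_
    have := hpos k
    gcongr
    linarith
  · have h1 := Finset.single_le_sum (f := fun k => M k * wt β k)
      (fun k _ => mul_nonneg (hM0 k) (hpos k).le) (Finset.mem_range.2 hk)
    rw [← div_eq_mul_inv, le_div_iff₀ (hpos k)]
    have h2 := mul_le_mul_of_nonneg_right (hM k x) (hpos k).le
    linarith

/-! ### Distributions of bounded Besov norm -/

/-- The restriction β > -2 is what lets the factor 4^{-k} gained by testing beat the growth of the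
blocks. -/
lemma summable_wt_inv_mul {β : ℝ} (hβ : -2 < β) :
    Summable fun k : ℕ => ((4 : ℝ) ^ k)⁻¹ * (wt β k)⁻¹ := by
  have h : (fun k : ℕ => ((4 : ℝ) ^ k)⁻¹ * (wt β k)⁻¹) =
      fun k => (2 : ℝ) ^ β * ((2 : ℝ) ^ (-β - 2)) ^ k := by
    funext k
    have h4 : ((4 : ℝ) ^ k)⁻¹ = ((2 : ℝ) ^ (-2 : ℝ)) ^ k := by
      rw [← inv_pow]
      congr 1
      rw [Real.rpow_neg two_pos.le]
      norm_num
    rw [wt_inv, wt_eq_pow, neg_neg, h4, mul_left_comm, ← mul_pow, ← Real.rpow_add two_pos]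
    congr 3
    ring
  rw [h]
  refine (summable_geometric_of_lt_one (by positivity) ?_).mul_left _
  exact Real.rpow_lt_one_of_one_lt_of_neg one_lt_two (by linarith)

lemma DyadicPartition.exists_apply_bound {d : ℕ} (χ : DyadicPartition d) {β : ℝ} (hβ : -2 < β) :
    ∃ b : ℕ → ℝ, Summable b ∧ (∀ k, 0 ≤ b k) ∧
      ∀ (k : ℕ) (f : Dist d) (C : ℝ) (φ : TestFun d) (L : ℝ), χ.BesovBound β f C →
        (∀ x, |φ.1 x| ≤ L) → (∀ x, |(lapT φ).1 x| ≤ L) →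
        |∫ x, χ.block k f x * φ.1 x| ≤ b k * (C * L) := by
  obtain ⟨D, hD0, hD⟩ := χ.exists_integral_block_le
  refine ⟨fun k => D * (((4 : ℝ) ^ k)⁻¹ * (wt β k)⁻¹), (summable_wt_inv_mul hβ).mul_left D,
    fun k => ?_, fun k f C φ L hf hL hL' => ?_⟩
  · have := wt_pos β k
    positivity
  · exact (hD k f φ _ L (hf k) hL hL').trans (le_of_eq (by ring))

lemma DyadicPartition.apply_eq_tsum {d : ℕ} (χ : DyadicPartition d) {f : Dist d} {φ : TestFun d}
    (h : Summable fun k => ∫ x, χ.block k f x * φ.1 x) :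
    f.1 φ = ∑' k, ∫ x, χ.block k f x * φ.1 x :=
  tendsto_nhds_unique (χ.tendsto_sum_block f φ) (h.hasSum.tendsto_sum_nat.comp (tendsto_add_atTop_nat 1))

/-- Since only φ and Δφ enter, limits of bounded sequences are automatically distributions of order
at most 2. -/
lemma DyadicPartition.exists_apply_le {d : ℕ} (χ : DyadicPartition d) {β : ℝ} (hβ : -2 < β) :
    ∃ D : ℝ, 0 ≤ D ∧ ∀ (f : Dist d) (C : ℝ) (φ : TestFun d) (L : ℝ), χ.BesovBound β f C →
        (∀ x, |φ.1 x| ≤ L) → (∀ x, |(lapT φ).1 x| ≤ L) → |f.1 φ| ≤ D * (C * L) := by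
  obtain ⟨b, hb, hb0, h⟩ := χ.exists_apply_bound hβ
  refine ⟨∑' k, b k, tsum_nonneg hb0, fun f C φ L hf hL hL' => ?_⟩
  have hs : Summable fun k => ∫ x, χ.block k f x * φ.1 x :=
    Summable.of_norm_bounded (hb.mul_right (C * L)) fun k => h k f C φ L hf hL hL'
  rw [χ.apply_eq_tsum hs, ← tsum_mul_right, ← Real.norm_eq_abs]
  exact tsum_of_norm_bounded (hb.mul_right (C * L)).hasSum fun k => h k f C φ L hf hL hL'

lemma exists_bound_lapT {d : ℕ} (φ : TestFun d) :
    ∃ L : ℝ, 0 ≤ L ∧ (∀ x, |φ.1 x| ≤ L) ∧ ∀ x, |(lapT φ).1 x| ≤ L := by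
  obtain ⟨A, hA0, hA⟩ := exists_bound_testFun φ
  obtain ⟨B, hB0, hB⟩ := exists_bound_testFun (lapT φ)
  exact ⟨max A B, hA0.trans (le_max_left _ _), fun x => (hA x).trans (le_max_left _ _),
    fun x => (hB x).trans (le_max_right _ _)⟩

lemma abs_le_testSeminorm_two {d : ℕ} (φ : TestFun d) (h : testSeminorm 2 φ ≠ ⊤) :
    (∀ x, |φ.1 x| ≤ (1 + d) * (testSeminorm 2 φ).toReal) ∧
      ∀ x, |(lapT φ).1 x| ≤ (1 + d) * (testSeminorm 2 φ).toReal := by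
  have key (l : List (Fin d)) (hl : l.length ≤ 2) (x) :
      |(wordDeriv l φ).1 x| ≤ (testSeminorm 2 φ).toReal := by
    have h1 := enorm_le_testSeminorm φ l hl x
    rw [← ofReal_norm, ENNReal.ofReal_le_iff_le_toReal h] at h1
    exact h1
  have h0 : 0 ≤ (testSeminorm 2 φ).toReal := ENNReal.toReal_nonneg
  have hd : (0 : ℝ) ≤ d := Nat.cast_nonneg d
  refine ⟨fun x => ?_, fun x => ?_⟩
  · have h1 := key [] (by simp) x
    have h2 : wordDeriv [] φ = φ := by simp [wordDeriv]
    rw [h2] at h1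
    nlinarith
  · rw [lapT, LinearMap.sum_apply, coe_sum_testFun]
    calc _ ≤ ∑ i : Fin d, |((pd i ∘ₗ pd i) φ).1 x| := Finset.abs_sum_le_sum_abs _ _
      _ ≤ ∑ _i : Fin d, (testSeminorm 2 φ).toReal := by
        refine Finset.sum_le_sum fun i _ => ?_
        have h1 := key [i, i] (by simp) x
        have h2 : wordDeriv [i, i] φ = (pd i ∘ₗ pd i) φ := by simp [wordDeriv]
        rwa [h2] at h1
      _ = d * (testSeminorm 2 φ).toReal := by simp
      _ ≤ _ := by nlinarith

/-- Bounded sequences whose blocks converge have a limit. -/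
lemma DyadicPartition.exists_tendsto {d : ℕ} (χ : DyadicPartition d) {β : ℝ} (hβ : -2 < β)
    (h : ℕ → Dist d) (C : ℝ) (hC : ∀ n, χ.BesovBound β (h n) C)
    (hlim : ∀ k x, ∃ l, Tendsto (fun n => χ.block k (h n) x) atTop (𝓝 l)) :
    ∃ g : Dist d, (∀ φ : TestFun d, Tendsto (fun n => (h n).1 φ) atTop (𝓝 (g.1 φ))) ∧
      χ.BesovBound β g C := by
  obtain ⟨b, hb, hb0, hbd⟩ := χ.exists_apply_bound hβ
  obtain ⟨D, hD0, hD⟩ := χ.exists_apply_le hβ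
  have hC0 := (hC 0).nonneg
  -- Dominated convergence twice: in the sum over blocks, with a majorant that does not depend on n,
  -- and inside each block, where only pointwise convergence is assumed.
  have hφ (φ : TestFun d) : ∃ l, Tendsto (fun n => (h n).1 φ) atTop (𝓝 l) := by
    obtain ⟨L, hL0, hL, hL'⟩ := exists_bound_lapT φ
    choose u hu using hlim
    have hb' (n k) := hbd k (h n) C φ L (hC n) hL hL'
    have hs (n) : Summable fun k => ∫ x, χ.block k (h n) x * φ.1 x :=
      Summable.of_norm_bounded (hb.mul_right (C * L)) fun k => hb' n k
    refine ⟨∑' k, ∫ x, u k x * φ.1 x, ?_⟩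
    simp only [fun n => χ.apply_eq_tsum (hs n)]
    refine tendsto_tsum_of_dominated_convergence (hb.mul_right (C * L)) (fun k => ?_)
      (Eventually.of_forall fun n k => hb' n k)
    refine tendsto_integral_of_dominated_convergence (fun _ => C * (wt β k)⁻¹ * L) (fun n => ?_)
      (integrable_const _) (fun n => ae_of_all _ fun x => ?_) (ae_of_all _ fun x => ?_)
    · exact ((χ.continuous_block k (h n)).mul (continuous_testFun φ)).aestronglyMeasurable
    · rw [norm_mul]
      have := wt_pos β k
      exact mul_le_mul (hC n k x) (hL x) (norm_nonneg _) (by positivity)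
    · exact (hu k x).mul_const _
  choose G hG using hφ
  let g₀ : TestFun d →ₗ[ℝ] ℝ :=
    { toFun := G
      map_add' := fun φ ψ => by
        refine tendsto_nhds_unique (hG (φ + ψ)) ?_
        simpa only [map_add] using (hG φ).add (hG ψ)
      map_smul' := fun c φ => by
        refine tendsto_nhds_unique (hG (c • φ)) ?_
        simpa only [map_smul, RingHom.id_apply] using (hG φ).const_smul c }
  have hmem : g₀ ∈ Dist d := by
    -- The summand 1 keeps the constant nonzero, so that the bound is trivial if the seminorm is
    -- infinite.
    refine ⟨(D * (C * (1 + d)) + 1).toNNReal, 2, fun φ => ?_⟩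
    have hpos : 0 < D * (C * (1 + d)) + 1 := by positivity
    rcases eq_or_ne (testSeminorm 2 φ) ⊤ with htop | htop
    · rw [htop, ENNReal.mul_top]
      · exact le_top
      · simpa using hpos
    · obtain ⟨h1, h2⟩ := abs_le_testSeminorm_two φ htop
      have h3 : |G φ| ≤ D * (C * ((1 + d) * (testSeminorm 2 φ).toReal)) :=
        le_of_tendsto (hG φ).abs (Eventually.of_forall fun n => hD (h n) C φ _ (hC n) h1 h2)
      change ‖G φ‖ₑ ≤ _
      rw [← ofReal_norm, ← ENNReal.ofReal_toReal htop]
      change _ ≤ ENNReal.ofReal _ * _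
      rw [← ENNReal.ofReal_mul hpos.le]
      refine ENNReal.ofReal_le_ofReal (h3.trans ?_)
      have h0 : 0 ≤ (testSeminorm 2 φ).toReal := ENNReal.toReal_nonneg
      nlinarith
  refine ⟨⟨g₀, hmem⟩, hG, fun k x => ?_⟩
  exact le_of_tendsto (hG (reflect x (χ.kernel k))).abs (Eventually.of_forall fun n => hC n k x)

/-! ### Products -/

/-- A piece of the product, localized in frequency. -/
def DyadicPartition.piece {d : ℕ} (χ : DyadicPartition d) (k i j : ℕ) (f g : Dist d)
    (x : Torus d) : ℝ :=
  χ.block k (ofContinuous (fun x => χ.block i f x * χ.block j g x)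
      ((χ.continuous_block i f).mul (χ.continuous_block j g))) x

lemma DyadicPartition.continuous_partialSum {d : ℕ} (χ : DyadicPartition d) (N : ℕ) (f : Dist d) :
    Continuous (χ.partialSum N f) :=
  continuous_finsetSum _ fun k _ => χ.continuous_block k f

lemma DyadicPartition.block_partialSum_mul {d : ℕ} (χ : DyadicPartition d) (k N : ℕ)
    (f g : Dist d) (x : Torus d) :
    χ.block k (ofContinuous (fun x => χ.partialSum N f x * χ.partialSum N g x)
      ((χ.continuous_partialSum N f).mul (χ.continuous_partialSum N g))) x =
      ∑ p ∈ Finset.range (N + 1) ×ˢ Finset.range (N + 1), χ.piece k p.1 p.2 f g x := by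
  change ∫ y, (χ.partialSum N f y * χ.partialSum N g y) * (reflect x (χ.kernel k)).1 y = 
    ∑ p ∈ Finset.range (N + 1) ×ˢ Finset.range (N + 1),
      ∫ y, (χ.block p.1 f y * χ.block p.2 g y) * (reflect x (χ.kernel k)).1 y
  rw [← integral_finsetSum]
  · congr 1
    funext y
    rw [← Finset.sum_mul, partialSum, partialSum, Finset.sum_mul_sum, Finset.sum_product]
  · intro p _
    exact integrable_mul_testFun ((χ.continuous_block p.1 f).mul (χ.continuous_block p.2 g)) _

/-- Absolute summability of the pieces in each output block bounds the partial products in the Besov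
norm and makes their blocks converge, which is what `exists_tendsto` needs. -/
lemma DyadicPartition.exists_isProd {d : ℕ} (χ : DyadicPartition d) {β : ℝ} (hβ : -2 < β)
    {f g : Dist d} {C : ℝ}
    (hC : ∀ k N x, ∑ p ∈ Finset.range (N + 1) ×ˢ Finset.range (N + 1),
      |χ.piece k p.1 p.2 f g x| ≤ C * (wt β k)⁻¹) :
    ∃ h, χ.IsProd f g h ∧ χ.BesovBound β h C := by
  obtain ⟨h, h1, h2⟩ := χ.exists_tendsto hβ
    (fun N => ofContinuous (fun x => χ.partialSum N f x * χ.partialSum N g x)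
      ((χ.continuous_partialSum N f).mul (χ.continuous_partialSum N g))) C
    (fun N k x => by
      rw [χ.block_partialSum_mul]
      exact (Finset.abs_sum_le_sum_abs _ _).trans (hC k N x))
    (fun k x => by
      simp only [χ.block_partialSum_mul]
      have hs : Summable fun p : ℕ × ℕ => |χ.piece k p.1 p.2 f g x| := by
        refine summable_of_sum_le (c := C * (wt β k)⁻¹) (fun p => abs_nonneg _) fun s => ?_
        obtain ⟨N, hN⟩ : ∃ N, s ⊆ Finset.range (N + 1) ×ˢ Finset.range (N + 1) := by
          refine ⟨s.sup fun p => max p.1 p.2, fun p hp => ?_⟩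
          have := Finset.le_sup (f := fun p : ℕ × ℕ => max p.1 p.2) hp
          simp only [Finset.mem_product, Finset.mem_range]
          omega
        exact (Finset.sum_le_sum_of_subset_of_nonneg hN fun _ _ _ => abs_nonneg _).trans (hC k N x)
      refine ⟨_, hs.of_abs.hasSum.comp (tendsto_atTop_finset_of_monotone (fun M N hMN => ?_)
        fun p => ⟨max p.1 p.2, ?_⟩)⟩
      · exact Finset.product_subset_product (Finset.range_mono (by omega))
          (Finset.range_mono (by omega))
      · simp only [Finset.mem_product, Finset.mem_range]
        omega)
  exact ⟨h, h1, h2⟩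

/-- The inner geometric sum is dominated by its largest term, of size G^{max(i,k)} ≤ G^i + G^k. The
condition aG < 1, that is γ < α, makes the first part summable against a^i. -/
lemma sum_pow_mul_pow_le {a G : ℝ} (ha0 : 0 < a) (ha1 : a < 1) (hG : 1 < G) (haG : a * G < 1)
    (k N : ℕ) :
    ∑ p ∈ Finset.range (N + 1) ×ˢ Finset.range (N + 1),
      (if p.2 < max p.1 k + 3 then a ^ p.1 * G ^ p.2 else 0) ≤
      (G ^ 3 / (G - 1) * ((1 - a * G)⁻¹ + (1 - a)⁻¹)) * G ^ k := by
  have hG1 : 0 < G - 1 := by linarith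
  have hG0 : 0 < G := by linarith
  have h1a : 0 < 1 - a := by linarith
  have h1aG : 0 < 1 - a * G := by linarith
  have hGk : 1 ≤ G ^ k := one_le_pow₀ hG.le
  have inner (i : ℕ) : ∑ j ∈ Finset.range (N + 1),
      (if j < max i k + 3 then a ^ i * G ^ j else 0) ≤
      G ^ 3 / (G - 1) * ((a * G) ^ i + a ^ i * G ^ k) := by
    rw [← Finset.sum_filter, ← Finset.mul_sum]
    have h1 : ∑ j ∈ Finset.range (N + 1) with j < max i k + 3, G ^ j ≤
        ∑ j ∈ Finset.range (max i k + 3), G ^ j :=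
      Finset.sum_le_sum_of_subset_of_nonneg (fun j hj => by
        simp only [Finset.mem_filter, Finset.mem_range] at hj ⊢; exact hj.2)
        fun _ _ _ => by positivity
    have h2 : ∑ j ∈ Finset.range (max i k + 3), G ^ j ≤ G ^ (max i k + 3) / (G - 1) := by
      rw [geom_sum_eq hG.ne']
      gcongr
      linarith
    have h3 : G ^ (max i k) ≤ G ^ i + G ^ k := by
      have hi : 0 < G ^ i := by positivity
      have hk : 0 < G ^ k := by positivity
      rcases le_total i k with h | h
      · rw [max_eq_right h]; linarith
      · rw [max_eq_left h]; linarith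
    calc a ^ i * ∑ j ∈ Finset.range (N + 1) with j < max i k + 3, G ^ j
        ≤ a ^ i * ((G ^ i + G ^ k) * G ^ 3 / (G - 1)) := by
          gcongr
          refine (h1.trans h2).trans ?_
          rw [pow_add]
          gcongr
      _ = _ := by rw [mul_pow]; ring
  rw [Finset.sum_product]
  calc _ ≤ ∑ i ∈ Finset.range (N + 1), G ^ 3 / (G - 1) * ((a * G) ^ i + a ^ i * G ^ k) :=
        Finset.sum_le_sum fun i _ => inner i
    _ = G ^ 3 / (G - 1) * (∑ i ∈ Finset.range (N + 1), (a * G) ^ i +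
          (∑ i ∈ Finset.range (N + 1), a ^ i) * G ^ k) := by
        rw [← Finset.mul_sum, Finset.sum_add_distrib, Finset.sum_mul]
    _ ≤ G ^ 3 / (G - 1) * ((1 - a * G)⁻¹ * G ^ k + (1 - a)⁻¹ * G ^ k) := by
        have h1 := Summable.sum_le_tsum (Finset.range (N + 1)) (fun i _ => by positivity)
          (summable_geometric_of_lt_one (r := a * G) (by positivity) haG)
        have h2 := Summable.sum_le_tsum (Finset.range (N + 1)) (fun i _ => by positivity)
          (summable_geometric_of_lt_one ha0.le ha1)
        rw [tsum_geometric_of_lt_one (by positivity) haG] at h1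
        rw [tsum_geometric_of_lt_one ha0.le ha1] at h2
        have h3 : (1 - a * G)⁻¹ ≤ (1 - a * G)⁻¹ * G ^ k :=
          le_mul_of_one_le_right (by positivity) hGk
        have h4 := h1.trans h3
        gcongr
    _ = _ := by ring

/-- One of the two indices must exceed k - 3; its geometric tail gives the factor a^k, and the other
index is summed freely. -/
lemma sum_pow_mul_pow_le' {a : ℝ} (ha0 : 0 < a) (ha1 : a < 1) (k N : ℕ) :
    ∑ p ∈ Finset.range (N + 1) ×ˢ Finset.range (N + 1),
      (if k < max p.1 p.2 + 3 then a ^ p.1 * a ^ p.2 else 0) ≤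
      (2 * (a⁻¹ ^ 2 * (1 - a)⁻¹ ^ 2)) * a ^ k := by
  have h1a : 0 < 1 - a := by linarith
  have htail : ∑ i ∈ Finset.range (N + 1), (if k < i + 3 then a ^ i else 0) ≤
      a⁻¹ ^ 2 * (1 - a)⁻¹ * a ^ k := by
    rw [← Finset.sum_filter]
    calc _ ≤ ∑ i ∈ Finset.Ico (k - 2) (N + 1), a ^ i :=
          Finset.sum_le_sum_of_subset_of_nonneg (fun j hj => by
            simp only [Finset.mem_filter, Finset.mem_range, Finset.mem_Ico] at hj ⊢; omega)
            fun _ _ _ => by positivity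
      _ ≤ a ^ (k - 2) / (1 - a) := geom_sum_Ico_le_of_lt_one ha0.le ha1
      _ = a⁻¹ ^ 2 * (1 - a)⁻¹ * a ^ (k - 2 + 2) := by
          rw [pow_add]; field_simp
      _ ≤ _ := by
          gcongr ?_ * ?_
          -- Truncated subtraction is harmless: k ≤ k - 2 + 2 always holds, and a < 1.
          exact pow_le_pow_of_le_one ha0.le ha1.le (by omega)
  have hfull : ∑ i ∈ Finset.range (N + 1), a ^ i ≤ (1 - a)⁻¹ := by
    have h2 := Summable.sum_le_tsum (Finset.range (N + 1)) (fun i _ => by positivity)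
      (summable_geometric_of_lt_one ha0.le ha1)
    rwa [tsum_geometric_of_lt_one ha0.le ha1] at h2
  have hfull0 : 0 ≤ ∑ i ∈ Finset.range (N + 1), a ^ i := Finset.sum_nonneg fun _ _ => by positivity
  calc _ ≤ ∑ p ∈ Finset.range (N + 1) ×ˢ Finset.range (N + 1),
        ((if k < p.1 + 3 then a ^ p.1 else 0) * a ^ p.2 +
          a ^ p.1 * (if k < p.2 + 3 then a ^ p.2 else 0)) := by
        refine Finset.sum_le_sum fun p _ => ?_
        have h1 : 0 < a ^ p.1 := by positivity
        have h2 : 0 < a ^ p.2 := by positivity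
        have h3 : 0 < a ^ p.1 * a ^ p.2 := by positivity
        split_ifs with h h' h'' <;> first | omega | linarith
    _ = (∑ i ∈ Finset.range (N + 1), (if k < i + 3 then a ^ i else 0)) *
          (∑ i ∈ Finset.range (N + 1), a ^ i) + (∑ i ∈ Finset.range (N + 1), a ^ i) *
          ∑ i ∈ Finset.range (N + 1), (if k < i + 3 then a ^ i else 0) := by
        rw [Finset.sum_add_distrib, Finset.sum_mul_sum, Finset.sum_mul_sum, Finset.sum_product,
          Finset.sum_product]
    _ = 2 * ((∑ i ∈ Finset.range (N + 1), (if k < i + 3 then a ^ i else 0)) *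
          (∑ i ∈ Finset.range (N + 1), a ^ i)) := by ring
    _ ≤ 2 * ((a⁻¹ ^ 2 * (1 - a)⁻¹ * a ^ k) * (1 - a)⁻¹) := by gcongr
    _ = _ := by ring

lemma DyadicPartition.exists_abs_piece_le {d : ℕ} (χ : DyadicPartition d) (α β : ℝ) :
    ∃ D : ℝ, 0 ≤ D ∧ ∀ (k i j : ℕ) (f g : Dist d) (A B : ℝ), χ.BesovBound α f A →
      χ.BesovBound β g B → ∀ x, |χ.piece k i j f g x| ≤
        D * (A * B) * if k < max i j + 3 ∧ j < max i k + 3 then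
          ((2 : ℝ) ^ (-α)) ^ i * ((2 : ℝ) ^ (-β)) ^ j else 0 := by
  obtain ⟨C, hC0, hC⟩ := χ.exists_block_ofContinuous_le
  refine ⟨C * ((2 : ℝ) ^ α * (2 : ℝ) ^ β), by positivity, fun k i j f g A B hf hg x => ?_⟩
  split_ifs with h
  · refine (hC k _ _ (A * (wt α i)⁻¹ * (B * (wt β j)⁻¹)) (fun y => ?_) x).trans (le_of_eq ?_)
    · rw [abs_mul]
      exact mul_le_mul (hf i y) (hg j y) (abs_nonneg _) ((abs_nonneg _).trans (hf i y))
    · rw [wt_inv, wt_inv, wt_eq_pow, wt_eq_pow, neg_neg, neg_neg]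
      ring
  · rw [piece, χ.block_mul_eq_zero f g (by omega), abs_zero, mul_zero]

/-- `𝒞^α` is an algebra for `α > 0`. -/
lemma DyadicPartition.exists_mul_bound {d : ℕ} (χ : DyadicPartition d) {α : ℝ} (hα : 0 < α) :
    ∃ D : ℝ, 0 ≤ D ∧ ∀ (f g : Dist d) (A B : ℝ), χ.BesovBound α f A → χ.BesovBound α g B →
      ∃ h, χ.IsProd f g h ∧ χ.BesovBound α h (D * (A * B)) := by
  obtain ⟨D, hD0, hD⟩ := χ.exists_abs_piece_le α α
  set a : ℝ := (2 : ℝ) ^ (-α) with ha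
  have ha0 : 0 < a := by positivity
  have ha1 : a < 1 := Real.rpow_lt_one_of_one_lt_of_neg one_lt_two (by linarith)
  have h1a : 0 < 1 - a := by linarith
  refine ⟨D * (2 * (a⁻¹ ^ 2 * (1 - a)⁻¹ ^ 2)) * (2 : ℝ) ^ (-α), by positivity,
    fun f g A B hf hg => χ.exists_isProd (by linarith) fun k N x => ?_⟩
  have hA := hf.nonneg
  have hB := hg.nonneg
  -- Both factors decay, so the only constraint needed is that some input frequency reaches the
  -- output frequency.
  calc _ ≤ ∑ p ∈ Finset.range (N + 1) ×ˢ Finset.range (N + 1), D * (A * B) *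
        (if k < max p.1 p.2 + 3 then a ^ p.1 * a ^ p.2 else 0) := by
        refine Finset.sum_le_sum fun p _ => (hD k p.1 p.2 f g A B hf hg x).trans ?_
        gcongr
        have : 0 < a ^ p.1 * a ^ p.2 := by positivity
        split_ifs with h h' <;> first | omega | linarith
    _ ≤ D * (A * B) * ((2 * (a⁻¹ ^ 2 * (1 - a)⁻¹ ^ 2)) * a ^ k) := by
        rw [← Finset.mul_sum]
        gcongr
        exact sum_pow_mul_pow_le' ha0 ha1 k N
    _ = _ := by
        have h2 : (2 : ℝ) ^ (-α) * (2 : ℝ) ^ α = 1 := by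
          rw [← Real.rpow_add two_pos]; simp
        rw [wt_inv, wt_eq_pow, neg_neg, ← ha]
        rw [← ha] at h2
        linear_combination (-(D * (A * B) * ((2 * (a⁻¹ ^ 2 * (1 - a)⁻¹ ^ 2)) * a ^ k))) * h2

/-- The product `𝒞^α × 𝒞^{-γ} → 𝒞^{-γ}` for `0 < γ < α`. -/
lemma DyadicPartition.exists_mul_bound_neg {d : ℕ} (χ : DyadicPartition d) {α γ : ℝ} (hγ : 0 < γ)
    (hγα : γ < α) (hγ2 : γ < 2) :
    ∃ D : ℝ, 0 ≤ D ∧ ∀ (f g : Dist d) (A B : ℝ), χ.BesovBound α f A → χ.BesovBound (-γ) g B →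
      ∃ h, χ.IsProd f g h ∧ χ.BesovBound (-γ) h (D * (A * B)) := by
  obtain ⟨D, hD0, hD⟩ := χ.exists_abs_piece_le α (-γ)
  rw [neg_neg] at hD
  set a : ℝ := (2 : ℝ) ^ (-α) with ha
  set G : ℝ := (2 : ℝ) ^ γ with hG
  have ha0 : 0 < a := by positivity
  have ha1 : a < 1 := Real.rpow_lt_one_of_one_lt_of_neg one_lt_two (by linarith)
  have hG1 : 1 < G := Real.one_lt_rpow one_lt_two hγ
  have haG : a * G < 1 := by
    rw [ha, hG, ← Real.rpow_add two_pos]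
    exact Real.rpow_lt_one_of_one_lt_of_neg one_lt_two (by linarith)
  have h1a : 0 < 1 - a := by linarith
  have h1aG : 0 < 1 - a * G := by linarith
  have h1G : 0 < G - 1 := by linarith
  refine ⟨D * (G ^ 3 / (G - 1) * ((1 - a * G)⁻¹ + (1 - a)⁻¹)) * G, by positivity,
    fun f g A B hf hg => χ.exists_isProd (by linarith) fun k N x => ?_⟩
  have hA := hf.nonneg
  have hB := hg.nonneg
  -- Here the blocks of g may grow, so the constraint to keep is the one that bounds j by i and k.
  calc _ ≤ ∑ p ∈ Finset.range (N + 1) ×ˢ Finset.range (N + 1), D * (A * B) *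
        (if p.2 < max p.1 k + 3 then a ^ p.1 * G ^ p.2 else 0) := by
        refine Finset.sum_le_sum fun p _ => (hD k p.1 p.2 f g A B hf hg x).trans ?_
        gcongr
        have : 0 < a ^ p.1 * G ^ p.2 := by positivity
        split_ifs with h h' <;> first | omega | linarith
    _ ≤ D * (A * B) * ((G ^ 3 / (G - 1) * ((1 - a * G)⁻¹ + (1 - a)⁻¹)) * G ^ k) := by
        rw [← Finset.mul_sum]
        gcongr
        exact sum_pow_mul_pow_le ha0 ha1 hG1 haG k N
    _ = _ := by
        have h2 : (2 : ℝ) ^ (-γ) * G = 1 := by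
          rw [hG, ← Real.rpow_add two_pos]; simp
        rw [wt_inv, wt_eq_pow, neg_neg, neg_neg, ← hG]
        linear_combination (-(D * (A * B) *
          ((G ^ 3 / (G - 1) * ((1 - a * G)⁻¹ + (1 - a)⁻¹)) * G ^ k))) * h2

end

end CahnHilliard

namespace CahnHilliard

noncomputable section

/-! ### The normed spaces of distributions of bounded Besov norm -/

lemma DyadicPartition.eq_zero_of_block {d : ℕ} (χ : DyadicPartition d) {f : Dist d}
    (h : ∀ k x, χ.block k f x = 0) : f = 0 := by
  refine Subtype.ext (LinearMap.ext fun φ => ?_)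
  refine tendsto_nhds_unique (χ.tendsto_sum_block f φ) ?_
  simp only [h, zero_mul, integral_zero, Finset.sum_const_zero]
  exact tendsto_const_nhds

/-- The submodule of the distributions of finite Besov norm. -/
def DyadicPartition.besovSubmodule {d : ℕ} (χ : DyadicPartition d) (β : ℝ) :
    Submodule ℝ (Dist d) where
  carrier := {f | ∃ C, χ.BesovBound β f C}
  add_mem' := fun ⟨_, hf⟩ ⟨_, hg⟩ => ⟨_, hf.add hg⟩
  zero_mem' := ⟨0, fun k x => by
    have h : χ.block k (0 : Dist d) x = 0 := rfl
    rw [h, abs_zero, zero_mul]⟩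
  smul_mem' := fun c _ ⟨_, hf⟩ => ⟨_, hf.smul c⟩

/-- The space of the distributions of finite Besov norm. -/
def Bes {d : ℕ} (χ : DyadicPartition d) (β : ℝ) : Type := χ.besovSubmodule β

namespace Bes

variable {d : ℕ} {χ : DyadicPartition d} {β : ℝ}

instance : AddCommMonoid (Bes χ β) := inferInstanceAs (AddCommMonoid (χ.besovSubmodule β))

instance : Module ℝ (Bes χ β) := inferInstanceAs (Module ℝ (χ.besovSubmodule β))

instance : AddCommGroup (Bes χ β) := Module.addCommMonoidToAddCommGroup ℝ

/-- The underlying distribution. -/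
def val : Bes χ β →ₗ[ℝ] Dist d := (χ.besovSubmodule β).subtype

/-- A distribution with a Besov bound. -/
def mk (f : Dist d) {C : ℝ} (h : χ.BesovBound β f C) : Bes χ β := ⟨f, C, h⟩

@[simp]
lemma val_mk (f : Dist d) {C : ℝ} (h : χ.BesovBound β f C) : (mk f h).val = f := rfl

lemma val_injective : Function.Injective (val : Bes χ β → Dist d) := Subtype.val_injective

@[ext]
lemma ext_val {f g : Bes χ β} (h : f.val = g.val) : f = g := val_injective h

lemma besov_ne_top (f : Bes χ β) : χ.besov β f.val ≠ ⊤ :=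
  let ⟨_, h⟩ := f.2
  h.ne_top

instance : Norm (Bes χ β) := ⟨fun f => (χ.besov β f.val).toReal⟩

lemma ofReal_norm_eq (f : Bes χ β) : ENNReal.ofReal ‖f‖ = χ.besov β f.val :=
  ENNReal.ofReal_toReal f.besov_ne_top

lemma besovBound_norm (f : Bes χ β) : χ.BesovBound β f.val ‖f‖ :=
  DyadicPartition.besovBound_toReal f.besov_ne_top

lemma norm_le {f : Bes χ β} {C : ℝ} (h : χ.BesovBound β f.val C) : ‖f‖ ≤ C := h.toReal_le

lemma core : NormedSpace.Core ℝ (Bes χ β) where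
  norm_nonneg _ := ENNReal.toReal_nonneg
  norm_smul c f := by
    have key (c : ℝ) (f : Bes χ β) : ‖c • f‖ ≤ |c| * ‖f‖ := norm_le (by
      rw [map_smul]; exact f.besovBound_norm.smul c)
    refine le_antisymm (key c f) ?_
    rcases eq_or_ne c 0 with rfl | hc
    · rw [norm_zero, zero_mul]; exact ENNReal.toReal_nonneg
    · have h := key c⁻¹ (c • f)
      rw [inv_smul_smul₀ hc, abs_inv] at h
      rw [Real.norm_eq_abs]
      have hc' : 0 < |c| := abs_pos.2 hc
      calc |c| * ‖f‖ ≤ |c| * (|c|⁻¹ * ‖c • f‖) := by gcongr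
        _ = ‖c • f‖ := by field_simp
  norm_triangle f g := norm_le (by rw [map_add]; exact f.besovBound_norm.add g.besovBound_norm)
  norm_eq_zero_iff f := by
    constructor
    · intro h
      refine ext_val (χ.eq_zero_of_block fun k x => ?_)
      have := f.besovBound_norm k x
      rw [h, zero_mul] at this
      exact abs_nonpos_iff.1 this
    · rintro rfl
      refine le_antisymm (norm_le fun k x => ?_) ENNReal.toReal_nonneg
      have h : χ.block k (val (0 : Bes χ β)) x = 0 := rfl
      rw [h, abs_zero, zero_mul]

instance : NormedAddCommGroup (Bes χ β) := NormedAddCommGroup.ofCore core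

instance : NormedSpace ℝ (Bes χ β) := NormedSpace.ofCore core

lemma abs_block_le (f : Bes χ β) (k : ℕ) (x : Torus d) :
    |χ.block k f.val x| ≤ ‖f‖ * (wt β k)⁻¹ := f.besovBound_norm k x

/-- A Cauchy sequence is bounded and its blocks converge, so `exists_tendsto` yields a weak limit.
Block bounds on u n - u m pass to the limit in m, giving convergence in norm. -/
lemma completeSpace (hβ : -2 < β) : CompleteSpace (Bes χ β) := by
  refine Metric.complete_of_cauchySeq_tendsto fun u hu => ?_
  obtain ⟨R, hR0, hR⟩ := cauchySeq_bdd hu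
  have hC (n) : χ.BesovBound β (u n).val (‖u 0‖ + R) := (u n).besovBound_norm.mono (by
    have h1 := (hR n 0).le
    rw [dist_eq_norm] at h1
    have h2 := norm_add_le (u 0) (u n - u 0)
    rw [add_sub_cancel] at h2
    linarith)
  have hblock (k x) : ∃ l, Tendsto (fun n => χ.block k (u n).val x) atTop (𝓝 l) := by
    refine cauchySeq_tendsto_of_complete (Metric.cauchySeq_iff.2 fun ε hε => ?_)
    have hw := wt_pos β k
    obtain ⟨N, hN⟩ := Metric.cauchySeq_iff.1 hu (ε * wt β k) (by positivity)
    refine ⟨N, fun m hm n hn => ?_⟩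
    have h1 := (u m - u n).abs_block_le k x
    rw [map_sub, χ.block_sub, ← dist_eq_norm] at h1
    rw [Real.dist_eq]
    refine h1.trans_lt ?_
    rw [← div_eq_mul_inv, div_lt_iff₀ hw]
    exact hN m hm n hn
  obtain ⟨g, hg, hgC⟩ := χ.exists_tendsto hβ (fun n => (u n).val) _ hC hblock
  refine ⟨mk g hgC, Metric.tendsto_atTop.2 fun ε hε => ?_⟩
  obtain ⟨N, hN⟩ := Metric.cauchySeq_iff.1 hu (ε / 2) (half_pos hε)
  refine ⟨N, fun n hn => ?_⟩
  rw [dist_eq_norm]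
  refine (norm_le (C := ε / 2) fun k x => ?_).trans_lt (half_lt_self hε)
  rw [map_sub, val_mk, χ.block_sub]
  have h1 : Tendsto (fun m => |χ.block k (u n).val x - χ.block k (u m).val x|) atTop
      (𝓝 |χ.block k (u n).val x - χ.block k g x|) :=
    (tendsto_const_nhds.sub (hg (reflect x (χ.kernel k)))).abs
  refine le_of_tendsto h1 (eventually_atTop.2 ⟨N, fun m hm => ?_⟩)
  have h2 := (u n - u m).abs_block_le k x
  rw [map_sub, χ.block_sub, ← dist_eq_norm] at h2
  have hw := wt_pos β k
  have h3 := (hN n hn m hm).le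
  exact h2.trans (by gcongr)

/-- Continuity of testing is what connects the tested integrals of the mild equation with Bochner
integrals. -/
lemma exists_eval (hβ : -2 < β) (φ : TestFun d) :
    ∃ e : Bes χ β →L[ℝ] ℝ, ∀ f, e f = f.val.1 φ := by
  obtain ⟨D, hD0, hD⟩ := χ.exists_apply_le hβ
  obtain ⟨L, hL0, hL, hL'⟩ := exists_bound_lapT φ
  refine ⟨LinearMap.mkContinuous
    { toFun := fun f : Bes χ β => f.val.1 φ
      map_add' := fun f g => rfl
      map_smul' := fun c f => rfl } (D * L) fun f => ?_, fun f => rfl⟩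
  exact (hD f.val _ φ L f.besovBound_norm hL hL').trans (le_of_eq (by ring))

lemma exists_inclusion {γ : ℝ} (h : γ ≤ β) :
    ∃ J : Bes χ β →L[ℝ] Bes χ γ, ∀ f, (J f).val = f.val := by
  have hb (f : Bes χ β) : χ.BesovBound γ f.val ((2 : ℝ) ^ (β - γ) * ‖f‖) := fun k x => by
    refine (f.abs_block_le k x).trans ?_
    -- The constant is forced by k = 0, which stands for the block of index -1, where the order of
    -- the weights is reversed.
    have h1 : (wt β k)⁻¹ ≤ (2 : ℝ) ^ (β - γ) * (wt γ k)⁻¹ := by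
      rw [wt_inv, wt_inv, wt, wt, ← Real.rpow_add two_pos]
      refine Real.rpow_le_rpow_of_exponent_le one_le_two ?_
      have : (0 : ℝ) ≤ k := k.cast_nonneg
      nlinarith
    calc ‖f‖ * (wt β k)⁻¹ ≤ ‖f‖ * ((2 : ℝ) ^ (β - γ) * (wt γ k)⁻¹) := by gcongr
      _ = _ := by ring
  exact ⟨LinearMap.mkContinuous
    { toFun := fun f : Bes χ β => mk f.val (hb f)
      map_add' := fun f g => rfl
      map_smul' := fun c f => rfl } _ fun f => norm_le (hb f), fun f => rfl⟩

end Bes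

/-! ### Bilinearity of the product -/

lemma DyadicPartition.partialSum_add {d : ℕ} (χ : DyadicPartition d) (N : ℕ) (f g : Dist d)
    (x : Torus d) : χ.partialSum N (f + g) x = χ.partialSum N f x + χ.partialSum N g x := by
  simp only [partialSum, χ.block_add, Finset.sum_add_distrib]

lemma DyadicPartition.partialSum_smul {d : ℕ} (χ : DyadicPartition d) (N : ℕ) (c : ℝ) (f : Dist d)
    (x : Torus d) : χ.partialSum N (c • f) x = c * χ.partialSum N f x := by
  simp only [partialSum, χ.block_smul, Finset.mul_sum]

lemma DyadicPartition.IsProd.symm {d : ℕ} {χ : DyadicPartition d} {f g h : Dist d}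
    (H : χ.IsProd f g h) : χ.IsProd g f h := fun φ => by
  simpa only [mul_comm (χ.partialSum _ g _)] using H φ

lemma DyadicPartition.IsProd.add_left {d : ℕ} {χ : DyadicPartition d} {f f' g h h' : Dist d}
    (H : χ.IsProd f g h) (H' : χ.IsProd f' g h') : χ.IsProd (f + f') g (h + h') := fun φ => by
  have hint (f : Dist d) (N : ℕ) :
      Integrable fun x => χ.partialSum N f x * χ.partialSum N g x * φ.1 x :=
    integrable_mul_testFun ((χ.continuous_partialSum N f).mul (χ.continuous_partialSum N g)) φ
  simp only [χ.partialSum_add, add_mul]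
  simp only [integral_add (hint f _) (hint f' _)]
  exact (H φ).add (H' φ)

lemma DyadicPartition.IsProd.smul_left {d : ℕ} {χ : DyadicPartition d} {f g h : Dist d}
    (H : χ.IsProd f g h) (c : ℝ) : χ.IsProd (c • f) g (c • h) := fun φ => by
  simp only [χ.partialSum_smul, mul_assoc, integral_const_mul]
  change Tendsto _ _ (𝓝 (c * h.1 φ))
  simpa only [mul_assoc] using (H φ).const_mul c

/-- A bounded product is a continuous bilinear map. -/
lemma DyadicPartition.exists_mulCLM {d : ℕ} (χ : DyadicPartition d) {a b c D : ℝ}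
    (hD : ∀ (f g : Dist d) (A B : ℝ), χ.BesovBound a f A → χ.BesovBound b g B →
      ∃ h, χ.IsProd f g h ∧ χ.BesovBound c h (D * (A * B))) :
    ∃ m : Bes χ a →L[ℝ] Bes χ b →L[ℝ] Bes χ c, ∀ f g, (m f g).val = χ.mul f.val g.val := by
  choose p hp hpb using fun (f : Bes χ a) (g : Bes χ b) =>
    hD f.val g.val _ _ f.besovBound_norm g.besovBound_norm
  -- A product is determined by the relation `IsProd`, so bilinearity of the relation passes to the
  -- chosen values.
  have hu {f g h h' : Dist d} (H : χ.IsProd f g h) (H' : χ.IsProd f g h') : h = h' :=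
    H.mul_eq.symm.trans H'.mul_eq
  let m₀ : Bes χ a →ₗ[ℝ] Bes χ b →ₗ[ℝ] Bes χ c := LinearMap.mk₂ ℝ (fun f g => Bes.mk _ (hpb f g))
    (fun f f' g => Bes.ext_val (hu (hp (f + f') g) ((hp f g).add_left (hp f' g))))
    (fun s f g => Bes.ext_val (hu (hp (s • f) g) ((hp f g).smul_left s)))
    (fun f g g' => Bes.ext_val
      (hu (hp f (g + g')) ((hp f g).symm.add_left (hp f g').symm).symm))
    (fun s f g => Bes.ext_val (hu (hp f (s • g)) ((hp f g).symm.smul_left s).symm))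
  refine ⟨m₀.mkContinuous₂ D fun f g => ?_, fun f g => (hp f g).mul_eq.symm⟩
  rw [mul_assoc]
  exact Bes.norm_le (hpb f g)

/-! ### The little Besov spaces -/

/-- The space `𝒞^β`, as a subspace of the space of distributions of finite Besov norm. -/
def little {d : ℕ} (χ : DyadicPartition d) (β : ℝ) : Submodule ℝ (Bes χ β) where
  carrier := {f | χ.MemC β f.val}
  add_mem' {f g} hf hg := by
    change χ.MemC β (f.val + g.val)
    refine χ.memC_iff.2 fun ε hε => ?_
    obtain ⟨K, hK⟩ := χ.memC_iff.1 hf (ε / 2) (half_pos hε)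
    obtain ⟨K', hK'⟩ := χ.memC_iff.1 hg (ε / 2) (half_pos hε)
    refine ⟨max K K', fun k hk x => ?_⟩
    rw [χ.block_add]
    refine (abs_add_le _ _).trans ((add_le_add (hK k (le_of_max_le_left hk) x)
      (hK' k (le_of_max_le_right hk) x)).trans (le_of_eq (by ring)))
  zero_mem' := χ.memC_iff.2 fun ε hε => ⟨0, fun k _ x => by
    have h : χ.block k (Bes.val (0 : Bes χ β)) x = 0 := rfl
    have := wt_pos β k
    rw [h, abs_zero]
    positivity⟩
  smul_mem' c f hf := by
    change χ.MemC β (c • f.val)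
    refine χ.memC_iff.2 fun ε hε => ?_
    obtain ⟨K, hK⟩ := χ.memC_iff.1 hf (ε / (|c| + 1)) (by positivity)
    refine ⟨K, fun k hk x => ?_⟩
    have := wt_pos β k
    rw [χ.block_smul, abs_mul]
    calc |c| * |χ.block k f.val x| ≤ (|c| + 1) * (ε / (|c| + 1) * (wt β k)⁻¹) := by
          gcongr
          · linarith
          · exact hK k hk x
      _ = _ := by field_simp

/-- The little spaces are the right phase space: smallness of high blocks makes the semigroup
strongly continuous there, and closedness makes them complete. -/
lemma isClosed_little {d : ℕ} (χ : DyadicPartition d) (β : ℝ) :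
    IsClosed (little χ β : Set (Bes χ β)) := by
  refine isClosed_of_closure_subset fun f hf => χ.memC_iff.2 fun ε hε => ?_
  obtain ⟨g, hg, hfg⟩ := Metric.mem_closure_iff.1 hf (ε / 2) (half_pos hε)
  obtain ⟨K, hK⟩ := χ.memC_iff.1 hg (ε / 2) (half_pos hε)
  refine ⟨K, fun k hk x => ?_⟩
  have h1 := (f - g).abs_block_le k x
  rw [map_sub, χ.block_sub, ← dist_eq_norm] at h1
  have h2 := hK k hk x
  have hw := inv_pos.2 (wt_pos β k)
  have h3 := abs_add_le (χ.block k f.val x - χ.block k g.val x) (χ.block k g.val x)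
  rw [sub_add_cancel] at h3
  nlinarith

lemma completeSpace_little {d : ℕ} (χ : DyadicPartition d) {β : ℝ} (hβ : -2 < β) :
    CompleteSpace (little χ β) :=
  haveI := Bes.completeSpace (χ := χ) hβ
  (isClosed_little χ β).completeSpace_coe

end

end CahnHilliard

namespace CahnHilliard

noncomputable section

/-! ### The semigroup on Besov spaces -/

lemma fc_add {d : ℕ} (m : Fin d → ℤ) (f g : Dist d) : fc m (f + g) = fc m f + fc m g :=
  (fc m).map_add f g

lemma fc_smul {d : ℕ} (m : Fin d → ℤ) (c : ℝ) (f : Dist d) : fc m (c • f) = c • fc m f :=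
  (fc m).map_smul c f

lemma semigroup_of_nonpos {d : ℕ} {r : ℝ} (hr : r ≤ 0) (f : Dist d) : semigroup r f = f :=
  dif_neg hr.not_gt

/-- The semigroup is the identity at all r ≤ 0, so facts proved for r ≥ 0 extend to every real r. -/
lemma semigroup_max {d : ℕ} (r : ℝ) (f : Dist d) : semigroup (max r 0) f = semigroup r f := by
  rcases le_total r 0 with h | h
  · rw [max_eq_right h, semigroup_of_nonpos h, semigroup_of_nonpos le_rfl]
  · rw [max_eq_left h]

lemma DyadicPartition.semigroup_add {d : ℕ} (χ : DyadicPartition d) (r : ℝ) (f g : Dist d) :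
    semigroup r (f + g) = semigroup r f + semigroup r g := by
  rw [← semigroup_max r, ← semigroup_max r f, ← semigroup_max r g]
  refine χ.fc_ext fun m => ?_
  simp only [fc_add, χ.fc_semigroup (le_max_right r 0), mul_add]

lemma DyadicPartition.semigroup_smul {d : ℕ} (χ : DyadicPartition d) (r c : ℝ) (f : Dist d) :
    semigroup r (c • f) = c • semigroup r f := by
  rw [← semigroup_max r, ← semigroup_max r f]
  refine χ.fc_ext fun m => ?_
  simp only [fc_smul, χ.fc_semigroup (le_max_right r 0), mul_smul_comm]

lemma DyadicPartition.semigroup_semigroup {d : ℕ} (χ : DyadicPartition d) {r s : ℝ} (hr : 0 ≤ r)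
    (hs : 0 ≤ s) (f : Dist d) : semigroup r (semigroup s f) = semigroup (r + s) f := by
  refine χ.fc_ext fun m => ?_
  rw [χ.fc_semigroup hr, χ.fc_semigroup hs, χ.fc_semigroup (add_nonneg hr hs), ← mul_assoc]
  congr 1
  rw [heatSymbol, heatSymbol, heatSymbol, ← Complex.ofReal_mul, ← Real.exp_add]
  congr 2
  ring

/-- Formulated one block at a time, because it is applied to whole norms and also to the smallness
of high blocks alone. -/
lemma DyadicPartition.exists_besovBound_semigroup {d : ℕ} (χ : DyadicPartition d) :
    ∃ C : ℝ, 0 < C ∧ ∀ (β : ℝ) (r : ℝ) (f : Dist d) (k : ℕ) (A : ℝ),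
      (∀ x, |χ.block k f x| ≤ A * (wt β k)⁻¹) →
        ∀ x, |χ.block k (semigroup r f) x| ≤ C * A * (wt β k)⁻¹ := by
  obtain ⟨C, hC0, hC⟩ := χ.exists_block_semigroup_le'
  refine ⟨C + 1, by positivity, fun β r f k A hA x => ?_⟩
  have h0 : 0 ≤ A * (wt β k)⁻¹ := (abs_nonneg _).trans (hA x)
  rw [← semigroup_max, mul_assoc]
  refine (hC k (max r 0) (le_max_right r 0) f _ hA x).trans ?_
  linarith

/-- The semigroup as a family of operators on the little Besov space. -/
lemma DyadicPartition.exists_semigroupCLM {d : ℕ} (χ : DyadicPartition d) (β : ℝ) :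
    ∃ (P : ℝ → little χ β →L[ℝ] little χ β) (C : ℝ),
      (∀ r f, (P r f).1.val = semigroup r f.1.val) ∧ ∀ r, ‖P r‖ ≤ C := by
  obtain ⟨C, hC0, hC⟩ := χ.exists_besovBound_semigroup
  have hb (r : ℝ) (f : Bes χ β) : χ.BesovBound β (semigroup r f.val) (C * ‖f‖) := fun k x =>
    hC β r f.val k _ (f.besovBound_norm k) x
  have hl (r : ℝ) (f : little χ β) : Bes.mk _ (hb r f.1) ∈ little χ β := by
    refine χ.memC_iff.2 fun ε hε => ?_
    obtain ⟨K, hK⟩ := χ.memC_iff.1 f.2 (ε / C) (by positivity)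
    refine ⟨K, fun k hk x => (hC β r f.1.val k _ (hK k hk) x).trans (le_of_eq ?_)⟩
    field_simp
  refine ⟨fun r => LinearMap.mkContinuous
    { toFun := fun f => ⟨Bes.mk _ (hb r f.1), hl r f⟩
      map_add' := fun f g => Subtype.ext (Bes.ext_val (χ.semigroup_add r f.1.val g.1.val))
      map_smul' := fun c f => Subtype.ext (Bes.ext_val (χ.semigroup_smul r c f.1.val)) } C
    fun f => Bes.norm_le (hb r f.1), C, fun r f => rfl, fun r => ?_⟩
  exact LinearMap.mkContinuous_norm_le _ hC0.le _

lemma DyadicPartition.exists_besovBound_semigroup_sub {d : ℕ} (χ : DyadicPartition d) (K : ℕ) :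
    ∃ C : ℝ, 0 ≤ C ∧ ∀ k < K, ∀ (β r : ℝ) (f : Dist d) (A : ℝ), 0 ≤ r → χ.BesovBound β f A →
        ∀ x, |χ.block k (semigroup r f - f) x| ≤ C * r * A * (wt β k)⁻¹ := by
  choose C hC0 hC using χ.exists_block_semigroup_sub_le
  refine ⟨∑ k ∈ Finset.range K, C k, Finset.sum_nonneg fun k _ => hC0 k,
    fun k hk β r f A hr hA x => ?_⟩
  have h1 := Finset.single_le_sum (f := C) (fun k _ => hC0 k) (Finset.mem_range.2 hk)
  have := wt_pos β k
  have := hA.nonneg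
  refine (hC k r hr f _ (hA k) x).trans ?_
  rw [mul_assoc _ A]
  gcongr

/-- High blocks of f are small and stay so under P_r; on the finitely many low ones the deviation is
O(r). -/
lemma DyadicPartition.tendsto_semigroup {d : ℕ} (χ : DyadicPartition d) {β : ℝ}
    {P : ℝ → little χ β →L[ℝ] little χ β} (hP : ∀ r f, (P r f).1.val = semigroup r f.1.val)
    (f : little χ β) : Tendsto (fun r => P r f) (𝓝[≥] 0) (𝓝 f) := by
  obtain ⟨C, hC0, hC⟩ := χ.exists_besovBound_semigroup
  refine Metric.tendsto_nhds.2 fun ε hε => ?_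
  obtain ⟨K, hK⟩ := χ.memC_iff.1 f.2 (ε / 2 / (C + 1)) (by positivity)
  obtain ⟨B, hB0, hB⟩ := χ.exists_besovBound_semigroup_sub K
  have h0 : Tendsto (fun r : ℝ => B * r * ‖f.1‖) (𝓝[≥] 0) (𝓝 0) := by
    have : Continuous fun r : ℝ => B * r * ‖f.1‖ := by fun_prop
    exact (this.tendsto' 0 0 (by simp)).mono_left nhdsWithin_le_nhds
  filter_upwards [h0.eventually_le_const (half_pos hε), self_mem_nhdsWithin] with r hr hr0
  rw [dist_eq_norm]
  refine lt_of_le_of_lt ?_ (half_lt_self hε)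
  refine Bes.norm_le (f := (P r f - f).1) fun k x => ?_
  change |χ.block k ((P r f).1 - f.1).val x| ≤ _
  rw [map_sub, hP]
  have hw := inv_pos.2 (wt_pos β k)
  rcases lt_or_ge k K with hk | hk
  · exact (hB k hk β r _ _ hr0 f.1.besovBound_norm x).trans (by gcongr)
  · rw [χ.block_sub]
    have h1 := hC β r f.1.val k _ (hK k hk) x
    have h2 := hK k hk x
    refine (abs_sub _ _).trans ((add_le_add h1 h2).trans (le_of_eq ?_))
    field_simp

/-- For a fixed element of the little Besov space, the semigroup is almost contractive. -/
lemma DyadicPartition.exists_norm_semigroup_le {d : ℕ} (χ : DyadicPartition d) {β : ℝ}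
    {P : ℝ → little χ β →L[ℝ] little χ β} (hP : ∀ r f, (P r f).1.val = semigroup r f.1.val)
    (f : little χ β) : ∃ B : ℝ, 0 ≤ B ∧ ∀ r, 0 ≤ r → ‖P r f‖ ≤ (1 + B * r) * ‖f‖ := by
  rcases eq_or_ne f 0 with rfl | hf
  · exact ⟨0, le_rfl, fun r _ => by simp⟩
  have hf0 : 0 < ‖f‖ := norm_pos_iff.2 hf
  obtain ⟨C, hC0, hC⟩ := χ.exists_besovBound_semigroup
  -- Beyond K the blocks of f are so small that even after the loss of the factor C they stay below
  -- ‖f‖. The finitely many blocks below K change by O(r).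
  obtain ⟨K, hK⟩ := χ.memC_iff.1 f.2 (‖f‖ / C) (by positivity)
  obtain ⟨B, hB0, hB⟩ := χ.exists_besovBound_semigroup_sub K
  refine ⟨B, hB0, fun r hr => Bes.norm_le (f := (P r f).1) fun k x => ?_⟩
  rw [hP]
  have hw := inv_pos.2 (wt_pos β k)
  rcases lt_or_ge k K with hk | hk
  · have h1 := hB k hk β r _ _ hr f.1.besovBound_norm x
    have h2 := f.1.besovBound_norm k x
    have h3 := abs_add_le (χ.block k (semigroup r f.1.val - f.1.val) x) (χ.block k f.1.val x)
    rw [χ.block_sub, sub_add_cancel] at h3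
    rw [χ.block_sub] at h1
    refine h3.trans ((add_le_add h1 h2).trans (le_of_eq ?_))
    change B * r * ‖f‖ * (wt β k)⁻¹ + ‖f‖ * (wt β k)⁻¹ = _
    ring
  · refine (hC β r f.1.val k _ (hK k hk) x).trans ?_
    rw [mul_div_cancel₀ _ hC0.ne']
    gcongr
    exact le_mul_of_one_le_left hf0.le (by have := mul_nonneg hB0 hr; linarith)

lemma DyadicPartition.BesovBound.memC {d : ℕ} {χ : DyadicPartition d} {β β' : ℝ} {f : Dist d}
    {C : ℝ} (h : χ.BesovBound β' f C) (hβ : β < β') : χ.MemC β f := by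
  refine χ.memC_iff.2 fun ε hε => ?_
  have h1 : Tendsto (fun k => C * (wt (β' - β) k)⁻¹) atTop (𝓝 0) := by
    simp only [wt_inv]
    simp only [wt_eq_pow]
    have := (tendsto_pow_atTop_nhds_zero_of_lt_one (r := (2 : ℝ) ^ (-(β' - β))) (by positivity)
      (Real.rpow_lt_one_of_one_lt_of_neg one_lt_two (by linarith))).const_mul
        (C * (2 : ℝ) ^ (- -(β' - β)))
    simpa only [mul_assoc, mul_zero] using this
  obtain ⟨K, hK⟩ := eventually_atTop.1 (h1.eventually_le_const hε)
  refine ⟨K, fun k hk x => (h k x).trans ?_⟩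
  have hw := inv_pos.2 (wt_pos β k)
  have h2 : (wt β' k)⁻¹ = (wt (β' - β) k)⁻¹ * (wt β k)⁻¹ := by
    rw [wt_inv, wt_inv, wt_inv, wt, wt, wt, ← Real.rpow_add two_pos]
    congr 1
    ring
  rw [h2, ← mul_assoc]
  have := hK k hk
  gcongr

lemma rpow_le_one_add {θ t : ℝ} (hθ0 : 0 ≤ θ) (hθ1 : θ ≤ 1) (ht : 0 ≤ t) : t ^ θ ≤ 1 + t := by
  rcases le_total t 1 with h | h
  · exact (Real.rpow_le_one ht h hθ0).trans (by linarith)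
  · calc t ^ θ ≤ t ^ (1 : ℝ) := Real.rpow_le_rpow_of_exponent_le h hθ1
      _ = t := Real.rpow_one t
      _ ≤ _ := by linarith

/-- The smoothing effect of `P_r Δ`. -/
lemma DyadicPartition.exists_besovBound_semigroup_lap {d : ℕ} (χ : DyadicPartition d) {α γ : ℝ}
    (h0 : 0 ≤ α + 2 + γ) (h4 : α + 2 + γ ≤ 4) :
    ∃ C : ℝ, 0 ≤ C ∧ ∀ (r : ℝ) (f : Dist d) (A : ℝ), 0 < r → χ.BesovBound (-γ) f A →
      χ.BesovBound α (semigroup r (lap f)) (C * r ^ (-((α + 2 + γ) / 4)) * A) := by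
  obtain ⟨C, hC0, hC⟩ := χ.exists_block_semigroup_lap_le
  refine ⟨C * (2 : ℝ) ^ (-(α + γ)), by positivity, fun r f A hr hA k x => ?_⟩
  have hA0 := hA.nonneg
  refine (hC k r hr.le f _ (hA k) x).trans ?_
  set θ := (α + 2 + γ) / 4 with hθ
  have hw := inv_pos.2 (wt_pos α k)
  have h1 : (wt (-γ) k)⁻¹ = wt (α + γ) k * (wt α k)⁻¹ := by
    rw [wt_inv, wt_inv, wt, wt, wt, ← Real.rpow_add two_pos]
    congr 1
    ring
  have h16 : (16 : ℝ) = (2 : ℝ) ^ (4 : ℝ) := by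
    rw [show (4 : ℝ) = ((4 : ℕ) : ℝ) by norm_num, Real.rpow_natCast]; norm_num
  have h44 : (4 : ℝ) = (2 : ℝ) ^ (2 : ℝ) := by
    rw [show (2 : ℝ) ^ (2 : ℝ) = (2 : ℝ) ^ ((2 : ℕ) : ℝ) by norm_num, Real.rpow_natCast]; norm_num
  -- The loss 4^k of the Laplacian and the change of weight 2^{(α+γ)k} combine to 16^{θk}; the bound
  -- (r16^k)^θ ≤ 1 + r16^k then trades this for r^{-θ}.
  have h2 : (4 : ℝ) ^ k * ((2 : ℝ) ^ (α + γ)) ^ k = ((16 : ℝ) ^ k) ^ θ := by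
    rw [← mul_pow, ← Real.rpow_natCast, ← Real.rpow_natCast, ← Real.rpow_mul (by norm_num),
      mul_comm (k : ℝ), Real.rpow_mul (by norm_num)]
    congr 1
    nth_rewrite 1 [h44]
    rw [h16, ← Real.rpow_add two_pos, ← Real.rpow_mul two_pos.le, hθ]
    congr 1
    ring
  have h3 : ((16 : ℝ) ^ k) ^ θ / (1 + r * 16 ^ k) ≤ r ^ (-θ) := by
    rw [div_le_iff₀ (by positivity)]
    have h5 := rpow_le_one_add (θ := θ) (t := r * 16 ^ k) (by rw [hθ]; linarith)
      (by rw [hθ]; linarith) (by positivity)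
    rw [Real.mul_rpow hr.le (by positivity)] at h5
    have hrθ : 0 < r ^ θ := Real.rpow_pos_of_pos hr θ
    rw [Real.rpow_neg hr.le, ← div_eq_inv_mul, le_div_iff₀ hrθ]
    linarith
  calc C * (4 ^ k / (1 + r * 16 ^ k)) * (A * (wt (-γ) k)⁻¹)
      = C * (2 : ℝ) ^ (-(α + γ)) * ((4 ^ k * ((2 : ℝ) ^ (α + γ)) ^ k) / (1 + r * 16 ^ k)) * A *
          (wt α k)⁻¹ := by
        rw [h1, wt_eq_pow]; ring
    _ ≤ _ := by
        rw [h2]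
        gcongr

/-- The operators `P_r Δ` from a Besov space to a little Besov space. -/
lemma DyadicPartition.exists_semigroupLapCLM {d : ℕ} (χ : DyadicPartition d) {α γ : ℝ}
    (h0 : 0 ≤ α + 2 + γ) (h4 : α + 2 + γ < 4) :
    ∃ (K : ℝ → Bes χ (-γ) →L[ℝ] little χ α) (C : ℝ), 0 ≤ C ∧
      (∀ r, 0 < r → ∀ f, (K r f).1.val = semigroup r (lap f.val)) ∧
      ∀ r, 0 < r → ‖K r‖ ≤ C * r ^ (-((α + 2 + γ) / 4)) := by
  obtain ⟨C, hC0, hC⟩ := χ.exists_besovBound_semigroup_lap h0 h4.le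
  -- The endpoint exponent 2 - γ exceeds α, so the image has regularity to spare and lies in the
  -- little space.
  obtain ⟨C', -, hC'⟩ := χ.exists_besovBound_semigroup_lap (α := 2 - γ) (γ := γ) (by linarith)
    (by linarith)
  have key (r : ℝ) (hr : 0 < r) : ∃ K : Bes χ (-γ) →L[ℝ] little χ α,
      (∀ f, (K f).1.val = semigroup r (lap f.val)) ∧ ‖K‖ ≤ C * r ^ (-((α + 2 + γ) / 4)) := by
    have hb (f : Bes χ (-γ)) := hC r f.val _ hr f.besovBound_norm
    refine ⟨LinearMap.mkContinuous
      { toFun := fun f => ⟨Bes.mk _ (hb f),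
          (hC' r f.val _ hr f.besovBound_norm).memC (by linarith)⟩
        map_add' := fun f g => Subtype.ext (Bes.ext_val
          (χ.semigroup_add r (lap f.val) (lap g.val)))
        map_smul' := fun c f => Subtype.ext (Bes.ext_val
          (χ.semigroup_smul r c (lap f.val))) } _ fun f => Bes.norm_le (hb f), fun f => rfl, ?_⟩
    exact LinearMap.mkContinuous_norm_le _ (by positivity) _
  choose! K hK using key
  exact ⟨K, C, hC0, fun r hr => (hK r hr).1, fun r hr => (hK r hr).2⟩

end

end CahnHilliard

namespace CahnHilliard

noncomputable section

/-! ### Duhamel integrals with a weakly singular kernel -/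

/-- A bounded strongly continuous semigroup `P` on `X`, with operators `K r : Y → X` that behave
like `P r` composed with an unbounded operator, and whose norm is at most `C r ^ (-θ)`. -/
structure SmoothingPair {X Y : Type*} [NormedAddCommGroup X] [NormedSpace ℝ X]
    [NormedAddCommGroup Y] [NormedSpace ℝ Y] (P : ℝ → X →L[ℝ] X) (K : ℝ → Y →L[ℝ] X)
    (M C θ : ℝ) : Prop where
  theta_nonneg : 0 ≤ θ
  theta_lt_one : θ < 1
  C_nonneg : 0 ≤ C
  norm_le : ∀ r, ‖P r‖ ≤ M
  zero_apply : ∀ x, P 0 x = x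
  add_apply : ∀ r s, 0 ≤ r → 0 ≤ s → ∀ x, P r (P s x) = P (r + s) x
  tendsto : ∀ x, Tendsto (fun r => P r x) (𝓝[≥] 0) (𝓝 x)
  norm_kernel_le : ∀ r, 0 < r → ‖K r‖ ≤ C * r ^ (-θ)
  apply_kernel : ∀ r s, 0 ≤ r → 0 < s → ∀ y, P r (K s y) = K (r + s) y

/-- The Duhamel integral `∫_0^r K(r-q) h(q) dq`. -/
def duhamel {X Y : Type*} [NormedAddCommGroup X] [NormedSpace ℝ X]
    [NormedAddCommGroup Y] [NormedSpace ℝ Y] (K : ℝ → Y →L[ℝ] X) (h : ℝ → Y) (r : ℝ) : X :=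
  ∫ q in (0 : ℝ)..r, K (r - q) (h q)

namespace SmoothingPair

variable {X Y : Type*} [NormedAddCommGroup X] [NormedSpace ℝ X]
  [NormedAddCommGroup Y] [NormedSpace ℝ Y] {P : ℝ → X →L[ℝ] X} {K : ℝ → Y →L[ℝ] X}
  {M C θ : ℝ}

/-- For s ≤ t, P_t x - P_s x = P_s(P_{t-s}x - x), and P_s is uniformly bounded; so continuity at 0
gives continuity from both sides. -/
lemma continuousOn_apply (H : SmoothingPair P K M C θ) (x : X) :
    ContinuousOn (fun r => P r x) (Set.Ici 0) := by
  intro r₀ hr₀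
  have hM : 0 ≤ M := (norm_nonneg _).trans (H.norm_le 0)
  have h1 : Tendsto (fun r : ℝ => |r - r₀|) (𝓝[Set.Ici 0] r₀) (𝓝[≥] 0) := by
    refine tendsto_nhdsWithin_iff.2 ⟨?_, Eventually.of_forall fun r => Set.mem_Ici.2 (abs_nonneg _)⟩
    have : Continuous fun r : ℝ => |r - r₀| := by fun_prop
    exact (this.tendsto' r₀ 0 (by simp)).mono_left nhdsWithin_le_nhds
  have h2 : Tendsto (fun r => M * ‖P |r - r₀| x - x‖) (𝓝[Set.Ici 0] r₀) (𝓝 0) := by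
    simpa using (tendsto_iff_norm_sub_tendsto_zero.1 ((H.tendsto x).comp h1)).const_mul M
  refine tendsto_iff_norm_sub_tendsto_zero.2 (squeeze_zero' (Eventually.of_forall fun _ =>
    norm_nonneg _) ?_ h2)
  filter_upwards [self_mem_nhdsWithin] with r hr
  have h3 (s t : ℝ) (hs : 0 ≤ s) (hst : s ≤ t) : ‖P t x - P s x‖ ≤ M * ‖P |t - s| x - x‖ := by
    have h4 : P t x - P s x = P s (P |t - s| x - x) := by
      rw [map_sub, H.add_apply _ _ hs (abs_nonneg _), abs_of_nonneg (sub_nonneg.2 hst),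
        add_sub_cancel]
    rw [h4]
    exact (P s).le_of_opNorm_le (H.norm_le s) _
  rcases le_total r₀ r with h | h
  · exact h3 r₀ r hr₀ h
  · rw [norm_sub_rev, abs_sub_comm]
    exact h3 r r₀ hr h

/-- Away from r = 0 the kernel factors as K(r) = P(r - a₀/2)K(a₀/2), so it inherits strong
continuity from P. -/
lemma tendsto_kernel (H : SmoothingPair P K M C θ) {ι : Type*} {l : Filter ι} {a : ι → ℝ}
    {h : ι → Y} {a₀ : ℝ} {y₀ : Y} (ha₀ : 0 < a₀) (ha : Tendsto a l (𝓝 a₀))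
    (hh : Tendsto h l (𝓝 y₀)) : Tendsto (fun t => K (a t) (h t)) l (𝓝 (K a₀ y₀)) := by
  have ha₂ : 0 < a₀ / 2 := half_pos ha₀
  have hev : ∀ᶠ t in l, a₀ / 2 < a t := ha.eventually_const_lt (half_lt_self ha₀)
  have h1 : Tendsto (fun t => K (a t) y₀) l (𝓝 (K a₀ y₀)) := by
    have h2 : ContinuousWithinAt (fun r => P r (K (a₀ / 2) y₀)) (Set.Ici 0) (a₀ / 2) :=
      H.continuousOn_apply _ _ ha₂.le
    have h3 : Tendsto (fun t => a t - a₀ / 2) l (𝓝[Set.Ici 0] (a₀ / 2)) := by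
      refine tendsto_nhdsWithin_iff.2 ⟨?_, ?_⟩
      · simpa only [sub_half] using ha.sub_const (a₀ / 2)
      · filter_upwards [hev] with t ht
        exact (sub_pos.2 ht).le
    have h4 := h2.tendsto.comp h3
    rw [H.apply_kernel _ _ ha₂.le ha₂, add_halves] at h4
    refine h4.congr' ?_
    filter_upwards [hev] with t ht
    change P _ _ = _
    rw [H.apply_kernel _ _ (sub_pos.2 ht).le ha₂, sub_add_cancel]
  have h5 : Tendsto (fun t => C * (a₀ / 2) ^ (-θ) * ‖h t - y₀‖) l (𝓝 0) := by
    simpa using (tendsto_iff_norm_sub_tendsto_zero.1 hh).const_mul (C * (a₀ / 2) ^ (-θ))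
  have h6 : Tendsto (fun t => K (a t) (h t - y₀)) l (𝓝 0) := by
    refine squeeze_zero_norm' ?_ h5
    filter_upwards [hev] with t ht
    refine (K (a t)).le_of_opNorm_le ((H.norm_kernel_le _ (ha₂.trans ht)).trans ?_) _
    have h7 : a t ^ (-θ) ≤ (a₀ / 2) ^ (-θ) :=
      Real.rpow_le_rpow_of_nonpos ha₂ ht.le (neg_nonpos.2 H.theta_nonneg)
    have := H.C_nonneg
    gcongr
  simpa using h6.add h1

lemma intervalIntegrable_bound (H : SmoothingPair P K M C θ) (c r : ℝ) :
    IntervalIntegrable (fun q => C * (r - q) ^ (-θ) * c) volume 0 r := by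
  have h : IntervalIntegrable (fun s : ℝ => s ^ (-θ)) volume 0 r :=
    intervalIntegral.intervalIntegrable_rpow' (by linarith [H.theta_lt_one])
  have h2 := (h.comp_sub_left r).symm
  rw [sub_self, sub_zero] at h2
  exact (h2.const_mul C).mul_const c

lemma intervalIntegrable_kernel (H : SmoothingPair P K M C θ) {h : ℝ → Y} {r : ℝ} (hr : 0 ≤ r)
    (hh : ContinuousOn h (Set.Icc 0 r)) :
    IntervalIntegrable (fun q => K (r - q) (h q)) volume 0 r := by
  obtain ⟨B, hB⟩ := isCompact_Icc.exists_bound_of_continuousOn hh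
  have h1 := (intervalIntegrable_iff_integrableOn_Ioo_of_le hr).1
    (H.intervalIntegrable_bound B r)
  refine (intervalIntegrable_iff_integrableOn_Ioo_of_le hr).2 (Integrable.mono' h1 ?_ ?_)
  · refine ContinuousOn.aestronglyMeasurable (fun q hq => ?_) measurableSet_Ioo
    refine H.tendsto_kernel (sub_pos.2 hq.2) ?_
      ((hh q (Set.Ioo_subset_Icc_self hq)).mono Set.Ioo_subset_Icc_self)
    exact ((continuous_const.sub continuous_id).tendsto q).mono_left nhdsWithin_le_nhds
  · refine (ae_restrict_iff' measurableSet_Ioo).2 (ae_of_all _ fun q hq => ?_)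
    have h2 := (K (r - q)).le_of_opNorm_le (H.norm_kernel_le _ (sub_pos.2 hq.2)) (h q)
    refine h2.trans ?_
    have := H.C_nonneg
    have h3 : 0 ≤ (r - q) ^ (-θ) := Real.rpow_nonneg (sub_pos.2 hq.2).le _
    gcongr
    exact hB q (Set.Ioo_subset_Icc_self hq)

/-- With s = r - q the factor e^{-λs} comes out of the forcing, and its integral against s^{-θ} is
at most λ^{θ-1}Γ(1-θ). This vanishes as λ → ∞ and replaces any smallness of the time interval. -/
lemma norm_duhamel_le (H : SmoothingPair P K M C θ) {h : ℝ → Y} {r lam A B : ℝ} (hr : 0 ≤ r)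
    (hlam : 0 < lam) (hA : 0 ≤ A)
    (hh : ∀ q ∈ Set.Icc 0 r, ‖h q‖ ≤ A * Real.exp (lam * q) + B) :
    ‖duhamel K h r‖ ≤ A * Real.exp (lam * r) * (C * ((1 / lam) ^ (1 - θ) * Real.Gamma (1 - θ))) +
      B * (C / (1 - θ) * r ^ (1 - θ)) := by
  have hC := H.C_nonneg
  have hθ := H.theta_lt_one
  have hint : IntervalIntegrable (fun s : ℝ => s ^ (-θ)) volume 0 r :=
    intervalIntegral.intervalIntegrable_rpow' (by linarith)
  have hint2 : IntervalIntegrable (fun s : ℝ => s ^ (-θ) * Real.exp (-(lam * s))) volume 0 r :=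
    hint.mul_continuousOn (by fun_prop)
  have h1 : ‖duhamel K h r‖ ≤
      ∫ s in (0 : ℝ)..r, (A * Real.exp (lam * r) * C * (s ^ (-θ) * Real.exp (-(lam * s))) +
        B * C * s ^ (-θ)) := by
    have h2 : duhamel K h r = ∫ s in (0 : ℝ)..r, K s (h (r - s)) := by
      have := intervalIntegral.integral_comp_sub_left (a := 0) (b := r)
        (fun q => K (r - q) (h q)) r
      simp only [sub_sub_cancel, sub_self, sub_zero] at this
      exact this.symm
    rw [h2]
    refine intervalIntegral.norm_integral_le_of_norm_le hr ?_
      ((hint2.const_mul _).add (hint.const_mul _))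
    refine ae_of_all _ fun s hs => ?_
    refine ((K s).le_of_opNorm_le (H.norm_kernel_le s hs.1) (h (r - s))).trans ?_
    have h3 := hh (r - s) ⟨sub_nonneg.2 hs.2, by linarith [hs.1]⟩
    have h4 : 0 ≤ s ^ (-θ) := Real.rpow_nonneg hs.1.le _
    calc C * s ^ (-θ) * ‖h (r - s)‖ ≤ C * s ^ (-θ) * (A * Real.exp (lam * (r - s)) + B) := by
          gcongr
      _ = _ := by
          rw [mul_sub, sub_eq_add_neg, Real.exp_add]
          ring
  refine h1.trans ?_
  rw [intervalIntegral.integral_add (hint2.const_mul _) (hint.const_mul _),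
    intervalIntegral.integral_const_mul, intervalIntegral.integral_const_mul,
    integral_rpow (Or.inl (by linarith)), Real.zero_rpow (by linarith), sub_zero,
    show -θ + 1 = 1 - θ by ring]
  have h5 : ∫ s in (0 : ℝ)..r, s ^ (-θ) * Real.exp (-(lam * s)) ≤
      (1 / lam) ^ (1 - θ) * Real.Gamma (1 - θ) := by
    rw [← Real.integral_rpow_mul_exp_neg_mul_Ioi (by linarith) hlam,
      intervalIntegral.integral_of_le hr, show 1 - θ - 1 = -θ by ring]
    refine setIntegral_mono_set ?_ ?_ (Eventually.of_forall fun s hs => hs.1)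
    · have := integrableOn_rpow_mul_exp_neg_mul_rpow (p := 1) (s := -θ) (b := lam) (by linarith)
        one_pos hlam
      simpa only [Real.rpow_one, neg_mul] using this
    · refine (ae_restrict_iff' measurableSet_Ioi).2 (ae_of_all _ fun s hs => ?_)
      exact mul_nonneg (Real.rpow_nonneg (Set.mem_Ioi.1 hs).le _) (Real.exp_pos _).le
  have h6 : 0 ≤ A * Real.exp (lam * r) * C := by positivity
  refine add_le_add ?_ (le_of_eq (by ring))
  rw [← mul_assoc (A * _)]
  gcongr

/-- The contribution of a bounded forcing. -/
lemma norm_duhamel_le_const (H : SmoothingPair P K M C θ) {h : ℝ → Y} {r B : ℝ} (hr : 0 ≤ r)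
    (hh : ∀ q ∈ Set.Icc 0 r, ‖h q‖ ≤ B) :
    ‖duhamel K h r‖ ≤ B * (C / (1 - θ) * r ^ (1 - θ)) := by
  simpa using H.norm_duhamel_le (A := 0) hr one_pos le_rfl (by simpa using hh)

/-- A Gronwall inequality. -/
lemma exists_gronwall (H : SmoothingPair P K M C θ) {L : ℝ} (hL : 0 ≤ L) :
    ∃ lam : ℝ, 0 < lam ∧ (L * (C * ((1 / lam) ^ (1 - θ) * Real.Gamma (1 - θ))) ≤ 1 / 2) ∧
      ∀ (U a e : ℝ) (w : ℝ → X) (h : ℝ → Y), 0 ≤ a → 0 ≤ e →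
      ContinuousOn w (Set.Icc 0 U) → (∀ r ∈ Set.Icc 0 U, ‖w r‖ ≤ a + ‖duhamel K h r‖) →
      (∀ q ∈ Set.Icc 0 U, ‖h q‖ ≤ L * ‖w q‖ + e) →
      ∀ r ∈ Set.Icc 0 U, ‖w r‖ ≤ 2 * (a + e * (C / (1 - θ) * U ^ (1 - θ))) * Real.exp (lam * U) := by
  have hC := H.C_nonneg
  have hθ : 0 < 1 - θ := by linarith [H.theta_lt_one]
  -- λ is chosen so large that the feedback through the Lipschitz constant is halved; the same λ
  -- later makes the fixed point map a contraction.
  obtain ⟨lam, hlam, hlam0⟩ : ∃ lam : ℝ,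
      L * (C * ((1 / lam) ^ (1 - θ) * Real.Gamma (1 - θ))) ≤ 1 / 2 ∧ 0 < lam := by
    have h1 : Tendsto (fun lam : ℝ => L * (C * ((1 / lam) ^ (1 - θ) * Real.Gamma (1 - θ)))) atTop
        (𝓝 0) := by
      have h2 : Tendsto (fun lam : ℝ => (1 / lam) ^ (1 - θ)) atTop (𝓝 0) := by
        simp only [one_div]
        have := tendsto_inv_atTop_zero.rpow_const (p := 1 - θ) (Or.inr hθ.le)
        rwa [Real.zero_rpow hθ.ne'] at this
      simpa using ((h2.mul_const (Real.Gamma (1 - θ))).const_mul C).const_mul L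
    exact ((h1.eventually_le_const (by norm_num)).and (eventually_gt_atTop 0)).exists
  refine ⟨lam, hlam0, hlam, fun U a e w h ha he hw h1 h2 r hr => ?_⟩
  have hU : 0 ≤ U := hr.1.trans hr.2
  -- At a maximum point of e^{-λq}‖w q‖ the integral inequality bounds the maximum by half of itself
  -- plus the data.
  obtain ⟨q, hq, hmax⟩ := isCompact_Icc.exists_isMaxOn (Set.nonempty_Icc.2 hU)
    (f := fun q => Real.exp (-(lam * q)) * ‖w q‖) (ContinuousOn.mul (by fun_prop) hw.norm)
  set S := Real.exp (-(lam * q)) * ‖w q‖ with hS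
  have hS0 : 0 ≤ S := by positivity
  have hle (s) (hs : s ∈ Set.Icc 0 U) : ‖w s‖ ≤ S * Real.exp (lam * s) := by
    have := hmax hs
    change Real.exp (-(lam * s)) * ‖w s‖ ≤ S at this
    rwa [Real.exp_neg, ← div_eq_inv_mul, div_le_iff₀ (Real.exp_pos _)] at this
  set b := C / (1 - θ) * U ^ (1 - θ) with hb
  have hb0 : 0 ≤ b := by positivity
  have h3 : ‖duhamel K h q‖ ≤ S * Real.exp (lam * q) * (1 / 2) + e * b := by
    refine (H.norm_duhamel_le (lam := lam) (A := L * S) (B := e) hq.1 hlam0 (by positivity)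
      fun t ht => ?_).trans ?_
    · have ht' : t ∈ Set.Icc 0 U := ⟨ht.1, ht.2.trans hq.2⟩
      refine (h2 t ht').trans ?_
      have := mul_le_mul_of_nonneg_left (hle t ht') hL
      linarith
    · refine add_le_add ?_ ?_
      · calc _ = S * Real.exp (lam * q) * (L * (C * ((1 / lam) ^ (1 - θ) * Real.Gamma (1 - θ)))) := by
              ring
          _ ≤ _ := by gcongr
      · have := Real.rpow_le_rpow hq.1 hq.2 hθ.le
        rw [hb]
        gcongr
  have h4 : ‖w q‖ = S * Real.exp (lam * q) := by
    rw [hS, Real.exp_neg]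
    field_simp
  have h5 := h1 q hq
  have h6 : S ≤ 2 * (a + e * b) := by
    have h7 : 1 ≤ Real.exp (lam * q) := Real.one_le_exp (mul_nonneg hlam0.le hq.1)
    have h8 : S * Real.exp (lam * q) ≤ 2 * (a + e * b) := by linarith
    nlinarith
  refine (hle r hr).trans ?_
  have h9 : Real.exp (lam * r) ≤ Real.exp (lam * U) := by
    have := hr.2
    gcongr
  gcongr

/-- In the variable s = r - q the singularity does not move with r, so one integrable majorant
serves all r. Extending h by constants makes the integrand meaningful on all of [0, U]; the cutoff s
< r is discontinuous in r only at s = r₀, a null set. -/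
lemma continuousOn_duhamel (H : SmoothingPair P K M C θ) {h : ℝ → Y} {U : ℝ}
    (hh : ContinuousOn h (Set.Icc 0 U)) : ContinuousOn (duhamel K h) (Set.Icc 0 U) := by
  rcases lt_or_ge U 0 with hU | hU
  · rw [Set.Icc_eq_empty hU.not_ge]; exact continuousOn_empty _
  obtain ⟨B, hB⟩ := isCompact_Icc.exists_bound_of_continuousOn hh
  set g : ℝ → Y := Set.IccExtend hU (Set.domRestrict (Set.Icc 0 U) h) with hg
  have hgc : Continuous g := (continuousOn_iff_continuous_domRestrict.1 hh).Icc_extend'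
  have hgB (t) : ‖g t‖ ≤ B := hB _ (Set.projIcc 0 U hU t).2
  have hgh (t) (ht : t ∈ Set.Icc 0 U) : g t = h t := Set.IccExtend_of_mem hU _ ht
  let F : ℝ → ℝ → X := fun r => (Set.Iio r).indicator fun s => K s (g (r - s))
  have hF : Set.EqOn (duhamel K h) (fun r => ∫ s in (0 : ℝ)..U, F r s) (Set.Icc 0 U) := by
    intro r hr
    have h1 : duhamel K h r = ∫ s in (0 : ℝ)..r, K s (h (r - s)) := by
      have := intervalIntegral.integral_comp_sub_left (a := 0) (b := r)
        (fun q => K (r - q) (h q)) r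
      simp only [sub_sub_cancel, sub_self, sub_zero] at this
      exact this.symm
    have h2 : Set.Ioc 0 U ∩ Set.Iio r = Set.Ioo 0 r := by
      ext s
      simp only [Set.mem_inter_iff, Set.mem_Ioc, Set.mem_Iio, Set.mem_Ioo]
      exact ⟨fun h => ⟨h.1.1, h.2⟩, fun h => ⟨⟨h.1, h.2.le.trans hr.2⟩, h.2⟩⟩
    change _ = ∫ s in (0 : ℝ)..U, F r s
    rw [h1, intervalIntegral.integral_of_le hr.1, intervalIntegral.integral_of_le hU,
      integral_Ioc_eq_integral_Ioo, setIntegral_indicator measurableSet_Iio, h2]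
    refine setIntegral_congr_fun measurableSet_Ioo fun s hs => ?_
    rw [hgh _ ⟨sub_nonneg.2 hs.2.le, by linarith [hs.1, hr.2]⟩]
  refine ContinuousOn.congr (fun r₀ _ => ContinuousAt.continuousWithinAt ?_) hF
  have hC := H.C_nonneg
  have hB0 : 0 ≤ B := (norm_nonneg _).trans (hgB 0)
  refine intervalIntegral.continuousAt_of_dominated_interval (bound := fun s => C * s ^ (-θ) * B)
    (Eventually.of_forall fun r => ?_) (Eventually.of_forall fun r => ae_of_all _ fun s hs => ?_)
    ?_ ?_
  · refine AEStronglyMeasurable.indicator ?_ measurableSet_Iio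
    rw [Set.uIoc_of_le hU]
    refine ContinuousOn.aestronglyMeasurable (fun s hs => ?_) measurableSet_Ioc
    exact H.tendsto_kernel hs.1 continuousWithinAt_id
      ((hgc.comp (continuous_const.sub continuous_id)).continuousWithinAt)
  · rw [Set.uIoc_of_le hU] at hs
    have h3 : 0 ≤ s ^ (-θ) := Real.rpow_nonneg hs.1.le _
    refine (norm_indicator_le_norm_self _ _).trans ?_
    refine ((K s).le_of_opNorm_le (H.norm_kernel_le s hs.1) _).trans ?_
    have := hgB (r - s)
    gcongr
  · exact ((intervalIntegral.intervalIntegrable_rpow'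
      (by linarith [H.theta_lt_one])).const_mul C).mul_const B
  · have h4 : ∀ᵐ s : ℝ, s ≠ r₀ := by
      simp [ae_iff, measure_singleton]
    filter_upwards [h4] with s hs _
    rcases lt_or_gt_of_ne hs with hlt | hgt
    · have h5 : (fun r => K s (g (r - s))) =ᶠ[𝓝 r₀] fun r => F r s := by
        filter_upwards [lt_mem_nhds hlt] with r hr
        exact (Set.indicator_of_mem (s := Set.Iio r) hr fun s => K s (g (r - s))).symm
      refine ContinuousAt.congr ?_ h5
      exact ((K s).continuous.comp (hgc.comp (continuous_id.sub continuous_const))).continuousAt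
    · have h5 : (fun _ => (0 : X)) =ᶠ[𝓝 r₀] fun r => F r s := by
        filter_upwards [gt_mem_nhds hgt] with r hr
        exact (Set.indicator_of_notMem (s := Set.Iio r) (fun h => lt_asymm hr h)
          fun s => K s (g (r - s))).symm
      exact continuousAt_const.congr h5

end SmoothingPair

end

end CahnHilliard

namespace CahnHilliard

noncomputable section

/-! ### Mild solutions of semilinear equations -/

/-- A nonlinearity that is continuous in time and locally Lipschitz in space. -/
structure LocLip {X Y : Type*} [NormedAddCommGroup X] [NormedAddCommGroup Y] (N : ℝ → X → Y) :
    Prop where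
  continuousOn : ∀ x, ContinuousOn (fun q => N q x) (Set.Ici 0)
  exists_lip : ∀ U R : ℝ, ∃ L : ℝ, 0 ≤ L ∧ ∀ q ∈ Set.Icc 0 U, ∀ x x', ‖x‖ ≤ R → ‖x'‖ ≤ R →
    ‖N q x - N q x'‖ ≤ L * ‖x - x'‖

/-- A mild solution on `[0, T]` with initial value `x₀`. -/
structure IsMild {X Y : Type*} [NormedAddCommGroup X] [NormedSpace ℝ X]
    [NormedAddCommGroup Y] [NormedSpace ℝ Y] (P : ℝ → X →L[ℝ] X) (K : ℝ → Y →L[ℝ] X)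
    (N : ℝ → X → Y) (x₀ : X) (T : ℝ) (f : ℝ → X) : Prop where
  continuousOn : ContinuousOn f (Set.Icc 0 T)
  eq : ∀ r ∈ Set.Icc 0 T, f r = P r x₀ + duhamel K (fun q => N q (f q)) r

/-! ### Truncation by the radial retraction -/

open Classical in
/-- The radial retraction onto the ball of radius `R`. -/
def retract {X : Type*} [NormedAddCommGroup X] [NormedSpace ℝ X] (R : ℝ) (x : X) : X :=
  if ‖x‖ ≤ R then x else (R / ‖x‖) • x

section retract

variable {X : Type*} [NormedAddCommGroup X] [NormedSpace ℝ X] {R : ℝ}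

lemma retract_of_le {x : X} (h : ‖x‖ ≤ R) : retract R x = x := if_pos h

lemma retract_of_lt {x : X} (h : R < ‖x‖) : retract R x = (R / ‖x‖) • x := if_neg h.not_ge

lemma norm_retract_le (hR : 0 ≤ R) (x : X) : ‖retract R x‖ ≤ R := by
  rcases le_or_gt ‖x‖ R with h | h
  · rwa [retract_of_le h]
  · have h0 := hR.trans_lt h
    rw [retract_of_lt h, norm_smul, Real.norm_of_nonneg (by positivity), div_mul_cancel₀ _ h0.ne']

/-- In a general normed space the Hilbert space constant 1 is not available. The difference splits
into a multiple of x - y and a radial part, and the latter is at most ‖y‖ - ‖x‖ ≤ ‖x - y‖. -/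
lemma norm_retract_sub_le (hR : 0 ≤ R) (x y : X) :
    ‖retract R x - retract R y‖ ≤ 2 * ‖x - y‖ := by
  wlog hxy : ‖x‖ ≤ ‖y‖ generalizing x y
  · rw [norm_sub_rev, norm_sub_rev x y]
    exact this y x (le_of_not_ge hxy)
  rcases le_or_gt ‖y‖ R with h | h
  · rw [retract_of_le h, retract_of_le (hxy.trans h)]
    linarith [norm_nonneg (x - y)]
  have hy := hR.trans_lt h
  have ha1 : R / ‖y‖ ≤ 1 := (div_le_one hy).2 h.le
  have ha0 : 0 ≤ R / ‖y‖ := by positivity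
  have hR' : R = R / ‖y‖ * ‖y‖ := by field_simp
  have key (b : ℝ) (hb : R / ‖y‖ ≤ b) (hbx : b * ‖x‖ ≤ R)
      (hbR : (b - R / ‖y‖) * ‖x‖ ≤ ‖y‖ - ‖x‖) :
      ‖b • x - (R / ‖y‖) • y‖ ≤ 2 * ‖x - y‖ := by
    have h1 : b • x - (R / ‖y‖) • y = (R / ‖y‖) • (x - y) + (b - R / ‖y‖) • x := by module
    rw [h1]
    refine (norm_add_le _ _).trans ?_
    rw [norm_smul, norm_smul, Real.norm_of_nonneg ha0, Real.norm_of_nonneg (sub_nonneg.2 hb)]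
    have h2 := norm_sub_norm_le y x
    rw [norm_sub_rev] at h2
    have h3 : R / ‖y‖ * ‖x - y‖ ≤ ‖x - y‖ := mul_le_of_le_one_left (norm_nonneg _) ha1
    linarith
  rw [retract_of_lt h]
  rcases le_or_gt ‖x‖ R with h' | h'
  · rw [retract_of_le h']
    nth_rewrite 1 [← one_smul ℝ x]
    refine key 1 ha1 (by rwa [one_mul]) ?_
    nlinarith [norm_nonneg x]
  · rw [retract_of_lt h']
    have hx := hR.trans_lt h'
    have hR'' : R / ‖x‖ * ‖x‖ = R := by field_simp
    refine key _ (by gcongr) hR''.le ?_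
    rw [sub_mul, hR'']
    nlinarith

end retract

lemma LocLip.comp {X Y : Type*} [NormedAddCommGroup X] [NormedAddCommGroup Y] {N : ℝ → X → Y}
    (hN : LocLip N) {f : ℝ → X} {U : ℝ}
    (hf : ContinuousOn f (Set.Icc 0 U)) : ContinuousOn (fun q => N q (f q)) (Set.Icc 0 U) := by
  obtain ⟨R, hR⟩ := isCompact_Icc.exists_bound_of_continuousOn hf
  obtain ⟨L, hL0, hL⟩ := hN.exists_lip U R
  intro t ht
  have h1 : ContinuousWithinAt (fun q => N q (f t)) (Set.Icc 0 U) t :=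
    (hN.continuousOn (f t) t ht.1).mono fun q hq => hq.1
  have h2 : Tendsto (fun q => L * ‖f q - f t‖) (𝓝[Set.Icc 0 U] t) (𝓝 0) := by
    simpa using (tendsto_iff_norm_sub_tendsto_zero.1 (hf t ht)).const_mul L
  have h3 : Tendsto (fun q => N q (f q) - N q (f t)) (𝓝[Set.Icc 0 U] t) (𝓝 0) := by
    refine squeeze_zero_norm' ?_ h2
    filter_upwards [self_mem_nhdsWithin] with q hq
    exact hL q hq _ _ (hR q hq) (hR t ht)
  have h4 := h3.add h1
  simp only [sub_add_cancel, zero_add] at h4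
  exact h4

/-- The truncated nonlinearity is globally Lipschitz in space on bounded time intervals and equals
the original one inside the ball. -/
lemma LocLip.retract {X Y : Type*} [NormedAddCommGroup X] [NormedSpace ℝ X]
    [NormedAddCommGroup Y] {N : ℝ → X → Y} (hN : LocLip N) {R : ℝ} (hR : 0 ≤ R) (U : ℝ) :
    LocLip (fun q x => N q (retract R x)) ∧ ∃ L : ℝ, 0 ≤ L ∧ ∀ q ∈ Set.Icc 0 U, ∀ x x',
      ‖N q (CahnHilliard.retract R x) - N q (CahnHilliard.retract R x')‖ ≤ L * ‖x - x'‖ := by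
  have key (U) : ∃ L : ℝ, 0 ≤ L ∧ ∀ q ∈ Set.Icc 0 U, ∀ x x',
      ‖N q (CahnHilliard.retract R x) - N q (CahnHilliard.retract R x')‖ ≤ L * ‖x - x'‖ := by
    obtain ⟨L, hL0, hL⟩ := hN.exists_lip U R
    refine ⟨L * 2, by positivity, fun q hq x x' =>
      (hL q hq _ _ (norm_retract_le hR x) (norm_retract_le hR x')).trans ?_⟩
    rw [mul_assoc]
    gcongr
    exact norm_retract_sub_le hR x x'
  refine ⟨⟨fun x => hN.continuousOn _, fun U R => ?_⟩, key U⟩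
  obtain ⟨L, hL0, hL⟩ := key U
  exact ⟨L, hL0, fun q hq x x' _ _ => hL q hq x x'⟩

/-! ### Uniqueness, existence and continuation of mild solutions -/

section

variable {X Y : Type*} [NormedAddCommGroup X] [NormedSpace ℝ X]
  [NormedAddCommGroup Y] [NormedSpace ℝ Y] {P : ℝ → X →L[ℝ] X} {K : ℝ → Y →L[ℝ] X}
  {M C θ : ℝ} {N : ℝ → X → Y} {x₀ : X}

lemma duhamel_congr {h h' : ℝ → Y} {r : ℝ} (hr : 0 ≤ r) (H : Set.EqOn h h' (Set.Icc 0 r)) :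
    duhamel K h r = duhamel K h' r := by
  refine intervalIntegral.integral_congr fun q hq => ?_
  rw [Set.uIcc_of_le hr] at hq
  rw [H hq]

lemma SmoothingPair.duhamel_sub (H : SmoothingPair P K M C θ) {h h' : ℝ → Y} {r : ℝ} (hr : 0 ≤ r)
    (hh : ContinuousOn h (Set.Icc 0 r)) (hh' : ContinuousOn h' (Set.Icc 0 r)) :
    duhamel K (fun q => h q - h' q) r = duhamel K h r - duhamel K h' r := by
  simp only [duhamel, map_sub]
  exact intervalIntegral.integral_sub (H.intervalIntegrable_kernel hr hh)
    (H.intervalIntegrable_kernel hr hh')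

lemma IsMild.mono {T T' : ℝ} {f : ℝ → X} (h : IsMild P K N x₀ T f) (hT : T' ≤ T) :
    IsMild P K N x₀ T' f :=
  ⟨h.continuousOn.mono (Set.Icc_subset_Icc_right hT),
    fun r hr => h.eq r ⟨hr.1, hr.2.trans hT⟩⟩

lemma IsMild.congr {T : ℝ} {f g : ℝ → X} {N' : ℝ → X → Y} (h : IsMild P K N x₀ T f)
    (hfg : Set.EqOn g f (Set.Icc 0 T)) (hN : ∀ q ∈ Set.Icc 0 T, N' q (g q) = N q (f q)) :
    IsMild P K N' x₀ T g := by
  refine ⟨h.continuousOn.congr hfg, fun r hr => ?_⟩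
  rw [hfg hr, h.eq r hr, duhamel_congr hr.1 fun q hq => (hN q ⟨hq.1, hq.2.trans hr.2⟩).symm]

lemma IsMild.zero_apply (H : SmoothingPair P K M C θ) {T : ℝ} (hT : 0 ≤ T) {f : ℝ → X}
    (h : IsMild P K N x₀ T f) : f 0 = x₀ := by
  rw [h.eq 0 ⟨le_rfl, hT⟩, H.zero_apply, duhamel, intervalIntegral.integral_same, add_zero]

/-- Uniqueness of mild solutions. -/
lemma IsMild.unique (H : SmoothingPair P K M C θ) (hN : LocLip N) {T : ℝ} {f g : ℝ → X}
    (hf : IsMild P K N x₀ T f) (hg : IsMild P K N x₀ T g) : Set.EqOn f g (Set.Icc 0 T) := by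
  obtain ⟨R, hR⟩ := isCompact_Icc.exists_bound_of_continuousOn hf.continuousOn
  obtain ⟨R', hR'⟩ := isCompact_Icc.exists_bound_of_continuousOn hg.continuousOn
  obtain ⟨L, hL0, hL⟩ := hN.exists_lip T (max R R')
  obtain ⟨lam, -, -, hG⟩ := H.exists_gronwall hL0
  intro r hr
  have h1 := hG T 0 0 (fun q => f q - g q) (fun q => N q (f q) - N q (g q)) le_rfl le_rfl
    (hf.continuousOn.sub hg.continuousOn) (fun s hs => by
      have hss : Set.Icc 0 s ⊆ Set.Icc 0 T := Set.Icc_subset_Icc_right hs.2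
      rw [H.duhamel_sub hs.1 ((hN.comp hf.continuousOn).mono hss)
        ((hN.comp hg.continuousOn).mono hss), hf.eq s hs, hg.eq s hs, zero_add,
        add_sub_add_left_eq_sub])
    (fun q hq => by
      rw [add_zero]
      exact hL q hq _ _ ((hR q hq).trans (le_max_left _ _)) ((hR' q hq).trans (le_max_right _ _)))
    r hr
  rw [zero_mul, add_zero, mul_zero, zero_mul] at h1
  exact sub_eq_zero.1 (norm_le_zero_iff.1 h1)

/-- Existence for globally Lipschitz nonlinearities. -/
lemma SmoothingPair.exists_isMild [CompleteSpace X] (H : SmoothingPair P K M C θ) (hN : LocLip N)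
    {U L : ℝ} (hU : 0 ≤ U) (hL0 : 0 ≤ L)
    (hL : ∀ q ∈ Set.Icc 0 U, ∀ x x', ‖N q x - N q x'‖ ≤ L * ‖x - x'‖) (x₀ : X) :
    ∃ f, IsMild P K N x₀ U f := by
  obtain ⟨lam, hlam0, hlam, -⟩ := H.exists_gronwall hL0
  -- The unknown is g = e^{-λq}f. In the sup norm of g the map contracts by 1/2 on all of [0, U], so
  -- no short intervals have to be glued.
  let E : C(Set.Icc (0 : ℝ) U, X) → ℝ → X := fun g q => Real.exp (lam * q) • Set.IccExtend hU g q
  have hE (g) : Continuous (E g) :=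
    (by fun_prop : Continuous fun q : ℝ => Real.exp (lam * q)).smul g.continuous.Icc_extend'
  let G : C(Set.Icc (0 : ℝ) U, X) → ℝ → Y := fun g q => N q (E g q)
  have hG (g) : ContinuousOn (G g) (Set.Icc 0 U) := hN.comp (hE g).continuousOn
  have hΦc (g) : ContinuousOn
      (fun t => Real.exp (-(lam * t)) • (P t x₀ + duhamel K (G g) t)) (Set.Icc 0 U) :=
    ContinuousOn.smul (by fun_prop) (((H.continuousOn_apply x₀).mono fun _ h => h.1).add
      (H.continuousOn_duhamel (hG g)))
  let Φ : C(Set.Icc (0 : ℝ) U, X) → C(Set.Icc (0 : ℝ) U, X) := fun g =>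
    ⟨fun t => Real.exp (-(lam * t)) • (P t x₀ + duhamel K (G g) t),
      continuousOn_iff_continuous_domRestrict.1 (hΦc g)⟩
  have hΦ : ContractingWith (1 / 2) Φ := by
    refine ⟨by rw [← NNReal.coe_lt_coe]; norm_num, LipschitzWith.of_dist_le_mul fun g g' => ?_⟩
    rw [dist_eq_norm, dist_eq_norm]
    refine (ContinuousMap.norm_le _ (by positivity)).2 fun t => ?_
    have hss : Set.Icc 0 (t : ℝ) ⊆ Set.Icc 0 U := Set.Icc_subset_Icc_right t.2.2
    have h1 : (Φ g - Φ g') t =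
        Real.exp (-(lam * t)) • duhamel K (fun q => G g q - G g' q) (t : ℝ) := by
      rw [H.duhamel_sub t.2.1 ((hG g).mono hss) ((hG g').mono hss)]
      change Real.exp (-(lam * t)) • (P t x₀ + duhamel K (G g) t) -
        Real.exp (-(lam * t)) • (P t x₀ + duhamel K (G g') t) = _
      rw [← smul_sub, add_sub_add_left_eq_sub]
    have h2 := H.norm_duhamel_le (h := fun q => G g q - G g' q) (A := L * ‖g - g'‖) (B := 0)
      t.2.1 hlam0 (by positivity) (fun q hq => by
        have h3 : ‖E g q - E g' q‖ ≤ Real.exp (lam * q) * ‖g - g'‖ := by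
          change ‖Real.exp (lam * q) • Set.IccExtend hU g q -
            Real.exp (lam * q) • Set.IccExtend hU g' q‖ ≤ _
          rw [← smul_sub, norm_smul, Real.norm_of_nonneg (Real.exp_pos _).le]
          gcongr
          exact (g - g').norm_coe_le_norm (Set.projIcc 0 U hU q)
        have h4 := (hL q (hss hq) (E g q) (E g' q)).trans (mul_le_mul_of_nonneg_left h3 hL0)
        rw [add_zero]
        exact h4.trans (le_of_eq (by ring)))
    rw [h1, norm_smul, Real.norm_of_nonneg (Real.exp_pos _).le]
    have h5 : Real.exp (-(lam * t)) * Real.exp (lam * t) = 1 := by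
      rw [← Real.exp_add, neg_add_cancel, Real.exp_zero]
    calc _ ≤ Real.exp (-(lam * t)) * (L * ‖g - g'‖ * Real.exp (lam * t) *
            (C * ((1 / lam) ^ (1 - θ) * Real.Gamma (1 - θ)))) := by
          rw [zero_mul, add_zero] at h2
          gcongr
      _ = (Real.exp (-(lam * t)) * Real.exp (lam * t)) *
            (L * (C * ((1 / lam) ^ (1 - θ) * Real.Gamma (1 - θ)))) * ‖g - g'‖ := by ring
      _ ≤ 1 * (1 / 2) * ‖g - g'‖ := by rw [h5]; gcongr
      _ = _ := by simp
  obtain ⟨g, hg, -⟩ := hΦ.exists_fixedPoint 0 (edist_ne_top _ _)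
  refine ⟨E g, (hE g).continuousOn, fun r hr => ?_⟩
  have h6 : Set.IccExtend hU g r = Φ g ⟨r, hr⟩ := by
    rw [Set.IccExtend_of_mem hU _ hr, hg.eq]
  change Real.exp (lam * r) • Set.IccExtend hU g r = P r x₀ + duhamel K (G g) r
  rw [h6]
  change Real.exp (lam * r) • Real.exp (-(lam * r)) • (P r x₀ + duhamel K (G g) r) = _
  rw [smul_smul, ← Real.exp_add, add_neg_cancel, Real.exp_zero, one_smul]

/-- Mild solutions can be extended as long as they stay bounded. -/
lemma SmoothingPair.exists_extension [CompleteSpace X] (H : SmoothingPair P K M C θ)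
    (hN : LocLip N) {x₀ : X} {T R : ℝ} (hT : 0 ≤ T) (hx : ‖x₀‖ ≤ R)
    (h : ∀ T', 0 ≤ T' → T' < T → ∃ f, IsMild P K N x₀ T' f ∧ ∀ q ∈ Set.Icc 0 T', ‖f q‖ ≤ R) :
    ∃ T', T < T' ∧ ∃ f, IsMild P K N x₀ T' f := by
  have hR : 0 ≤ R := (norm_nonneg _).trans hx
  -- Solve the equation truncated at R + 1 beyond T. Before T its solution agrees with the given
  -- ones and stays below R; by continuity it stays below R + 1 for a little longer, where the
  -- truncation is inactive.
  obtain ⟨hN', L, hL0, hL⟩ := hN.retract (R := R + 1) (by linarith) (T + 1)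
  obtain ⟨g, hg⟩ := H.exists_isMild hN' (by linarith) hL0 hL x₀
  have h1 (q) (hq0 : 0 ≤ q) (hqT : q < T) : ‖g q‖ ≤ R := by
    obtain ⟨f, hf, hfR⟩ := h q hq0 hqT
    have hf' : IsMild P K (fun q x => N q (CahnHilliard.retract (R + 1) x)) x₀ q f :=
      hf.congr (fun _ _ => rfl) fun s hs => by
        rw [retract_of_le ((hfR s hs).trans (by linarith))]
    have hq : q ∈ Set.Icc 0 q := ⟨hq0, le_rfl⟩
    rw [(hg.mono (by linarith : q ≤ T + 1)).unique H hN' hf' hq]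
    exact hfR q hq
  have hgT : ‖g T‖ ≤ R := by
    rcases hT.eq_or_lt with rfl | hT'
    · rwa [hg.zero_apply H (by linarith)]
    · have hc : ContinuousWithinAt (fun q => ‖g q‖) (Set.Ioo 0 T) T :=
        ((hg.continuousOn T ⟨hT, by linarith⟩).mono fun q hq =>
          ⟨hq.1.le, by linarith [hq.2]⟩).norm
      have hcl : T ∈ closure (Set.Ioo 0 T) := by
        rw [closure_Ioo hT'.ne]; exact ⟨hT, le_rfl⟩
      have := mem_closure_iff_nhdsWithin_neBot.1 hcl
      refine le_of_tendsto hc ?_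
      filter_upwards [self_mem_nhdsWithin] with q hq
      exact h1 q hq.1.le hq.2
  have hev : ∀ᶠ q in 𝓝[Set.Icc 0 (T + 1)] T, ‖g q‖ < R + 1 :=
    (hg.continuousOn T ⟨hT, by linarith⟩).norm.eventually_lt_const (by linarith)
  obtain ⟨ε, hε, hεb⟩ := Metric.mem_nhdsWithin_iff.1 hev
  have hm : 0 < min (ε / 2) 1 := by positivity
  have hm1 : min (ε / 2) 1 ≤ 1 := min_le_right _ _
  have hm2 : min (ε / 2) 1 ≤ ε / 2 := min_le_left _ _
  refine ⟨T + min (ε / 2) 1, by linarith, g, (hg.mono (by linarith)).congr (fun _ _ => rfl)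
    fun q hq => ?_⟩
  rw [retract_of_le]
  rcases lt_or_ge q T with hqT | hqT
  · exact (h1 q hq.1 hqT).trans (by linarith)
  · refine le_of_lt (hεb ⟨?_, hq.1, by linarith [hq.2]⟩)
    rw [Metric.mem_ball, Real.dist_eq, abs_of_nonneg (sub_nonneg.2 hqT)]
    linarith [hq.2]

end

end

end CahnHilliard

namespace CahnHilliard

noncomputable section

/-! ### Maximal mild solutions -/

section

variable {X Y : Type*} [NormedAddCommGroup X] [NormedSpace ℝ X]
  [NormedAddCommGroup Y] [NormedSpace ℝ Y] {P : ℝ → X →L[ℝ] X} {K : ℝ → Y →L[ℝ] X}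
  {M C θ : ℝ} {N : ℝ → X → Y} {x₀ : X}

lemma LocLip.exists_bound {X Y : Type*} [NormedAddCommGroup X] [NormedAddCommGroup Y]
    {N : ℝ → X → Y} (hN : LocLip N) (U R : ℝ) :
    ∃ B : ℝ, 0 ≤ B ∧ ∀ q ∈ Set.Icc 0 U, ∀ x, ‖x‖ ≤ R → ‖N q x‖ ≤ B := by
  obtain ⟨L, hL0, hL⟩ := hN.exists_lip U R
  obtain ⟨B, hB⟩ := isCompact_Icc.exists_bound_of_continuousOn
    ((hN.continuousOn 0).mono (fun q (hq : q ∈ Set.Icc 0 U) => hq.1))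
  refine ⟨|B| + L * |R|, by positivity, fun q hq x hx => ?_⟩
  have h1 := hL q hq x 0 hx (by rw [norm_zero]; exact (norm_nonneg _).trans hx)
  rw [sub_zero] at h1
  have h2 := norm_add_le (N q x - N q 0) (N q 0)
  rw [sub_add_cancel] at h2
  have h3 := (hB q hq).trans (le_abs_self B)
  have h4 : L * ‖x‖ ≤ L * |R| := by
    gcongr
    exact hx.trans (le_abs_self R)
  linarith

/-- Duhamel integrals can be restarted. -/
lemma SmoothingPair.duhamel_restart [CompleteSpace X] (H : SmoothingPair P K M C θ) {h : ℝ → Y}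
    {s t : ℝ} (hs : 0 ≤ s) (hst : s ≤ t) (hh : ContinuousOn h (Set.Icc 0 t)) :
    duhamel K h t = P (t - s) (duhamel K h s) + duhamel K (fun q => h (s + q)) (t - s) := by
  have hint := H.intervalIntegrable_kernel (hs.trans hst) hh
  have h1 : P (t - s) (duhamel K h s) = ∫ q in (0 : ℝ)..s, K (t - q) (h q) := by
    rw [duhamel, ← ContinuousLinearMap.intervalIntegral_comp_comm _
      (H.intervalIntegrable_kernel hs (hh.mono (Set.Icc_subset_Icc_right hst))),
      intervalIntegral.integral_of_le hs, intervalIntegral.integral_of_le hs,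
      integral_Ioc_eq_integral_Ioo, integral_Ioc_eq_integral_Ioo]
    refine setIntegral_congr_fun measurableSet_Ioo fun q hq => ?_
    change P (t - s) (K (s - q) (h q)) = _
    rw [H.apply_kernel _ _ (sub_nonneg.2 hst) (sub_pos.2 hq.2), sub_add_sub_cancel]
  have h2 : duhamel K (fun q => h (s + q)) (t - s) = ∫ q in s..t, K (t - q) (h q) := by
    have := intervalIntegral.integral_comp_add_left (a := 0) (b := t - s)
      (fun q => K (t - q) (h q)) s
    rw [add_zero, add_sub_cancel] at this
    rw [← this, duhamel]
    congr 1
    funext q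
    rw [sub_sub]
  have hsub1 : Set.uIcc 0 s ⊆ Set.uIcc 0 t := by
    rw [Set.uIcc_of_le hs, Set.uIcc_of_le (hs.trans hst)]
    exact Set.Icc_subset_Icc_right hst
  have hsub2 : Set.uIcc s t ⊆ Set.uIcc 0 t := by
    rw [Set.uIcc_of_le hst, Set.uIcc_of_le (hs.trans hst)]
    exact Set.Icc_subset_Icc_left hs
  rw [h1, h2, duhamel, intervalIntegral.integral_add_adjacent_intervals
    (hint.mono_set hsub1) (hint.mono_set hsub2)]

/-- The norm of a solution cannot grow arbitrarily fast. -/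
lemma SmoothingPair.exists_delay [CompleteSpace X] (H : SmoothingPair P K M C θ) (hN : LocLip N)
    (U R : ℝ) : ∃ δ R' : ℝ, 0 < δ ∧ ∀ (T : ℝ) (f : ℝ → X), T ≤ U → IsMild P K N x₀ T f →
      ∀ s ∈ Set.Icc 0 T, ‖f s‖ ≤ R → ∀ t ∈ Set.Icc s T, t ≤ s + δ → ‖f t‖ ≤ R' := by
  have hC := H.C_nonneg
  have hM : 0 ≤ M := (norm_nonneg _).trans (H.norm_le 0)
  have hθ : 0 < 1 - θ := by linarith [H.theta_lt_one]
  -- R' exceeds both |R| and M|R| + 1/2, the largest value that the restarted equation permits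
  -- within time δ.
  set R' := (M + 1) * |R| + 1 with hR'
  obtain ⟨B, hB0, hB⟩ := hN.exists_bound U R'
  obtain ⟨δ, hδ1, hδ0⟩ : ∃ δ : ℝ, B * (C / (1 - θ) * δ ^ (1 - θ)) ≤ 1 / 2 ∧ 0 < δ := by
    have h1 : Tendsto (fun δ : ℝ => B * (C / (1 - θ) * δ ^ (1 - θ))) (𝓝[>] 0) (𝓝 0) := by
      have h2 : Continuous fun δ : ℝ => B * (C / (1 - θ) * δ ^ (1 - θ)) :=
        continuous_const.mul (continuous_const.mul (Real.continuous_rpow_const hθ.le))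
      exact (h2.tendsto' 0 0 (by rw [Real.zero_rpow hθ.ne']; ring)).mono_left nhdsWithin_le_nhds
    exact ((h1.eventually_le_const (by norm_num)).and self_mem_nhdsWithin).exists
  refine ⟨δ, R', hδ0, fun T f hTU hf s hs hfs t ht hts => ?_⟩
  by_contra! hcon
  have hcont : ContinuousOn (fun q => ‖f q‖) (Set.Icc s t) :=
    (hf.continuousOn.mono (Set.Icc_subset_Icc hs.1 ht.2)).norm
  have hcompact : IsCompact (Set.Icc s t ∩ (fun q => ‖f q‖) ⁻¹' Set.Ici R') :=
    isCompact_Icc.of_isClosed_subset (hcont.preimage_isClosed_of_isClosed isClosed_Icc isClosed_Ici)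
      Set.inter_subset_left
  -- u is the first time at which the norm reaches R'. Up to u the nonlinearity is bounded by B, and
  -- the equation restarted at s contradicts ‖f u‖ ≥ R'.
  obtain ⟨u, ⟨hu, huR⟩, hleast⟩ := hcompact.exists_isLeast ⟨t, ⟨ht.1, le_rfl⟩, hcon.le⟩
  have hlt (q) (hq : q ∈ Set.Ico s u) : ‖f q‖ < R' := by
    by_contra! hq'
    exact absurd (hleast ⟨⟨hq.1, hq.2.le.trans hu.2⟩, hq'⟩) hq.2.not_ge
  have hRabs : ‖f s‖ ≤ |R| := hfs.trans (le_abs_self R)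
  have hsu : s < u := by
    refine lt_of_le_of_ne hu.1 fun h => ?_
    have h3 : R' ≤ ‖f s‖ := h ▸ huR
    nlinarith [abs_nonneg R]
  have hfu : ‖f u‖ ≤ R' := by
    have hcl : u ∈ closure (Set.Ico s u) := by
      rw [closure_Ico hsu.ne]; exact ⟨hsu.le, le_rfl⟩
    have := mem_closure_iff_nhdsWithin_neBot.1 hcl
    have hc : ContinuousWithinAt (fun q => ‖f q‖) (Set.Ico s u) u :=
      (hcont u hu).mono fun q hq => ⟨hq.1, hq.2.le.trans hu.2⟩
    refine le_of_tendsto hc ?_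
    filter_upwards [self_mem_nhdsWithin] with q hq
    exact (hlt q hq).le
  have huT : u ∈ Set.Icc 0 T := ⟨hs.1.trans hu.1, hu.2.trans ht.2⟩
  have hNc := hN.comp hf.continuousOn
  have h4 : f u = P (u - s) (f s) + duhamel K (fun q => N (s + q) (f (s + q))) (u - s) := by
    rw [hf.eq u huT, hf.eq s hs, H.duhamel_restart hs.1 hu.1
      (hNc.mono (Set.Icc_subset_Icc_right huT.2)), map_add, H.add_apply _ _ (sub_nonneg.2 hu.1) hs.1,
      sub_add_cancel, add_assoc]
  have h5 := H.norm_duhamel_le_const (h := fun q => N (s + q) (f (s + q))) (B := B)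
    (sub_nonneg.2 hu.1) fun q hq => by
      refine hB _ ⟨add_nonneg hs.1 hq.1, by linarith [hq.2, huT.2]⟩ _ ?_
      rcases (show s + q ≤ u by linarith [hq.2]).lt_or_eq with h | h
      · exact (hlt _ ⟨by linarith [hq.1], h⟩).le
      · rwa [h]
  have h6 : (u - s) ^ (1 - θ) ≤ δ ^ (1 - θ) :=
    Real.rpow_le_rpow (sub_nonneg.2 hu.1) (by linarith [hu.2]) hθ.le
  have h7 : B * (C / (1 - θ) * (u - s) ^ (1 - θ)) ≤ 1 / 2 := by
    refine le_trans ?_ hδ1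
    gcongr
  have h8 := (P (u - s)).le_of_opNorm_le (H.norm_le _) (f s)
  have h9 := norm_add_le (P (u - s) (f s)) (duhamel K (fun q => N (s + q) (f (s + q))) (u - s))
  rw [← h4] at h9
  have h10 : M * ‖f s‖ ≤ M * |R| := by gcongr
  have h11 : R' ≤ ‖f u‖ := huR
  linarith [abs_nonneg R]

/-- Existence of a maximal mild solution, which blows up if its lifetime is finite. -/
theorem SmoothingPair.exists_maximal [CompleteSpace X] (H : SmoothingPair P K M C θ)
    (hN : LocLip N) (x₀ : X) : ∃ (β : ℝ≥0∞) (f : ℝ → X), 0 < β ∧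
      (∀ T, 0 ≤ T → ENNReal.ofReal T < β → IsMild P K N x₀ T f) ∧
      (β ≠ ⊤ → Tendsto (fun q => ‖f q‖) (𝓝[<] β.toReal) atTop) := by
  set S : Set ℝ := {T | 0 ≤ T ∧ ∃ f, IsMild P K N x₀ T f} with hS
  set β : ℝ≥0∞ := ⨆ T ∈ S, ENNReal.ofReal T with hβ
  have hle {T : ℝ} (hT : T ∈ S) : ENNReal.ofReal T ≤ β := le_iSup₂_of_le T hT le_rfl
  have hmem (T : ℝ) (hT : 0 ≤ T) (hTβ : ENNReal.ofReal T < β) : ∃ f, IsMild P K N x₀ T f := by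
    obtain ⟨T', h1⟩ := lt_iSup_iff.1 hTβ
    obtain ⟨⟨-, f, hf⟩, h2⟩ := lt_iSup_iff.1 h1
    exact ⟨f, hf.mono (ENNReal.ofReal_lt_ofReal_iff'.1 h2).1.le⟩
  choose! F hF using hmem
  -- F t is some solution on [0, t]; by uniqueness they are all restrictions of the diagonal
  -- function.
  have hsol (T : ℝ) (hT : 0 ≤ T) (hTβ : ENNReal.ofReal T < β) :
      IsMild P K N x₀ T fun t => F t t := by
    have heq : Set.EqOn (fun t => F t t) (F T) (Set.Icc 0 T) := fun t ht => by
      have h1 := hF t ht.1 ((ENNReal.ofReal_le_ofReal ht.2).trans_lt hTβ)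
      exact h1.unique H hN ((hF T hT hTβ).mono ht.2) ⟨ht.1, le_rfl⟩
    exact (hF T hT hTβ).congr heq fun q hq => by rw [← heq hq]
  -- For T = 0 the boundedness hypothesis of `exists_extension` is vacuous, so it yields local
  -- existence.
  have hβ0 : 0 < β := by
    obtain ⟨T, hT, hf⟩ := H.exists_extension hN (x₀ := x₀) le_rfl le_rfl
      fun T' h h' => absurd h h'.not_ge
    exact (ENNReal.ofReal_pos.2 hT).trans_le (hle ⟨hT.le, hf⟩)
  refine ⟨β, fun t => F t t, hβ0, hsol, fun htop => ?_⟩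
  set b := β.toReal with hb
  have hbβ : ENNReal.ofReal b = β := ENNReal.ofReal_toReal htop
  have hb0 : 0 < b := ENNReal.toReal_pos hβ0.ne' htop
  have hlt {T : ℝ} (hT : T < b) : ENNReal.ofReal T < β := by
    rw [← hbβ]; exact (ENNReal.ofReal_lt_ofReal_iff hb0).2 hT
  -- Otherwise the norm is below some R at times arbitrarily close to b. From such a time, less than
  -- δ before b, `exists_delay` bounds the solution up to b, and `exists_extension` continues it
  -- past b.
  by_contra hcon
  rw [tendsto_atTop] at hcon
  push Not at hcon
  obtain ⟨R, hR⟩ := hcon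
  obtain ⟨δ, R', hδ, hdelay⟩ := H.exists_delay (x₀ := x₀) hN b R
  have hnear : ∀ᶠ s in 𝓝[<] b, s ∈ Set.Ioo (max 0 (b - δ)) b :=
    Ioo_mem_nhdsLT (max_lt hb0 (by linarith))
  obtain ⟨s, hsR, hs⟩ := (hR.and_eventually hnear).exists
  have hs0 : 0 ≤ s := (le_max_left _ _).trans hs.1.le
  have hsδ : b - δ < s := (le_max_right _ _).trans_lt hs.1
  obtain ⟨R'', hR''⟩ := isCompact_Icc.exists_bound_of_continuousOn
    (hsol s hs0 (hlt hs.2)).continuousOn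
  have hbound (t : ℝ) (ht0 : 0 ≤ t) (htb : t < b) : ‖F t t‖ ≤ max R' R'' := by
    rcases le_total t s with h | h
    · exact (hR'' t ⟨ht0, h⟩).trans (le_max_right _ _)
    · exact (hdelay t _ htb.le (hsol t ht0 (hlt htb)) s ⟨hs0, h⟩ (le_of_lt (by simpa using hsR)) t
        ⟨h, le_rfl⟩ (by linarith)).trans (le_max_left _ _)
  have hx : ‖x₀‖ ≤ max R' R'' := by
    rw [← (hsol 0 le_rfl (hlt hb0)).zero_apply H le_rfl]
    exact hbound 0 le_rfl hb0
  obtain ⟨T, hT, hf⟩ := H.exists_extension hN hb0.le hx fun T' h0 h1 =>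
    ⟨_, hsol T' h0 (hlt h1), fun q hq => hbound q hq.1 (hq.2.trans_lt h1)⟩
  have h3 := hle ⟨hb0.le.trans hT.le, hf⟩
  rw [← hbβ] at h3
  exact absurd ((ENNReal.ofReal_le_ofReal_iff hb0.le).1 h3) hT.not_ge

end

end

end CahnHilliard

namespace CahnHilliard

noncomputable section

/-! ### Stability of mild solutions -/

lemma self_le_max_rpow (p : ℝ) {r U : ℝ} (h : r ≤ U) : r ≤ max U (U ^ p) :=
  h.trans (le_max_left _ _)

lemma max_rpow_mono {p : ℝ} (hp : 0 ≤ p) {r U : ℝ} (hr : 0 ≤ r) (h : r ≤ U) :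
    max r (r ^ p) ≤ max U (U ^ p) :=
  max_le_max h (Real.rpow_le_rpow hr h hp)

/-- On a fixed time interval, the difference of the nonlinear terms is controlled. -/
lemma exists_norm_nonlin_sub_le {X Y : Type*} [NormedAddCommGroup X] [NormedAddCommGroup Y]
    {N₁ N₂ : ℝ → X → Y} (hN₂ : LocLip N₂) {A : ℝ → ℝ → ℝ} {Q : ℝ}
    (hNA : ∀ σ U, 0 ≤ σ → ∀ q ∈ Set.Icc 0 U, ∀ x : X, ‖x‖ ≤ σ →
      ‖N₂ q x - N₁ q x‖ ≤ Q * A σ U)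
    {V : ℝ} {F₁ F₂ : ℝ → X} (h₁ : ContinuousOn F₁ (Set.Icc 0 V))
    (h₂ : ContinuousOn F₂ (Set.Icc 0 V)) :
    ∃ L S : ℝ, 0 ≤ L ∧ 0 ≤ S ∧ (∀ q ∈ Set.Icc 0 V, ‖F₂ q - F₁ q‖ ≤ S) ∧
      ∀ U ≤ V, ∀ σ, 0 ≤ σ → (∀ q ∈ Set.Icc 0 U, ‖F₁ q‖ ≤ σ) →
        ∀ q ∈ Set.Icc 0 U, ‖N₂ q (F₂ q) - N₁ q (F₁ q)‖ ≤ L * ‖F₂ q - F₁ q‖ + Q * A σ U := by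
  -- The Lipschitz constant is taken on balls containing the two given solutions on [0, V], so it
  -- depends on neither σ nor U.
  obtain ⟨R, hR⟩ := isCompact_Icc.exists_bound_of_continuousOn h₁
  obtain ⟨R', hR'⟩ := isCompact_Icc.exists_bound_of_continuousOn h₂
  obtain ⟨L, hL0, hL⟩ := hN₂.exists_lip V (max R R')
  refine ⟨L, |R'| + |R|, hL0, by positivity, fun q hq => ?_, fun U hU σ hσ hF q hq => ?_⟩
  · exact (norm_sub_le _ _).trans (add_le_add ((hR' q hq).trans (le_abs_self _))
      ((hR q hq).trans (le_abs_self _)))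
  · have hq' : q ∈ Set.Icc 0 V := ⟨hq.1, hq.2.trans hU⟩
    rw [← sub_add_sub_cancel (N₂ q (F₂ q)) (N₂ q (F₁ q))]
    exact (norm_add_le _ _).trans (add_le_add
      (hL q hq' _ _ ((hR' q hq').trans (le_max_right _ _)) ((hR q hq').trans (le_max_left _ _)))
      (hNA σ U hσ q hq _ (hF q hq)))

section

variable {X Y : Type*} [NormedAddCommGroup X] [NormedSpace ℝ X]
  [NormedAddCommGroup Y] [NormedSpace ℝ Y] {P : ℝ → X →L[ℝ] X} {K : ℝ → Y →L[ℝ] X}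
  {M C θ : ℝ} {N₁ N₂ : ℝ → X → Y} {x₁ x₂ : X}

lemma IsMild.sub_eq (H : SmoothingPair P K M C θ) (hN₁ : LocLip N₁) (hN₂ : LocLip N₂)
    {T : ℝ} {F₁ F₂ : ℝ → X} (h₁ : IsMild P K N₁ x₁ T F₁) (h₂ : IsMild P K N₂ x₂ T F₂) {r : ℝ}
    (hr : r ∈ Set.Icc 0 T) : F₂ r - F₁ r =
      P r (x₂ - x₁) + duhamel K (fun q => N₂ q (F₂ q) - N₁ q (F₁ q)) r := by
  have hss : Set.Icc 0 r ⊆ Set.Icc 0 T := Set.Icc_subset_Icc_right hr.2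
  rw [H.duhamel_sub hr.1 ((hN₂.comp h₂.continuousOn).mono hss)
    ((hN₁.comp h₁.continuousOn).mono hss), h₁.eq r hr, h₂.eq r hr, map_sub]
  abel

/-- Stability, if the initial values agree. -/
lemma exists_stability_same (H : SmoothingPair P K M C θ) (hN₁ : LocLip N₁) (hN₂ : LocLip N₂)
    {A : ℝ → ℝ → ℝ} {Q : ℝ} (hQ : 0 ≤ Q) (hA : ∀ σ U, 0 ≤ σ → 0 ≤ A σ U)
    (hNA : ∀ σ U, 0 ≤ σ → ∀ q ∈ Set.Icc 0 U, ∀ x : X, ‖x‖ ≤ σ →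
      ‖N₂ q x - N₁ q x‖ ≤ Q * A σ U)
    {V : ℝ} {F₁ F₂ : ℝ → X} (h₁ : IsMild P K N₁ x₁ V F₁)
    (h₂ : IsMild P K N₂ x₁ V F₂) :
    ∃ c : ℝ, 0 ≤ c ∧ ∀ U ≤ V, ∀ σ, 0 ≤ σ → (∀ q ∈ Set.Icc 0 U, ‖F₁ q‖ ≤ σ) →
      ∀ r ∈ Set.Icc 0 U, ‖F₂ r - F₁ r‖ ≤ c * max U (U ^ (1 - θ)) * A σ U := by
  obtain ⟨L, S, hL0, hS0, hS, hL⟩ := exists_norm_nonlin_sub_le hN₂ hNA h₁.continuousOn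
    h₂.continuousOn
  obtain ⟨lam, hlam0, -, hG⟩ := H.exists_gronwall hL0
  have hC := H.C_nonneg
  have hθ : 0 < 1 - θ := by linarith [H.theta_lt_one]
  refine ⟨2 * (Q * (C / (1 - θ))) * Real.exp (lam * V), by positivity,
    fun U hU σ hσ hF r hr => ?_⟩
  have hU0 := hr.1.trans hr.2
  have hAU := hA σ U hσ
  have h1 := hG U 0 (Q * A σ U) (fun q => F₂ q - F₁ q) (fun q => N₂ q (F₂ q) - N₁ q (F₁ q)) le_rfl
    (by positivity) ((h₂.mono hU).continuousOn.sub (h₁.mono hU).continuousOn)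
    (fun s hs => by
      rw [IsMild.sub_eq H hN₁ hN₂ (h₁.mono hU) (h₂.mono hU) hs, sub_self, map_zero, zero_add,
        zero_add])
    (hL U hU σ hσ hF) r hr
  refine h1.trans ?_
  have h2 : U ^ (1 - θ) ≤ max U (U ^ (1 - θ)) := le_max_right _ _
  have h3 : 0 ≤ U ^ (1 - θ) := Real.rpow_nonneg hU0 _
  rw [zero_add]
  calc 2 * (Q * A σ U * (C / (1 - θ) * U ^ (1 - θ))) * Real.exp (lam * U)
      ≤ 2 * (Q * A σ U * (C / (1 - θ) * max U (U ^ (1 - θ)))) * Real.exp (lam * V) := by gcongr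
    _ = _ := by ring

/-- Stability on short time intervals, if the initial values differ. -/
lemma exists_stability_ne (H : SmoothingPair P K M C θ) (hN₁ : LocLip N₁) (hN₂ : LocLip N₂)
    {A : ℝ → ℝ → ℝ} {Q : ℝ} (hQ : 0 ≤ Q) (hA : ∀ σ U, 0 ≤ σ → 0 ≤ A σ U)
    (hNA : ∀ σ U, 0 ≤ σ → ∀ q ∈ Set.Icc 0 U, ∀ x : X, ‖x‖ ≤ σ →
      ‖N₂ q x - N₁ q x‖ ≤ Q * A σ U)
    {B : ℝ} (hB0 : 0 ≤ B) (hB : ∀ r, 0 ≤ r → ‖P r (x₂ - x₁)‖ ≤ (1 + B * r) * ‖x₂ - x₁‖)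
    (hx : 0 < ‖x₂ - x₁‖)
    {V : ℝ} {F₁ F₂ : ℝ → X} (h₁ : IsMild P K N₁ x₁ V F₁)
    (h₂ : IsMild P K N₂ x₂ V F₂) :
    ∃ c : ℝ, 0 ≤ c ∧ ∀ U ≤ V, ∀ σ, 0 ≤ σ → (∀ q ∈ Set.Icc 0 U, ‖F₁ q‖ ≤ σ) →
      ∀ r ∈ Set.Icc 0 U, ‖F₂ r - F₁ r‖ ≤ ‖x₂ - x₁‖ * (1 + c * max U (U ^ (1 - θ))) +
        c * max U (U ^ (1 - θ)) * A σ U := by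
  obtain ⟨L, S, hL0, hS0, hS, hL⟩ := exists_norm_nonlin_sub_le hN₂ hNA h₁.continuousOn
    h₂.continuousOn
  have hC := H.C_nonneg
  have hθ : 0 < 1 - θ := by linarith [H.theta_lt_one]
  set D := ‖x₂ - x₁‖ with hD
  set C' := C / (1 - θ) with hC'
  have hC'0 : 0 ≤ C' := by positivity
  -- Gronwall would spoil the coefficient 1 of D. Instead the difference inside the integral is
  -- bounded crudely by S, and since D > 0 the result is charged to the term D·c·m.
  refine ⟨B + L * S * C' / D + Q * C', by positivity, fun U hU σ hσ hF r hr => ?_⟩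
  have hAU := hA σ U hσ
  have h1 := H.norm_duhamel_le_const (h := fun q => N₂ q (F₂ q) - N₁ q (F₁ q))
    (B := L * S + Q * A σ U) hr.1 fun q hq => by
      have hq' : q ∈ Set.Icc 0 U := ⟨hq.1, hq.2.trans hr.2⟩
      refine (hL U hU σ hσ hF q hq').trans ?_
      have := hS q ⟨hq.1, hq'.2.trans hU⟩
      gcongr
  set m := max U (U ^ (1 - θ)) with hm
  have hrm : r ≤ m := self_le_max_rpow _ hr.2
  have hm0 : 0 ≤ m := hr.1.trans hrm
  have hrm' : r ^ (1 - θ) ≤ m := (Real.rpow_le_rpow hr.1 hr.2 hθ.le).trans (le_max_right _ _)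
  rw [IsMild.sub_eq H hN₁ hN₂ (h₁.mono hU) (h₂.mono hU) hr]
  calc ‖P r (x₂ - x₁) + duhamel K (fun q => N₂ q (F₂ q) - N₁ q (F₁ q)) r‖
      ≤ (1 + B * r) * D + (L * S + Q * A σ U) * (C' * r ^ (1 - θ)) :=
        (norm_add_le _ _).trans (add_le_add (hB r hr.1) h1)
    _ ≤ (1 + B * m) * D + (L * S + Q * A σ U) * (C' * m) := by gcongr
    _ = D * (1 + (B + L * S * C' / D) * m) + Q * C' * m * A σ U := by field_simp; ring
    _ ≤ D * (1 + (B + L * S * C' / D + Q * C') * m) +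
          (B + L * S * C' / D + Q * C') * m * A σ U := by
        have h4 : 0 ≤ L * S * C' / D := by positivity
        have h5 : 0 ≤ Q * C' := by positivity
        have h6 : B + L * S * C' / D ≤ B + L * S * C' / D + Q * C' := by linarith
        have h7 : Q * C' ≤ B + L * S * C' / D + Q * C' := by linarith
        exact add_le_add (by gcongr) (by gcongr)

/-- Stability of mild solutions. -/
theorem exists_stability (H : SmoothingPair P K M C θ) (hN₁ : LocLip N₁) (hN₂ : LocLip N₂)
    {a b e : ℝ → ℝ} {Q : ℝ} (hQ : 0 ≤ Q) (ha : ∀ U, 0 ≤ a U) (hb : ∀ U, 0 ≤ b U)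
    (he : ∀ U, 0 ≤ e U) (ha' : Monotone a) (hb' : Monotone b) (he' : Monotone e)
    (hNA : ∀ σ U, 0 ≤ σ → ∀ q ∈ Set.Icc 0 U, ∀ x : X, ‖x‖ ≤ σ →
      ‖N₂ q x - N₁ q x‖ ≤ Q * ((σ ^ 2 + 1) * a U + σ * b U + e U))
    {B : ℝ} (hB0 : 0 ≤ B) (hB : ∀ r, 0 ≤ r → ‖P r (x₂ - x₁)‖ ≤ (1 + B * r) * ‖x₂ - x₁‖)
    {β : ℝ≥0∞} (hβ : 0 < β) {F₁ F₂ : ℝ → X}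
    (h₁ : ∀ T, 0 ≤ T → ENNReal.ofReal T < β → IsMild P K N₁ x₁ T F₁)
    (h₂ : ∀ T, 0 ≤ T → ENNReal.ofReal T < β → IsMild P K N₂ x₂ T F₂) :
    ∃ c : ℝ, 0 < c ∧ ∀ σ U : ℝ, 0 ≤ σ → 0 ≤ U → ENNReal.ofReal U < β →
      (∀ q ∈ Set.Icc 0 U, ‖F₁ q‖ ≤ σ) → (∀ q ∈ Set.Icc 0 U, ‖F₂ q‖ ≤ σ) →
      ∀ r ∈ Set.Icc 0 U, ‖F₂ r - F₁ r‖ ≤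
        (‖x₂ - x₁‖ + c * max U (U ^ (1 - θ)) * ((σ ^ 2 + 1) * a U + σ * b U + e U)) *
          Real.exp (c * max U (U ^ (1 - θ)) * (2 * σ ^ 2 + 1)) := by
  have hθ : 0 < 1 - θ := by linarith [H.theta_lt_one]
  set A : ℝ → ℝ → ℝ := fun σ U => (σ ^ 2 + 1) * a U + σ * b U + e U with hAdef
  have hA (σ U : ℝ) (hσ : 0 ≤ σ) : 0 ≤ A σ U := by
    have := ha U
    have := hb U
    have := he U
    simp only [hAdef]
    positivity
  have hm0 {U : ℝ} (hU : 0 ≤ U) : 0 ≤ max U (U ^ (1 - θ)) := hU.trans (le_max_left _ _)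
  have hw {U σ : ℝ} {r : ℝ} (hF₁ : ∀ q ∈ Set.Icc 0 U, ‖F₁ q‖ ≤ σ)
      (hF₂ : ∀ q ∈ Set.Icc 0 U, ‖F₂ q‖ ≤ σ) (hr : r ∈ Set.Icc 0 U) : ‖F₂ r - F₁ r‖ ≤ 2 * σ :=
    (norm_sub_le _ _).trans (by linarith [hF₁ r hr, hF₂ r hr])
  have hexp (c U σ : ℝ) (hc : 0 ≤ c) (hU : 0 ≤ U) :
      1 + c * max U (U ^ (1 - θ)) * (2 * σ ^ 2 + 1) ≤
        Real.exp (c * max U (U ^ (1 - θ)) * (2 * σ ^ 2 + 1)) := by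
    linarith [Real.add_one_le_exp (c * max U (U ^ (1 - θ)) * (2 * σ ^ 2 + 1))]
  rcases (norm_nonneg (x₂ - x₁)).eq_or_lt with hD | hD
  · have hx : x₂ = x₁ := sub_eq_zero.1 (norm_eq_zero.1 hD.symm)
    subst hx
    by_cases hV : ∃ V, 0 < V ∧ ENNReal.ofReal V < β ∧ 0 < a V + b V + e V
    · obtain ⟨V, hV0, hVβ, hs⟩ := hV
      obtain ⟨c, hc0, hc⟩ := exists_stability_same H hN₁ hN₂ hQ hA hNA (h₁ V hV0.le hVβ)
        (h₂ V hV0.le hVβ)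
      set s := a V + b V + e V with hsdef
      set mV := max V (V ^ (1 - θ)) with hmV
      have hmV0 : 0 < mV := hV0.trans_le (le_max_left _ _)
      -- The two extra terms are for U ≥ V, where they give c'm_U s ≥ 2 and c'm_U ≥ 1. There 2σ =
      -- 2·min(1,σ)·max(1,σ): the minimum times s is at most A σ U, and the maximum is at most the
      -- exponential.
      refine ⟨c + 2 / (s * mV) + 1 / mV, by positivity, fun σ U hσ hU hUβ hF₁ hF₂ r hr => ?_⟩
      set c' := c + 2 / (s * mV) + 1 / mV with hc'
      have hc'0 : 0 ≤ c' := by positivity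
      have hAU := hA σ U hσ
      have hmU := hm0 hU
      rw [← hD, zero_add]
      rcases le_total U V with hUV | hUV
      · have hcc : c ≤ c' := by
          have : 0 ≤ 2 / (s * mV) := by positivity
          have : 0 ≤ 1 / mV := by positivity
          linarith
        have h3 : 1 ≤ Real.exp (c' * max U (U ^ (1 - θ)) * (2 * σ ^ 2 + 1)) :=
          Real.one_le_exp (by positivity)
        calc _ ≤ c * max U (U ^ (1 - θ)) * A σ U := hc U hUV σ hσ hF₁ r hr
          _ ≤ c' * max U (U ^ (1 - θ)) * A σ U * 1 := by rw [mul_one]; gcongr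
          _ ≤ _ := by gcongr
      · have hmm : mV ≤ max U (U ^ (1 - θ)) := max_rpow_mono hθ.le hV0.le hUV
        have h4 : 2 ≤ c' * max U (U ^ (1 - θ)) * s := by
          have h5 : 2 / (s * mV) ≤ c' := by
            have : 0 ≤ 1 / mV := by positivity
            linarith
          rw [div_le_iff₀ (by positivity)] at h5
          calc (2 : ℝ) ≤ c' * (s * mV) := h5
            _ ≤ c' * (s * max U (U ^ (1 - θ))) := by gcongr
            _ = _ := by ring
        have h6 : 1 ≤ c' * max U (U ^ (1 - θ)) := by
          have h5 : 1 / mV ≤ c' := by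
            have : 0 ≤ 2 / (s * mV) := by positivity
            linarith
          rw [div_le_iff₀ (by positivity)] at h5
          exact h5.trans (by gcongr)
        have h7 : max 1 σ ≤ Real.exp (c' * max U (U ^ (1 - θ)) * (2 * σ ^ 2 + 1)) := by
          refine le_trans ?_ (hexp c' U σ hc'0 hU)
          have h8 : 1 * (2 * σ ^ 2 + 1) ≤ c' * max U (U ^ (1 - θ)) * (2 * σ ^ 2 + 1) := by
            gcongr
          refine max_le ?_ ?_ <;> nlinarith [sq_nonneg (σ - 1)]
        have h9 : min 1 σ * s ≤ A σ U := by
          have h10 : min 1 σ ≤ 1 := min_le_left _ _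
          have h11 : min 1 σ ≤ σ := min_le_right _ _
          have h12 := ha' hUV
          have h13 := hb' hUV
          have h14 := he' hUV
          have h15 : 0 ≤ min 1 σ := le_min zero_le_one hσ
          have k1 : min 1 σ * a V ≤ (σ ^ 2 + 1) * a U :=
            mul_le_mul (h10.trans (by nlinarith [sq_nonneg σ])) h12 (ha V) (by positivity)
          have k2 : min 1 σ * b V ≤ σ * b U := mul_le_mul h11 h13 (hb V) hσ
          have k3 : min 1 σ * e V ≤ 1 * e U := mul_le_mul h10 h14 (he V) zero_le_one
          simp only [hAdef, hsdef]
          linarith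
        have h16 : min 1 σ * max 1 σ = σ := by rw [min_mul_max, one_mul]
        have h15 : 0 ≤ min 1 σ := le_min zero_le_one hσ
        calc ‖F₂ r - F₁ r‖ ≤ 2 * σ := hw hF₁ hF₂ hr
          _ = 2 * min 1 σ * max 1 σ := by rw [mul_assoc, h16]
          _ ≤ c' * max U (U ^ (1 - θ)) * s * min 1 σ * max 1 σ := by gcongr
          _ = c' * max U (U ^ (1 - θ)) * (min 1 σ * s) * max 1 σ := by ring
          _ ≤ _ := by gcongr
    -- All coefficient differences vanish during the lifetime, so the short-time estimate, used on
    -- all of [0, U], says that the solutions coincide.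
    · push Not at hV
      obtain ⟨W, hW0, hWβ⟩ : ∃ W : ℝ, 0 < W ∧ ENNReal.ofReal W < β := by
        obtain ⟨W, hW0, hW, hWβ⟩ := ENNReal.lt_iff_exists_real_btwn.1 hβ
        exact ⟨W, ENNReal.ofReal_pos.1 hW, hWβ⟩
      refine ⟨1, one_pos, fun σ U hσ hU hUβ hF₁ hF₂ r hr => ?_⟩
      obtain ⟨c, hc0, hc⟩ := exists_stability_same H hN₁ hN₂ hQ hA hNA (h₁ U hU hUβ)
        (h₂ U hU hUβ)
      have hsum : a U + b U + e U ≤ 0 := by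
        rcases hU.eq_or_lt with rfl | hU'
        · have := hV W hW0 hWβ
          have := ha' hW0.le
          have := hb' hW0.le
          have := he' hW0.le
          linarith
        · exact hV U hU' hUβ
      have ha0 : a U = 0 := by linarith [ha U, hb U, he U]
      have hb0 : b U = 0 := by linarith [ha U, hb U, he U]
      have he0 : e U = 0 := by linarith [ha U, hb U, he U]
      have h3 := hc U le_rfl σ hσ hF₁ r hr
      simp only [hAdef, ha0, hb0, he0, mul_zero, add_zero] at h3
      refine h3.trans ?_
      simp only [ha0, hb0, he0, mul_zero, add_zero]
      positivity
  · obtain ⟨V, hV0', hV, hVβ⟩ := ENNReal.lt_iff_exists_real_btwn.1 hβ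
    have hV0 : 0 < V := ENNReal.ofReal_pos.1 hV
    obtain ⟨c, hc0, hc⟩ := exists_stability_ne H hN₁ hN₂ hQ hA hNA hB0 hB hD (h₁ V hV0' hVβ)
      (h₂ V hV0' hVβ)
    set D := ‖x₂ - x₁‖ with hDdef
    set mV := max V (V ^ (1 - θ)) with hmV
    have hmV0 : 0 < mV := hV0.trans_le (le_max_left _ _)
    -- The extra term gives D c'm_U ≥ 1 for U ≥ V. Then the initial difference times the exponential
    -- already exceeds 2σ² + 1 ≥ 2σ.
    refine ⟨c + 1 / (D * mV), by positivity, fun σ U hσ hU hUβ hF₁ hF₂ r hr => ?_⟩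
    set c' := c + 1 / (D * mV) with hc'
    have hc'0 : 0 ≤ c' := by positivity
    have hAU := hA σ U hσ
    have hmU := hm0 hU
    have h3 := hexp c' U σ hc'0 hU
    set E := Real.exp (c' * max U (U ^ (1 - θ)) * (2 * σ ^ 2 + 1)) with hE
    have hcA : 0 ≤ c' * max U (U ^ (1 - θ)) * A σ U := by positivity
    have hE1 : 1 ≤ E := Real.one_le_exp (by positivity)
    change _ ≤ (D + c' * max U (U ^ (1 - θ)) * A σ U) * E
    rcases le_total U V with hUV | hUV
    · have hcc : c ≤ c' := le_add_of_nonneg_right (by positivity)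
      have h4 : 1 + c' * max U (U ^ (1 - θ)) ≤ E := by
        refine le_trans ?_ h3
        have h5 : 0 ≤ c' * max U (U ^ (1 - θ)) := by positivity
        nlinarith [mul_nonneg h5 (sq_nonneg σ)]
      calc _ ≤ D * (1 + c * max U (U ^ (1 - θ))) + c * max U (U ^ (1 - θ)) * A σ U :=
            hc U hUV σ hσ hF₁ r hr
        _ ≤ D * (1 + c' * max U (U ^ (1 - θ))) + c' * max U (U ^ (1 - θ)) * A σ U := by gcongr
        _ ≤ D * E + c' * max U (U ^ (1 - θ)) * A σ U * E :=
            add_le_add (by gcongr) (le_mul_of_one_le_right hcA hE1)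
        _ = _ := by ring
    · have hmm : mV ≤ max U (U ^ (1 - θ)) := max_rpow_mono hθ.le hV0.le hUV
      have h4 : 1 ≤ D * (c' * max U (U ^ (1 - θ))) := by
        have h5 : 1 / (D * mV) ≤ c' := le_add_of_nonneg_left hc0
        rw [div_le_iff₀ (by positivity)] at h5
        calc (1 : ℝ) ≤ c' * (D * mV) := h5
          _ ≤ c' * (D * max U (U ^ (1 - θ))) := by gcongr
          _ = _ := by ring
      calc ‖F₂ r - F₁ r‖ ≤ 2 * σ := hw hF₁ hF₂ hr
        _ ≤ 1 * (2 * σ ^ 2 + 1) := by nlinarith [sq_nonneg (σ - 1), sq_nonneg σ]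
        _ ≤ D * (c' * max U (U ^ (1 - θ))) * (2 * σ ^ 2 + 1) := by gcongr
        _ = D * (c' * max U (U ^ (1 - θ)) * (2 * σ ^ 2 + 1)) := by ring
        _ ≤ D * E := by gcongr; linarith
        _ ≤ (D + c' * max U (U ^ (1 - θ)) * A σ U) * E := by gcongr; linarith

end

end

end CahnHilliard

namespace CahnHilliard

noncomputable section

/-! ### The nonlinearity on Besov spaces -/

/-- The products and the embedding that enter the nonlinearity. -/
structure ProductMaps {d : ℕ} (χ : DyadicPartition d) (α γ : ℝ) where
  /-- the product on `𝒞^α` -/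
  sq : Bes χ α →L[ℝ] Bes χ α →L[ℝ] Bes χ α
  /-- the product `𝒞^α × 𝒞^{-γ} → 𝒞^{-γ}` -/
  act : Bes χ α →L[ℝ] Bes χ (-γ) →L[ℝ] Bes χ (-γ)
  /-- the embedding -/
  incl : Bes χ α →L[ℝ] Bes χ (-γ)
  sq_val : ∀ f g, (sq f g).val = χ.mul f.val g.val
  act_val : ∀ f g, (act f g).val = χ.mul f.val g.val
  incl_val : ∀ f, (incl f).val = f.val

lemma nonempty_productMaps {d : ℕ} (χ : DyadicPartition d) {α γ : ℝ} (hγ : 0 < γ) (hγα : γ < α)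
    (hγ2 : γ < 2) : Nonempty (ProductMaps χ α γ) := by
  obtain ⟨D, -, hD⟩ := χ.exists_mul_bound (hγ.trans hγα)
  obtain ⟨D', -, hD'⟩ := χ.exists_mul_bound_neg hγ hγα hγ2
  obtain ⟨m, hm⟩ := χ.exists_mulCLM hD
  obtain ⟨m', hm'⟩ := χ.exists_mulCLM hD'
  obtain ⟨J, hJ⟩ := Bes.exists_inclusion (χ := χ) (show -γ ≤ α by linarith)
  exact ⟨⟨m, m', J, hm, hm', hJ⟩⟩

namespace ProductMaps

variable {d : ℕ} {χ : DyadicPartition d} {α γ : ℝ}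

/-- The nonlinearity `x³ + 3x²a + 3xb + c - x - a`. -/
def nonlin (m : ProductMaps χ α γ) (x : Bes χ α) (a b c : Bes χ (-γ)) : Bes χ (-γ) :=
  m.incl (m.sq (m.sq x x) x) + (3 : ℝ) • m.act (m.sq x x) a + (3 : ℝ) • m.act x b + c -
    m.incl x - a

lemma nonlin_val (m : ProductMaps χ α γ) (x : Bes χ α) (a b c : Bes χ (-γ)) :
    (m.nonlin x a b c).val = χ.nonlin x.val a.val b.val c.val := by
  rw [nonlin, map_sub, map_sub, map_add, map_add, map_add, map_smul, map_smul, m.incl_val,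
    m.incl_val, m.sq_val, m.sq_val, m.act_val, m.sq_val, m.act_val, DyadicPartition.nonlin]

lemma exists_norm_nonlin_sub_le_left (m : ProductMaps χ α γ) (R A : ℝ) :
    ∃ L : ℝ, 0 ≤ L ∧ ∀ (x x' : Bes χ α) (a b c : Bes χ (-γ)), ‖x‖ ≤ R → ‖x'‖ ≤ R → ‖a‖ ≤ A →
      ‖b‖ ≤ A → ‖m.nonlin x a b c - m.nonlin x' a b c‖ ≤ L * ‖x - x'‖ := by
  refine ⟨‖m.incl‖ * (3 * (‖m.sq‖ ^ 2 * |R| ^ 2)) + 3 * (2 * (‖m.act‖ * ‖m.sq‖ * |R| * |A|)) +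
    3 * (‖m.act‖ * |A|) + ‖m.incl‖, by positivity, fun x x' a b c hx hx' ha hb => ?_⟩
  replace hx := hx.trans (le_abs_self R)
  replace hx' := hx'.trans (le_abs_self R)
  replace ha := ha.trans (le_abs_self A)
  replace hb := hb.trans (le_abs_self A)
  -- The cube and the square are telescoped one factor at a time, so commutativity of the product is
  -- not needed.
  have h : m.nonlin x a b c - m.nonlin x' a b c =
      m.incl (m.sq (m.sq x x) (x - x') + m.sq (m.sq x (x - x')) x' + m.sq (m.sq (x - x') x') x') +
      (3 : ℝ) • (m.act (m.sq x (x - x')) a + m.act (m.sq (x - x') x') a) +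
      (3 : ℝ) • m.act (x - x') b - m.incl (x - x') := by
    simp only [nonlin, map_add, map_sub, sub_apply]
    module
  set w := x - x' with hw
  have h2 (f g : Bes χ α) {A B : ℝ} (hf : ‖f‖ ≤ A) (hg : ‖g‖ ≤ B) :
      ‖m.sq f g‖ ≤ ‖m.sq‖ * A * B := by
    have := (norm_nonneg f).trans hf
    exact (m.sq.le_opNorm₂ f g).trans (by gcongr)
  have h3 (f : Bes χ α) (g : Bes χ (-γ)) {A B : ℝ} (hf : ‖f‖ ≤ A) (hg : ‖g‖ ≤ B) :
      ‖m.act f g‖ ≤ ‖m.act‖ * A * B := by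
    have := (norm_nonneg f).trans hf
    exact (m.act.le_opNorm₂ f g).trans (by gcongr)
  have e1 := h2 _ _ (h2 _ _ hx hx) (le_refl ‖w‖)
  have e2 := h2 _ _ (h2 _ _ hx (le_refl ‖w‖)) hx'
  have e3 := h2 _ _ (h2 _ _ (le_refl ‖w‖) hx') hx'
  have e4 := h3 _ _ (h2 _ _ hx (le_refl ‖w‖)) ha
  have e5 := h3 _ _ (h2 _ _ (le_refl ‖w‖) hx') ha
  have e6 := h3 _ _ (le_refl ‖w‖) hb
  have e7 := m.incl.le_opNorm w
  have e8 := m.incl.le_opNorm_of_le (norm_add₃_le.trans (add_le_add_three e1 e2 e3))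
  have h3' (y : Bes χ (-γ)) {B : ℝ} (hy : ‖y‖ ≤ B) : ‖(3 : ℝ) • y‖ ≤ 3 * B := by
    rw [norm_smul, Real.norm_ofNat]
    gcongr
  have e9 := h3' _ ((norm_add_le _ _).trans (add_le_add e4 e5))
  have e10 := h3' _ e6
  rw [h]
  refine (norm_sub_le _ _).trans ((add_le_add (norm_add₃_le.trans (add_le_add_three e8 e9 e10))
    e7).trans (le_of_eq ?_))
  ring

/-- The nonlinearity is affine in (a, b, c). The weight σ² + 1 comes from the two occurrences of a,
in 3x²a and in -a. -/
lemma exists_norm_nonlin_sub_le_right (m : ProductMaps χ α γ) :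
    ∃ Q : ℝ, 0 ≤ Q ∧ ∀ (x : Bes χ α) (a b c a' b' c' : Bes χ (-γ)) (σ A B E : ℝ), ‖x‖ ≤ σ →
      ‖a' - a‖ ≤ A → ‖b' - b‖ ≤ B → ‖c' - c‖ ≤ E →
      ‖m.nonlin x a' b' c' - m.nonlin x a b c‖ ≤ Q * ((σ ^ 2 + 1) * A + σ * B + E) := by
  refine ⟨3 * (‖m.act‖ * ‖m.sq‖) + 3 * ‖m.act‖ + 1, by positivity,
    fun x a b c a' b' c' σ A B E hx ha hb hc => ?_⟩
  have h : m.nonlin x a' b' c' - m.nonlin x a b c =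
      (3 : ℝ) • m.act (m.sq x x) (a' - a) + (3 : ℝ) • m.act x (b' - b) + (c' - c) - (a' - a) := by
    simp only [nonlin, map_sub]
    module
  have hσ := (norm_nonneg x).trans hx
  have hA := (norm_nonneg _).trans ha
  have hB := (norm_nonneg _).trans hb
  have hE := (norm_nonneg _).trans hc
  have e0 : ‖m.sq x x‖ ≤ ‖m.sq‖ * σ * σ := (m.sq.le_opNorm₂ x x).trans (by gcongr)
  have e1 : ‖(3 : ℝ) • m.act (m.sq x x) (a' - a)‖ ≤ 3 * (‖m.act‖ * (‖m.sq‖ * σ * σ) * A) := by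
    rw [norm_smul, Real.norm_ofNat]
    refine mul_le_mul_of_nonneg_left ((m.act.le_opNorm₂ _ _).trans ?_) zero_le_three
    gcongr
  have e2 : ‖(3 : ℝ) • m.act x (b' - b)‖ ≤ 3 * (‖m.act‖ * σ * B) := by
    rw [norm_smul, Real.norm_ofNat]
    refine mul_le_mul_of_nonneg_left ((m.act.le_opNorm₂ _ _).trans ?_) zero_le_three
    gcongr
  rw [h]
  refine (norm_sub_le _ _).trans ((add_le_add (norm_add₃_le.trans (add_le_add_three e1 e2 hc))
    ha).trans ?_)
  have k1 : 0 ≤ ‖m.act‖ * ‖m.sq‖ := by positivity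
  have k2 : 0 ≤ ‖m.act‖ := by positivity
  have k3 : 0 ≤ σ * B := by positivity
  have k4 : 0 ≤ σ ^ 2 * A := by positivity
  have k5 : 0 ≤ ‖m.act‖ * ‖m.sq‖ * (σ * B) := by positivity
  have k6 : 0 ≤ ‖m.act‖ * ‖m.sq‖ * E := by positivity
  have k7 : 0 ≤ ‖m.act‖ * ‖m.sq‖ * A := by positivity
  have k8 : 0 ≤ ‖m.act‖ * (σ ^ 2 * A) := by positivity
  have k9 : 0 ≤ ‖m.act‖ * E := by positivity
  have k10 : 0 ≤ ‖m.act‖ * A := by positivity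
  linarith

lemma locLip (m : ProductMaps χ α γ) {a b c : ℝ → Bes χ (-γ)} (ha : ContinuousOn a (Set.Ici 0))
    (hb : ContinuousOn b (Set.Ici 0)) (hc : ContinuousOn c (Set.Ici 0)) :
    LocLip fun (q : ℝ) (x : little χ α) => m.nonlin x.1 (a q) (b q) (c q) := by
  refine ⟨fun x => ?_, fun U R => ?_⟩
  · have h1 := (m.act (m.sq x.1 x.1)).continuous.comp_continuousOn ha
    have h2 := (m.act x.1).continuous.comp_continuousOn hb
    exact ((((continuousOn_const.add (h1.const_smul (3 : ℝ))).add (h2.const_smul (3 : ℝ))).add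
      hc).sub continuousOn_const).sub ha
  · have hss : Set.Icc 0 U ⊆ Set.Ici 0 := fun q hq => hq.1
    obtain ⟨A, hA⟩ := isCompact_Icc.exists_bound_of_continuousOn (ha.mono hss)
    obtain ⟨B, hB⟩ := isCompact_Icc.exists_bound_of_continuousOn (hb.mono hss)
    obtain ⟨L, hL0, hL⟩ := m.exists_norm_nonlin_sub_le_left R (max A B)
    exact ⟨L, hL0, fun q hq x x' hx hx' => hL x.1 x'.1 _ _ _ hx hx'
      ((hA q hq).trans (le_max_left _ _)) ((hB q hq).trans (le_max_right _ _))⟩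

end ProductMaps

/-! ### From distributions to the normed spaces -/

lemma DyadicPartition.exists_smoothingPair {d : ℕ} (χ : DyadicPartition d) {α γ : ℝ}
    (h0 : 0 ≤ α + 2 + γ) (h4 : α + 2 + γ < 4) :
    ∃ (P : ℝ → little χ α →L[ℝ] little χ α) (K : ℝ → Bes χ (-γ) →L[ℝ] little χ α) (M C : ℝ),
      SmoothingPair P K M C ((α + 2 + γ) / 4) ∧
      (∀ r f, (P r f).1.val = semigroup r f.1.val) ∧
      ∀ r, 0 < r → ∀ f, (K r f).1.val = semigroup r (lap f.val) := by
  obtain ⟨P, M, hP, hM⟩ := χ.exists_semigroupCLM α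
  obtain ⟨K, C, hC0, hK, hKC⟩ := χ.exists_semigroupLapCLM h0 h4
  refine ⟨P, K, M, C, ⟨by linarith, by linarith, hC0, hM, fun x => ?_, fun r s hr hs x => ?_,
    χ.tendsto_semigroup hP, hKC, fun r s hr hs y => ?_⟩, hP, hK⟩
  · refine Subtype.ext (Bes.ext_val ?_)
    rw [hP, semigroup_of_nonpos le_rfl]
  · refine Subtype.ext (Bes.ext_val ?_)
    rw [hP, hP, hP, χ.semigroup_semigroup hr hs]
  · refine Subtype.ext (Bes.ext_val ?_)
    rw [hP, hK s hs, hK (r + s) (by linarith), χ.semigroup_semigroup hr hs.le]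

open Classical in
/-- An element of `𝒞^β`, as an element of the normed space `little χ β`. -/
def toLittle {d : ℕ} (χ : DyadicPartition d) (β : ℝ) (f : Dist d) : little χ β :=
  if h : χ.MemC β f then ⟨Bes.mk f h.exists_besovBound.choose_spec, h⟩ else 0

lemma toLittle_val {d : ℕ} {χ : DyadicPartition d} {β : ℝ} {f : Dist d} (h : χ.MemC β f) :
    (toLittle χ β f).1.val = f := by
  rw [toLittle, dif_pos h]
  rfl

lemma Bes.ofReal_norm_sub {d : ℕ} {χ : DyadicPartition d} {β : ℝ} (f g : Bes χ β) :
    ENNReal.ofReal ‖f - g‖ = χ.besov β (f.val - g.val) := by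
  rw [Bes.ofReal_norm_eq, map_sub]

/-- Continuity in `𝒞^β` is continuity in the normed space. -/
lemma tendsto_besov_sub_iff {d : ℕ} {χ : DyadicPartition d} {β : ℝ} {ι : Type*} {l : Filter ι}
    {F : ι → Bes χ β} {G : Bes χ β} : Tendsto (fun s => χ.besov β ((F s).val - G.val)) l (𝓝 0) ↔
      Tendsto F l (𝓝 G) := by
  rw [tendsto_iff_norm_sub_tendsto_zero]
  simp only [← Bes.ofReal_norm_sub]
  constructor
  · intro h
    have := (ENNReal.tendsto_toReal ENNReal.zero_ne_top).comp h
    refine this.congr fun s => ?_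
    exact ENNReal.toReal_ofReal (norm_nonneg _)
  · intro h
    simpa using ENNReal.tendsto_ofReal h

lemma DyadicPartition.MemCC.continuousOn {d : ℕ} {χ : DyadicPartition d} {U β : ℝ}
    {f : ℝ → Dist d} (h : χ.MemCC U β f) :
    ContinuousOn (fun t => toLittle χ β (f t)) (Set.Icc 0 U) := by
  intro t ht
  refine tendsto_subtype_rng.2 (tendsto_besov_sub_iff.1 ((h.2 t ht).congr' ?_))
  filter_upwards [self_mem_nhdsWithin] with s hs
  rw [toLittle_val (h.1 s hs), toLittle_val (h.1 t ht)]

lemma memCC_of_continuousOn {d : ℕ} {χ : DyadicPartition d} {U β : ℝ} {F : ℝ → little χ β}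
    (h : ContinuousOn F (Set.Icc 0 U)) : χ.MemCC U β fun t => (F t).1.val :=
  ⟨fun t _ => (F t).2, fun t ht => tendsto_besov_sub_iff.2 (tendsto_subtype_rng.1 (h t ht))⟩

/-- A continuous path in `𝒞^β`, as a continuous path in the normed space. -/
lemma exists_lift {d : ℕ} {χ : DyadicPartition d} {β : ℝ} {g : ℝ → Dist d}
    (h : ∀ U, 0 ≤ U → χ.MemCC U β g) :
    ∃ G : ℝ → Bes χ β, ContinuousOn G (Set.Ici 0) ∧ ∀ t, 0 ≤ t → (G t).val = g t := by
  refine ⟨fun t => (toLittle χ β (g t)).1, fun t ht => ?_, fun t ht =>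
    toLittle_val ((h t ht).1 t ⟨ht, le_rfl⟩)⟩
  have ht' : 0 ≤ t := ht
  have h1 := ((h (t + 1) (by linarith)).continuousOn t ⟨ht, by linarith⟩).mono_of_mem_nhdsWithin
    (s := Set.Ici 0) (by
      filter_upwards [self_mem_nhdsWithin, mem_nhdsWithin_of_mem_nhds (gt_mem_nhds (lt_add_one t))]
        with s hs hs'
      exact ⟨hs, le_of_lt hs'⟩)
  exact tendsto_subtype_rng.1 h1

lemma supBesov_le_iff {d : ℕ} {χ : DyadicPartition d} {U β σ : ℝ} {F : ℝ → Bes χ β}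
    {f : ℝ → Dist d} (hF : ∀ t ∈ Set.Icc 0 U, (F t).val = f t) (hσ : 0 ≤ σ) :
    χ.supBesov U β f ≤ ENNReal.ofReal σ ↔ ∀ t ∈ Set.Icc 0 U, ‖F t‖ ≤ σ := by
  rw [DyadicPartition.supBesov, iSup₂_le_iff]
  refine forall₂_congr fun t ht => ?_
  rw [← hF t ht, ← Bes.ofReal_norm_eq, ENNReal.ofReal_le_ofReal_iff hσ]

lemma supBesov_ne_top {d : ℕ} {χ : DyadicPartition d} {U β : ℝ} {F : ℝ → Bes χ β}
    {f : ℝ → Dist d} (hFc : ContinuousOn F (Set.Icc 0 U))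
    (hF : ∀ t ∈ Set.Icc 0 U, (F t).val = f t) : χ.supBesov U β f ≠ ⊤ := by
  obtain ⟨B, hB⟩ := isCompact_Icc.exists_bound_of_continuousOn hFc
  have h1 : χ.supBesov U β f ≤ ENNReal.ofReal |B| :=
    (supBesov_le_iff hF (abs_nonneg B)).2 fun t ht => (hB t ht).trans (le_abs_self B)
  exact (h1.trans_lt ENNReal.ofReal_lt_top).ne

lemma norm_le_supBesov {d : ℕ} {χ : DyadicPartition d} {U β : ℝ} {F : ℝ → Bes χ β}
    {f : ℝ → Dist d} (hFc : ContinuousOn F (Set.Icc 0 U))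
    (hF : ∀ t ∈ Set.Icc 0 U, (F t).val = f t) :
    ∀ t ∈ Set.Icc 0 U, ‖F t‖ ≤ (χ.supBesov U β f).toReal :=
  (supBesov_le_iff hF ENNReal.toReal_nonneg).1
    (ENNReal.ofReal_toReal (supBesov_ne_top hFc hF)).ge

lemma monotone_supBesov {d : ℕ} {χ : DyadicPartition d} {β : ℝ} {F : ℝ → Bes χ β}
    {f : ℝ → Dist d} (hFc : ContinuousOn F (Set.Ici 0)) (hF : ∀ t, 0 ≤ t → (F t).val = f t) :
    Monotone fun U => (χ.supBesov U β f).toReal := fun _ V h =>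
  ENNReal.toReal_mono (supBesov_ne_top (hFc.mono fun q (hq : q ∈ Set.Icc 0 V) => hq.1)
    fun t ht => hF t ht.1) (biSup_mono fun _ hr => ⟨hr.1, hr.2.trans h⟩)

end

end CahnHilliard

namespace CahnHilliard

noncomputable section

/-! ### Weak and strong mild solutions -/

section

variable {d : ℕ} {χ : DyadicPartition d} {α γ : ℝ} {P : ℝ → little χ α →L[ℝ] little χ α}
  {K : ℝ → Bes χ (-γ) →L[ℝ] little χ α} {M C θ : ℝ}

/-- The Duhamel integral can be tested under the integral sign. -/
lemma SmoothingPair.duhamel_apply (H : SmoothingPair P K M C θ) (hα : -2 < α)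
    (hK : ∀ r, 0 < r → ∀ f, (K r f).1.val = semigroup r (lap f.val)) {h : ℝ → Bes χ (-γ)}
    {r : ℝ} (hr : 0 ≤ r) (hh : ContinuousOn h (Set.Icc 0 r)) (φ : TestFun d) :
    IntervalIntegrable (fun q => (semigroup (r - q) (lap (h q).val)).1 φ) volume 0 r ∧
    (duhamel K h r).1.val.1 φ =
      ∫ q in (0 : ℝ)..r, (semigroup (r - q) (lap (h q).val)).1 φ := by
  have := completeSpace_little χ hα
  obtain ⟨e, he⟩ := Bes.exists_eval (χ := χ) hα φ
  set e' : little χ α →L[ℝ] ℝ := e ∘L (little χ α).subtypeL with he'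
  have hint := H.intervalIntegrable_kernel hr hh
  -- The right endpoint must be excluded: K is identified with P_rΔ for positive times only.
  have heq : ∀ q ∈ Set.Ioo 0 r,
      e' (K (r - q) (h q)) = (semigroup (r - q) (lap (h q).val)).1 φ := fun q hq => by
    rw [← hK _ (sub_pos.2 hq.2), ← he]
    rfl
  have hint' : IntervalIntegrable (fun q => e' (K (r - q) (h q))) volume 0 r :=
    ⟨e'.integrable_comp hint.1, e'.integrable_comp hint.2⟩
  constructor
  · rw [intervalIntegrable_iff_integrableOn_Ioo_of_le hr] at hint' ⊢
    exact hint'.congr_fun heq measurableSet_Ioo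
  · have h1 : (duhamel K h r).1.val.1 φ = e' (duhamel K h r) := (he _).symm
    rw [h1, duhamel, ← e'.intervalIntegral_comp_comm hint, intervalIntegral.integral_of_le hr,
      intervalIntegral.integral_of_le hr, integral_Ioc_eq_integral_Ioo,
      integral_Ioc_eq_integral_Ioo]
    exact setIntegral_congr_fun measurableSet_Ioo heq

/-- Existence and uniqueness of a maximal solution. -/
lemma SmoothingPair.exists_uniqueMildSolution (H : SmoothingPair P K M C θ) (hα : -2 < α)
    (hP : ∀ r f, (P r f).1.val = semigroup r f.1.val)
    (hK : ∀ r, 0 < r → ∀ f, (K r f).1.val = semigroup r (lap f.val))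
    (m : ProductMaps χ α γ) {A B E : ℝ → Bes χ (-γ)} (hA : ContinuousOn A (Set.Ici 0))
    (hB : ContinuousOn B (Set.Ici 0)) (hE : ContinuousOn E (Set.Ici 0)) {a b c : ℝ → Dist d}
    (hAa : ∀ t, 0 ≤ t → (A t).val = a t) (hBb : ∀ t, 0 ≤ t → (B t).val = b t)
    (hEc : ∀ t, 0 ≤ t → (E t).val = c t) (x₀ : little χ α) :
    ∃ (β : ℝ≥0∞) (F : ℝ → little χ α), 0 < β ∧
      (∀ T, 0 ≤ T → ENNReal.ofReal T < β →
        IsMild P K (fun q x => m.nonlin x.1 (A q) (B q) (E q)) x₀ T F) ∧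
      χ.IsUniqueMildSolution α x₀.1.val a b c β (fun t => (F t).1.val) ∧
      χ.BlowsUpAt α β (fun t => (F t).1.val) := by
  have := completeSpace_little χ hα
  have hN := m.locLip hA hB hE
  set N : ℝ → little χ α → Bes χ (-γ) := fun q x => m.nonlin x.1 (A q) (B q) (E q) with hNdef
  have hNval (q : ℝ) (hq : 0 ≤ q) (x : little χ α) :
      (N q x).val = χ.nonlin x.1.val (a q) (b q) (c q) := by
    rw [hNdef, m.nonlin_val, hAa q hq, hBb q hq, hEc q hq]
  obtain ⟨β, F, hβ, hF, hblow⟩ := H.exists_maximal hN x₀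
  have key {f : ℝ → little χ α} {r : ℝ} (hr : 0 ≤ r) (hf : ContinuousOn f (Set.Icc 0 r))
      (φ : TestFun d) : IntervalIntegrable (fun q =>
        (semigroup (r - q) (lap (χ.nonlin (f q).1.val (a q) (b q) (c q)))).1 φ) volume 0 r ∧
      (P r x₀ + duhamel K (fun q => N q (f q)) r).1.val.1 φ = (semigroup r x₀.1.val).1 φ +
        ∫ q in (0 : ℝ)..r,
          (semigroup (r - q) (lap (χ.nonlin (f q).1.val (a q) (b q) (c q)))).1 φ := by
    obtain ⟨h1, h2⟩ := H.duhamel_apply hα hK hr (hN.comp hf) φ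
    have heq : ∀ q ∈ Set.uIcc 0 r, (semigroup (r - q) (lap (N q (f q)).val)).1 φ =
        (semigroup (r - q) (lap (χ.nonlin (f q).1.val (a q) (b q) (c q)))).1 φ := fun q hq => by
      rw [Set.uIcc_of_le hr] at hq
      rw [hNval q hq.1]
    refine ⟨h1.congr_uIoo fun q hq => heq q (Set.Ioo_subset_Icc_self hq), ?_⟩
    rw [← intervalIntegral.integral_congr heq, ← h2, ← hP]
    rfl
  refine ⟨β, F, hβ, hF, ⟨⟨fun U hU hUβ => memCC_of_continuousOn (hF U hU hUβ).continuousOn,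
    fun r hr hrβ φ => ?_⟩, fun h hh r hr hrβ => ?_⟩, fun htop => ?_⟩
  · obtain ⟨h1, h2⟩ := key hr (hF r hr hrβ).continuousOn φ
    refine ⟨h1, ?_⟩
    change (F r).1.val.1 φ = _
    rw [← h2, (hF r hr hrβ).eq r ⟨hr, le_rfl⟩]
  -- Any solution in the tested sense lifts to a mild solution in the normed space, because
  -- distributions are determined by testing; uniqueness there transfers back.
  · have hG : IsMild P K N x₀ r fun t => toLittle χ α (h t) := by
      have hMC := hh.1 r hr hrβ
      refine ⟨hMC.continuousOn, fun t ht => Subtype.ext (Bes.ext_val (Subtype.ext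
        (LinearMap.ext fun φ => ?_)))⟩
      have htβ : ENNReal.ofReal t < β := (ENNReal.ofReal_le_ofReal ht.2).trans_lt hrβ
      rw [(key ht.1 (hh.1 t ht.1 htβ).continuousOn φ).2, toLittle_val (hMC.1 t ht),
        (hh.2 t ht.1 htβ φ).2]
      congr 1
      refine intervalIntegral.integral_congr fun q hq => ?_
      rw [Set.uIcc_of_le ht.1] at hq
      rw [toLittle_val (hMC.1 q ⟨hq.1, hq.2.trans ht.2⟩)]
    have h1 := hG.unique H hN (hF r hr hrβ) (show r ∈ Set.Icc 0 r from ⟨hr, le_rfl⟩)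
    change h r = (F r).1.val
    rw [← h1, toLittle_val ((hh.1 r hr hrβ).1 r ⟨hr, le_rfl⟩)]
  · have h1 := ENNReal.tendsto_ofReal_atTop.comp (hblow htop)
    refine h1.congr fun q => ?_
    exact (F q).1.ofReal_norm_eq

end

end

end CahnHilliard

/-! ### Assembly of the theorem -/

theorem mainTheorem3 (χ : CahnHilliard.DyadicPartition 4) (α : ℝ) (hα0 : 0 < α) (hα2 : α < 2)
    (g₁ g₅ : CahnHilliard.Dist 4) (g₂ g₃ g₄ g₆ g₇ g₈ : ℝ → CahnHilliard.Dist 4)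
    (hg₁ : χ.MemC α g₁) (hg₅ : χ.MemC α g₅)
    (hg₂ : ∀ U ε : ℝ, 0 ≤ U → 0 < ε → χ.MemCC U (-ε) g₂)
    (hg₃ : ∀ U ε : ℝ, 0 ≤ U → 0 < ε → χ.MemCC U (-ε) g₃)
    (hg₄ : ∀ U ε : ℝ, 0 ≤ U → 0 < ε → χ.MemCC U (-ε) g₄)
    (hg₆ : ∀ U ε : ℝ, 0 ≤ U → 0 < ε → χ.MemCC U (-ε) g₆)
    (hg₇ : ∀ U ε : ℝ, 0 ≤ U → 0 < ε → χ.MemCC U (-ε) g₇)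
    (hg₈ : ∀ U ε : ℝ, 0 ≤ U → 0 < ε → χ.MemCC U (-ε) g₈) :
    ∃ (c γ₁ γ₂ : ℝ) (β₁ β₂ : ℝ≥0∞),
      0 < c ∧ 0 < γ₁ ∧ 0 < γ₂ ∧ γ₂ < 1 ∧ 0 < β₁ ∧ 0 < β₂ ∧
      ∃ f₁ f₂ : ℝ → CahnHilliard.Dist 4,
        χ.IsUniqueMildSolution α g₁ g₂ g₃ g₄ β₁ f₁ ∧ χ.BlowsUpAt α β₁ f₁ ∧
        χ.IsUniqueMildSolution α g₅ g₆ g₇ g₈ β₂ f₂ ∧ χ.BlowsUpAt α β₂ f₂ ∧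
        ∀ σ U : ℝ, 0 ≤ σ → 0 ≤ U → ENNReal.ofReal U < min β₁ β₂ →
          max (χ.supBesov U α f₁) (χ.supBesov U α f₂) ≤ ENNReal.ofReal σ →
          χ.supBesov U α (f₂ - f₁) ≤ ENNReal.ofReal
            (((χ.besov α (g₅ - g₁)).toReal +
                c * max U (U ^ (1 - γ₂)) *
                  ((σ ^ 2 + 1) * (χ.supBesov U (-γ₁) (g₆ - g₂)).toReal +
                    σ * (χ.supBesov U (-γ₁) (g₇ - g₃)).toReal +
                    (χ.supBesov U (-γ₁) (g₈ - g₄)).toReal)) *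
              Real.exp (c * max U (U ^ (1 - γ₂)) *
                (2 * σ ^ 2 + 2 * σ * (χ.supBesov U (-γ₁) g₆).toReal +
                  (χ.supBesov U (-γ₁) g₇).toReal + 1))) := by
  -- Two constraints: γ < α for the product with 𝒞^{-γ}, and α + 2 + γ < 4 for an integrable
  -- singularity.
  set γ := min α (2 - α) / 2 with hγdef
  have hγ1 : γ ≤ α / 2 := by have := min_le_left α (2 - α); rw [hγdef]; linarith
  have hγ2 : γ ≤ (2 - α) / 2 := by have := min_le_right α (2 - α); rw [hγdef]; linarith
  have hγ0 : 0 < γ := half_pos (lt_min hα0 (by linarith))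
  have hα : -2 < α := by linarith
  obtain ⟨m⟩ := CahnHilliard.nonempty_productMaps χ hγ0 (α := α) (by linarith) (by linarith)
  obtain ⟨P, K, M, C, H, hP, hK⟩ := χ.exists_smoothingPair (α := α) (γ := γ) (by linarith)
    (by linarith)
  obtain ⟨G₂, hG₂, hGg₂⟩ := CahnHilliard.exists_lift fun U hU => hg₂ U γ hU hγ0
  obtain ⟨G₃, hG₃, hGg₃⟩ := CahnHilliard.exists_lift fun U hU => hg₃ U γ hU hγ0
  obtain ⟨G₄, hG₄, hGg₄⟩ := CahnHilliard.exists_lift fun U hU => hg₄ U γ hU hγ0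
  obtain ⟨G₆, hG₆, hGg₆⟩ := CahnHilliard.exists_lift fun U hU => hg₆ U γ hU hγ0
  obtain ⟨G₇, hG₇, hGg₇⟩ := CahnHilliard.exists_lift fun U hU => hg₇ U γ hU hγ0
  obtain ⟨G₈, hG₈, hGg₈⟩ := CahnHilliard.exists_lift fun U hU => hg₈ U γ hU hγ0
  set x₁ := CahnHilliard.toLittle χ α g₁ with hx₁
  set x₂ := CahnHilliard.toLittle χ α g₅ with hx₂
  have hxg₁ : x₁.1.val = g₁ := CahnHilliard.toLittle_val hg₁
  have hxg₂ : x₂.1.val = g₅ := CahnHilliard.toLittle_val hg₅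
  obtain ⟨β₁, F₁, hβ₁, hF₁, hsol₁, hblow₁⟩ := H.exists_uniqueMildSolution hα hP hK m hG₂ hG₃ hG₄
    hGg₂ hGg₃ hGg₄ x₁
  obtain ⟨β₂, F₂, hβ₂, hF₂, hsol₂, hblow₂⟩ := H.exists_uniqueMildSolution hα hP hK m hG₆ hG₇ hG₈
    hGg₆ hGg₇ hGg₈ x₂
  rw [hxg₁] at hsol₁
  rw [hxg₂] at hsol₂
  obtain ⟨Q, hQ0, hQ⟩ := m.exists_norm_nonlin_sub_le_right
  obtain ⟨B, hB0, hB⟩ := χ.exists_norm_semigroup_le hP (x₂ - x₁)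
  have hsub {G G' : ℝ → CahnHilliard.Bes χ (-γ)} {g g' : ℝ → CahnHilliard.Dist 4}
      (h : ∀ t, 0 ≤ t → (G t).val = g t) (h' : ∀ t, 0 ≤ t → (G' t).val = g' t) (t : ℝ)
      (ht : 0 ≤ t) : (G t - G' t).val = (g - g') t := by
    rw [map_sub, h t ht, h' t ht]
    rfl
  have hbd {G : ℝ → CahnHilliard.Bes χ (-γ)} {g : ℝ → CahnHilliard.Dist 4}
      (hG : ContinuousOn G (Set.Ici 0)) (h : ∀ t, 0 ≤ t → (G t).val = g t) (U : ℝ) :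
      ∀ q ∈ Set.Icc 0 U, ‖G q‖ ≤ (χ.supBesov U (-γ) g).toReal :=
    CahnHilliard.norm_le_supBesov (hG.mono fun q (hq : q ∈ Set.Icc 0 U) => hq.1)
      fun t ht => h t ht.1
  obtain ⟨c, hc0, hc⟩ := CahnHilliard.exists_stability H (m.locLip hG₂ hG₃ hG₄)
    (m.locLip hG₆ hG₇ hG₈) (x₁ := x₁) (x₂ := x₂) hQ0
    (a := fun U => (χ.supBesov U (-γ) (g₆ - g₂)).toReal)
    (b := fun U => (χ.supBesov U (-γ) (g₇ - g₃)).toReal)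
    (e := fun U => (χ.supBesov U (-γ) (g₈ - g₄)).toReal)
    (fun _ => ENNReal.toReal_nonneg) (fun _ => ENNReal.toReal_nonneg)
    (fun _ => ENNReal.toReal_nonneg)
    (CahnHilliard.monotone_supBesov (hG₆.sub hG₂) (hsub hGg₆ hGg₂))
    (CahnHilliard.monotone_supBesov (hG₇.sub hG₃) (hsub hGg₇ hGg₃))
    (CahnHilliard.monotone_supBesov (hG₈.sub hG₄) (hsub hGg₈ hGg₄))
    (fun σ U _ q hq x hx => hQ x.1 _ _ _ _ _ _ σ _ _ _ hx
      (hbd (hG₆.sub hG₂) (hsub hGg₆ hGg₂) U q hq) (hbd (hG₇.sub hG₃) (hsub hGg₇ hGg₃) U q hq)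
      (hbd (hG₈.sub hG₄) (hsub hGg₈ hGg₄) U q hq))
    hB0 hB (lt_min hβ₁ hβ₂) (fun T hT h => hF₁ T hT (h.trans_le (min_le_left _ _)))
    (fun T hT h => hF₂ T hT (h.trans_le (min_le_right _ _)))
  -- γ₁ is the negative regularity in use, and γ₂ is the order θ of the singularity, so U^{1-γ₂} is
  -- the scaling of its integral.
  refine ⟨c, γ, (α + 2 + γ) / 4, β₁, β₂, hc0, hγ0, by linarith, by linarith, hβ₁, hβ₂, _, _,
    hsol₁, hblow₁, hsol₂, hblow₂, fun σ U hσ hU hUβ hmax => ?_⟩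
  have hFσ₁ := (CahnHilliard.supBesov_le_iff (F := fun t => (F₁ t).1) (fun t _ => rfl) hσ).1
    ((le_max_left _ _).trans hmax)
  have hFσ₂ := (CahnHilliard.supBesov_le_iff (F := fun t => (F₂ t).1) (fun t _ => rfl) hσ).1
    ((le_max_right _ _).trans hmax)
  have hD : (χ.besov α (g₅ - g₁)).toReal = ‖x₂ - x₁‖ := by
    rw [← hxg₁, ← hxg₂, ← CahnHilliard.Bes.ofReal_norm_sub,
      ENNReal.toReal_ofReal (norm_nonneg _)]
    rfl
  have hm0 : 0 ≤ max U (U ^ (1 - (α + 2 + γ) / 4)) := hU.trans (le_max_left _ _)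
  rw [CahnHilliard.supBesov_le_iff (F := fun t => (F₂ t).1 - (F₁ t).1) (fun t _ => by
    rw [map_sub]; rfl) (by positivity), hD]
  intro t ht
  refine (hc σ U hσ hU hUβ hFσ₁ hFσ₂ t ht).trans ?_
  have h6 : 0 ≤ (χ.supBesov U (-γ) g₆).toReal := ENNReal.toReal_nonneg
  have h7 : 0 ≤ (χ.supBesov U (-γ) g₇).toReal := ENNReal.toReal_nonneg
  have h8 : 0 ≤ 2 * σ * (χ.supBesov U (-γ) g₆).toReal := by positivity
  -- `exists_stability` gives a smaller exponent; the terms with g₆ and g₇ are nonnegative and only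
  -- enlarge the right side.
  refine mul_le_mul_of_nonneg_left (Real.exp_le_exp.2 ?_) (by positivity)
  refine mul_le_mul_of_nonneg_left ?_ (by positivity)
  linarith
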